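/- Work in the first-order language of set theory with the single non-logical symbol $\in$, and let $\Delta_0=\Sigma_0=\Pi_0,\Sigma_1,\Pi_1,\dots$ be the L\'evy classes of formulas. Let $\mathbf{M}$ be the theory with axioms extensionality, emptyset, pair, union, set difference, powerset, transitive containment (every set is a subset of a transitive set), infinity, set foundation (every nonempty set has an $\in$-minimal element) and the scheme of $\Delta_0$-separation. Let $\mathrm{Z}$ be the theory obtained from $\mathbf{M}$ by removing transitive containment and adding separation for all formulas. For a class $\Gamma$ of formulas, consider the following schemes, for all $\phi\in\Gamma$. $\Gamma$-collection is $\forall \vec z\,\forall w\,\bigl((\forall x\in w)\exists y\,\phi(x,y,\vec z)\Rightarrow \exists C(\forall x\in w)(\exists y\in C)\phi(x,y,\vec z)\bigr)$. Strong $\Gamma$-collection is $\forall \vec z\,\forall w\,\exists C(\forall x\in w)\bigl(\exists y\,\phi(x,y,\vec z)\Rightarrow(\exists y\in C)\phi(x,y,\vec z)\bigr)$. $\Gamma$-induction on $\omega$ is $\forall\vec z\,\bigl(\phi(\emptyset,\vec z)\wedge(\forall n\in\omega)(\phi(n,\vec z)\Rightarrow\phi(n+1,\vec z))\Rightarrow(\forall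 n\in\omega)\phi(n,\vec z)\bigr)$. Theorem: Let $m\ge 1$. The theory $\mathbf{M}+\Pi_{m+1}\text{-collection}+\Sigma_{m+2}\text{-induction on }\omega$ proves the sentence of set theory which says, with formulas coded by sets and satisfaction formalized inside the theory: there is an ordinal $\beta$ such that $V_\beta$ exists, is transitive, and $\langle V_\beta,\in\rangle$ is a model of $\mathrm{Z}+\text{strong }\Pi_m\text{-collection}$; moreover, $V_\beta$ is the union of a sequence $\langle V_{\gamma_n}\mid n\in\omega\rangle$ of nonempty sets with $V_{\gamma_n}\in V_{\gamma_{n+1}}$ for all $n\in\omega$, each $V_{\gamma_n}$ being a $\Pi_m$-elementary submodel of the universe, that is, for every coded $\Pi_m$-formula and all parameters from $V_{\gamma_n}$, the formula holds in $\langle V_{\gamma_n},\in\rangle$ if and only if it holds in the universe, in the sense of the partial satisfaction predicate $\mathrm{Sat}_{\Pi_m}$. -/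

import Mathlib

open FirstOrder FirstOrder.Language

namespace FOSet

/-! ## The language of set theory -/

/-- The only symbol of the language of set theory is a binary relation symbol. -/
inductive SetRel : ℕ → Type
  | mem : SetRel 2

/-- The first-order language of set theory. -/
def setLang : FirstOrder.Language.{0, 0} := ⟨fun _ => Empty, SetRel⟩

/-- Formulas of set theory whose free variables are numbered by `Fin n`. -/
abbrev Fml (n : ℕ) : Type := setLang.BoundedFormula Empty n

/-! ## The Levy hierarchy -/

/-- A variable, as a term. -/
def tv {α : Type} {n : ℕ} (x : α ⊕ Fin n) : setLang.Term (α ⊕ Fin n) := Term.var x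

/-- The atomic formula `x ∈ y`. -/
def memB {α : Type} {n : ℕ} (x y : α ⊕ Fin n) : setLang.BoundedFormula α n :=
  BoundedFormula.rel (L := setLang) SetRel.mem ![tv x, tv y]

/-- A variable seen under one more quantifier. -/
def up {α : Type} {n : ℕ} (x : α ⊕ Fin n) : α ⊕ Fin (n + 1) := Sum.map id Fin.castSucc x

/-- The variable bound by the innermost quantifier. -/
def newVar {α : Type} {n : ℕ} : α ⊕ Fin (n + 1) := Sum.inr (Fin.last n)

/-- `Δ₀`-formulas: closed under the connectives (`⊥` and `→` generate them) and under the
bounded quantifiers `∀ x ∈ y` and `∃ x ∈ y`, where `y` is a variable other than `x`. -/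
inductive IsDelta0 {α : Type} : ∀ {n : ℕ}, setLang.BoundedFormula α n → Prop
  | falsum {n : ℕ} : IsDelta0 (BoundedFormula.falsum (n := n))
  | equal {n : ℕ} (t s : setLang.Term (α ⊕ Fin n)) : IsDelta0 (BoundedFormula.equal t s)
  | rel {n l : ℕ} (R : setLang.Relations l) (ts : Fin l → setLang.Term (α ⊕ Fin n)) :
      IsDelta0 (BoundedFormula.rel R ts)
  | imp {n : ℕ} {φ ψ : setLang.BoundedFormula α n} :
      IsDelta0 φ → IsDelta0 ψ → IsDelta0 (φ.imp ψ)
  | ball {n : ℕ} (y : α ⊕ Fin n) {φ : setLang.BoundedFormula α (n + 1)} :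
      IsDelta0 φ → IsDelta0 (BoundedFormula.all ((memB newVar (up y)).imp φ))
  | bex {n : ℕ} (y : α ⊕ Fin n) {φ : setLang.BoundedFormula α (n + 1)} :
      IsDelta0 φ → IsDelta0 (BoundedFormula.ex (memB newVar (up y) ⊓ φ))

/-- The two sides of the Levy hierarchy. -/
inductive Side
  | sigma
  | pi

/-- The other side. -/
def Side.swap : Side → Side
  | .sigma => .pi
  | .pi => .sigma

/-- The Levy classes: `Σ₀ = Π₀ = Δ₀`, a `Σ_{k+1}`-formula is a (possibly empty) block of
existential quantifiers in front of a `Π_k`-formula, and dually. -/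
inductive IsLevy {α : Type} : Side → ℕ → ∀ {n : ℕ}, setLang.BoundedFormula α n → Prop
  | zero (s : Side) {n : ℕ} {φ : setLang.BoundedFormula α n} : IsDelta0 φ → IsLevy s 0 φ
  | next (s : Side) (k : ℕ) {n : ℕ} {φ : setLang.BoundedFormula α n} :
      IsLevy s.swap k φ → IsLevy s (k + 1) φ
  | ex (k : ℕ) {n : ℕ} {φ : setLang.BoundedFormula α (n + 1)} :
      IsLevy .sigma (k + 1) φ → IsLevy .sigma (k + 1) φ.ex
  | all (k : ℕ) {n : ℕ} {φ : setLang.BoundedFormula α (n + 1)} :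
      IsLevy .pi (k + 1) φ → IsLevy .pi (k + 1) φ.all

/-! ## Writing formulas

Quantifiers take the body as a function of the bound variable; variables are moved under
further quantifiers by a coercion. -/

section Formulas

/-- A variable keeps its number under a further quantifier. -/
@[reducible] def liftVar (n : ℕ) : Coe (Fin n) (Fin (n + 1)) := ⟨Fin.castSucc⟩

attribute [local instance] liftVar

def memF {n : ℕ} (x y : Fin n) : Fml n := memB (Sum.inr x) (Sum.inr y)
def eqF {n : ℕ} (x y : Fin n) : Fml n := BoundedFormula.equal (tv (Sum.inr x)) (tv (Sum.inr y))
def notF {n : ℕ} (φ : Fml n) : Fml n := BoundedFormula.not φ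
def andF {n : ℕ} (φ ψ : Fml n) : Fml n := φ ⊓ ψ
def orF {n : ℕ} (φ ψ : Fml n) : Fml n := φ ⊔ ψ
def impF {n : ℕ} (φ ψ : Fml n) : Fml n := BoundedFormula.imp φ ψ
def iffF {n : ℕ} (φ ψ : Fml n) : Fml n := BoundedFormula.iff φ ψ
def allF {n : ℕ} (φ : Fin (n + 1) → Fml (n + 1)) : Fml n := BoundedFormula.all (φ (Fin.last n))
def exF {n : ℕ} (φ : Fin (n + 1) → Fml (n + 1)) : Fml n := BoundedFormula.ex (φ (Fin.last n))

infix:80 " ∊ " => memF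
infix:80 " ≐ " => eqF
infixr:70 " ⋏ " => andF
infixr:65 " ⋎ " => orF
infixr:60 " ⟶ₛ " => impF
infix:55 " ⟷ₛ " => iffF

/-- `∀ y ∈ x, φ y` -/
def allIn {n : ℕ} (x : Fin n) (φ : Fin (n + 1) → Fml (n + 1)) : Fml n :=
  allF fun y => y ∊ x ⟶ₛ φ y

/-- `∃ y ∈ x, φ y` -/
def exIn {n : ℕ} (x : Fin n) (φ : Fin (n + 1) → Fml (n + 1)) : Fml n :=
  exF fun y => y ∊ x ⋏ φ y

/-- The formula `φ` with its free variables replaced by the variables `g`. -/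
def inst {k l : ℕ} (φ : setLang.Formula (Fin k)) (g : Fin k → Fin l) : Fml l :=
  BoundedFormula.relabel (n := l) (fun i => Sum.inr (g i)) φ

/-- The universal closure. -/
def closure {n : ℕ} (φ : Fml n) : setLang.Sentence := BoundedFormula.alls φ

/-! ## Basic set-theoretic notions, as formulas -/

/-- `x ⊆ y` -/
def subF {n : ℕ} (x y : Fin n) : Fml n := allIn x fun z => z ∊ y

/-- `x = ∅` -/
def isEmpty {n : ℕ} (x : Fin n) : Fml n := allF fun z => notF (z ∊ x)

/-- `s = x ∪ {x}` -/
def isSucc {n : ℕ} (x s : Fin n) : Fml n := allF fun z => z ∊ s ⟷ₛ (z ∊ x ⋎ z ≐ x)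

/-- `x` is transitive. -/
def isTrans {n : ℕ} (x : Fin n) : Fml n := allIn x fun y => allIn y fun z => z ∊ x

/-- `x` is an ordinal: a transitive set of transitive sets. -/
def isOrd {n : ℕ} (x : Fin n) : Fml n := isTrans x ⋏ allIn x fun y => isTrans y

/-- `x` is empty or a successor. -/
def isZeroOrSucc {n : ℕ} (x : Fin n) : Fml n := isEmpty x ⋎ exIn x fun y => isSucc y x

/-- `x ∈ ω` -/
def isNat {n : ℕ} (x : Fin n) : Fml n :=
  isOrd x ⋏ isZeroOrSucc x ⋏ allIn x fun y => isZeroOrSucc y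

/-- `p = {x, y}` -/
def isUPair {n : ℕ} (p x y : Fin n) : Fml n := allF fun z => z ∊ p ⟷ₛ (z ≐ x ⋎ z ≐ y)

/-- `p = ⟨x, y⟩ = {{x}, {x, y}}` -/
def isPair {n : ℕ} (p x y : Fin n) : Fml n :=
  exF fun a => exF fun b => isUPair a x x ⋏ isUPair b x y ⋏ isUPair p a b

/-- `⟨x, y⟩ ∈ r`; when `r` is a function, `r(x) = y`. -/
def app {n : ℕ} (r x y : Fin n) : Fml n := exF fun p => isPair p x y ⋏ p ∊ r

/-- `f` is a function with domain `d`. -/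
def isFunOn {n : ℕ} (f d : Fin n) : Fml n :=
  (allIn f fun p => exF fun x => exF fun y => x ∊ d ⋏ isPair p x y) ⋏
  (allIn d fun x => exF fun y => app f x y ⋏ allF fun z => app f x z ⟶ₛ z ≐ y)

/-- `f` is a function with domain `ω`. -/
def isSeq {n : ℕ} (f : Fin n) : Fml n :=
  (allIn f fun p => exF fun x => exF fun y => isNat x ⋏ isPair p x y) ⋏
  (allF fun x => isNat x ⟶ₛ exF fun y => app f x y ⋏ allF fun z => app f x z ⟶ₛ z ≐ y)

/-- `x = V_β`, for an ordinal `β`: there is a function `F` on `β ∪ {β}` such that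
`F(γ) = ⋃_{δ ∈ γ} 𝒫(F(δ))` for every `γ` in its domain, and `F(β) = x`. -/
def isV {n : ℕ} (β x : Fin n) : Fml n :=
  exF fun F => exF fun s => isSucc β s ⋏ isFunOn F s ⋏
    (allIn s fun γ => allF fun y => app F γ y ⟶ₛ
      allF fun z => z ∊ y ⟷ₛ exIn γ fun δ => exF fun u => app F δ u ⋏ subF z u) ⋏
    app F β x

/-! ## The axioms -/

/-- Extensionality. -/
def axExt : setLang.Sentence :=
  closure (n := 0) (allF fun x => allF fun y => (allF fun z => z ∊ x ⟷ₛ z ∊ y) ⟶ₛ x ≐ y)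

/-- Emptyset. -/
def axEmpty : setLang.Sentence := closure (n := 0) (exF fun x => isEmpty x)

/-- Pair. -/
def axPair : setLang.Sentence :=
  closure (n := 0) (allF fun x => allF fun y => exF fun p => isUPair p x y)

/-- Union. -/
def axUnion : setLang.Sentence :=
  closure (n := 0) (allF fun x => exF fun u => allF fun z => z ∊ u ⟷ₛ exIn x fun y => z ∊ y)

/-- Set difference. -/
def axDiff : setLang.Sentence :=
  closure (n := 0) (allF fun x => allF fun y => exF fun d => allF fun z =>
    z ∊ d ⟷ₛ (z ∊ x ⋏ notF (z ∊ y)))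

/-- Powerset. -/
def axPower : setLang.Sentence :=
  closure (n := 0) (allF fun x => exF fun p => allF fun z => z ∊ p ⟷ₛ subF z x)

/-- Infinity. -/
def axInf : setLang.Sentence :=
  closure (n := 0) (exF fun x => (exIn x fun e => isEmpty e) ⋏
    allIn x fun y => exIn x fun s => isSucc y s)

/-- Set foundation. -/
def axFound : setLang.Sentence :=
  closure (n := 0) (allF fun z => (exF fun x => x ∊ z) ⟶ₛ
    exIn z fun y => allIn y fun x => notF (x ∊ z))

/-- Transitive containment. -/
def axTCo : setLang.Sentence :=
  closure (n := 0) (allF fun x => exF fun y => isTrans y ⋏ subF x y)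

/-- Separation for `φ(x, z⃗)`. -/
def sepInst {k : ℕ} (φ : setLang.Formula (Fin (k + 1))) : setLang.Sentence :=
  closure (n := k) (allF fun w => exF fun y => allF fun x =>
    x ∊ y ⟷ₛ (x ∊ w ⋏ inst φ (Fin.cons x fun i : Fin k => i)))

/-- Collection for `φ(x, y, z⃗)`. -/
def collInst {k : ℕ} (φ : setLang.Formula (Fin (k + 2))) : setLang.Sentence :=
  closure (n := k) (allF fun w =>
    (allIn w fun x => exF fun y => inst φ (Fin.cons x (Fin.cons y fun i : Fin k => i))) ⟶ₛ
    exF fun C => allIn w fun x => exIn C fun y =>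
      inst φ (Fin.cons x (Fin.cons y fun i : Fin k => i)))

/-- Induction on `ω` for `φ(x, z⃗)`. -/
def indInst {k : ℕ} (φ : setLang.Formula (Fin (k + 1))) : setLang.Sentence :=
  closure (n := k)
    (((exF fun e => isEmpty e ⋏ inst φ (Fin.cons e fun i : Fin k => i)) ⋏
      (allF fun x => isNat x ⟶ₛ inst φ (Fin.cons x fun i : Fin k => i) ⟶ₛ
        exF fun s => isSucc x s ⋏ inst φ (Fin.cons s fun i : Fin k => i))) ⟶ₛ
    allF fun x => isNat x ⟶ₛ inst φ (Fin.cons x fun i : Fin k => i))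

/-- The theory `M`. -/
def theoryM : setLang.Theory :=
  {axExt, axEmpty, axPair, axUnion, axDiff, axPower, axTCo, axInf, axFound} ∪
  {σ | ∃ (k : ℕ) (φ : setLang.Formula (Fin (k + 1))), IsDelta0 φ ∧ σ = sepInst φ}

/-- `Π_m`-collection. -/
def piCollection (m : ℕ) : setLang.Theory :=
  {σ | ∃ (k : ℕ) (φ : setLang.Formula (Fin (k + 2))), IsLevy .pi m φ ∧ σ = collInst φ}

/-- `Σ_m`-induction on `ω`. -/
def sigmaInduction (m : ℕ) : setLang.Theory :=
  {σ | ∃ (k : ℕ) (φ : setLang.Formula (Fin (k + 1))), IsLevy .sigma m φ ∧ σ = indInst φ}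

/-! ## Formulas inside set theory

Formulas with variables `v_i`, `i ∈ ω`, are coded by sets:
`⌜v_i ∈ v_j⌝ = ⟨0, ⟨i, j⟩⟩`, `⌜v_i = v_j⌝ = ⟨1, ⟨i, j⟩⟩`, `⌜¬φ⌝ = ⟨2, ⌜φ⌝⟩`,
`⌜φ ∧ ψ⌝ = ⟨3, ⟨⌜φ⌝, ⌜ψ⌝⟩⟩`, `⌜∃ v_i φ⌝ = ⟨4, ⟨i, ⌜φ⌝⟩⟩`, `⌜∀ v_i φ⌝ = ⟨5, ⟨i, ⌜φ⌝⟩⟩`. -/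

/-- `x` is the natural number `k`. -/
def isNum : ℕ → ∀ {n : ℕ}, Fin n → Fml n
  | 0, _, x => isEmpty x
  | k + 1, _, x => exF fun y => isNum k y ⋏ isSucc y x

/-- `c = ⟨k, q⟩` -/
def tagged {n : ℕ} (k : ℕ) (c q : Fin n) : Fml n := exF fun t => isNum k t ⋏ isPair c t q

/-- `c = ⟨k, ⟨a, b⟩⟩` -/
def tagged₂ {n : ℕ} (k : ℕ) (c a b : Fin n) : Fml n := exF fun q => isPair q a b ⋏ tagged k c q

/-- `c = ⌜v_i ∈ v_j⌝` -/
def cMem {n : ℕ} (c i j : Fin n) : Fml n := isNat i ⋏ isNat j ⋏ tagged₂ 0 c i j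

/-- `c = ⌜v_i = v_j⌝` -/
def cEq {n : ℕ} (c i j : Fin n) : Fml n := isNat i ⋏ isNat j ⋏ tagged₂ 1 c i j

/-- `c = ⌜¬d⌝` -/
def cNot {n : ℕ} (c d : Fin n) : Fml n := tagged 2 c d

/-- `c = ⌜d ∧ e⌝` -/
def cAnd {n : ℕ} (c d e : Fin n) : Fml n := tagged₂ 3 c d e

/-- `c = ⌜∃ v_i d⌝` -/
def cEx {n : ℕ} (c i d : Fin n) : Fml n := isNat i ⋏ tagged₂ 4 c i d

/-- `c = ⌜∀ v_i d⌝` -/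
def cAll {n : ℕ} (c i d : Fin n) : Fml n := isNat i ⋏ tagged₂ 5 c i d

/-- `c = ⌜∃ v_i (v_i ∈ v_j ∧ d)⌝`, where `i ≠ j` -/
def cBEx {n : ℕ} (c i j d : Fin n) : Fml n :=
  notF (i ≐ j) ⋏ exF fun e => exF fun g => cMem e i j ⋏ cAnd g e d ⋏ cEx c i g

/-- `c = ⌜∀ v_i ¬(v_i ∈ v_j ∧ ¬d)⌝`, where `i ≠ j` -/
def cBAll {n : ℕ} (c i j d : Fin n) : Fml n :=
  notF (i ≐ j) ⋏ exF fun e => exF fun d' => exF fun g => exF fun h =>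
    cMem e i j ⋏ cNot d' d ⋏ cAnd g e d' ⋏ cNot h g ⋏ cAll c i h

/-- `c` codes an atomic formula. -/
def cAtomic {n : ℕ} (c : Fin n) : Fml n := exF fun i => exF fun j => cMem c i j ⋎ cEq c i j

/-- Every element of `C` is atomic, or is built from elements of `C` by `¬`, `∧`, `∃`, `∀`. -/
def formClosed {n : ℕ} (C : Fin n) : Fml n :=
  allIn C fun c => cAtomic c ⋎ (exIn C fun d => cNot c d) ⋎
    (exIn C fun d => exIn C fun e => cAnd c d e) ⋎
    (exF fun i => exIn C fun d => cEx c i d ⋎ cAll c i d)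

/-- `c` codes a `Δ₀`-formula. By foundation, the components of an element of `C` lead down to
atomic formulas in finitely many steps. -/
def isDelta0Code {n : ℕ} (c : Fin n) : Fml n :=
  exF fun C => c ∊ C ⋏ allIn C fun c => cAtomic c ⋎ (exIn C fun d => cNot c d) ⋎
    (exIn C fun d => exIn C fun e => cAnd c d e) ⋎
    (exF fun i => exF fun j => exIn C fun d => cBEx c i j d ⋎ cBAll c i j d)

/-- `c` is `⌜∃ v_i d⌝` or `⌜∀ v_i d⌝`, according to the side of the hierarchy. -/
def cQuant {n : ℕ} : Side → Fin n → Fin n → Fin n → Fml n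
  | .sigma, c, i, d => cEx c i d
  | .pi, c, i, d => cAll c i d

/-- `c` codes a `Σ_k`-formula (or a `Π_k`-formula): a block of quantifiers in front of a formula
of the other class one level below. -/
def isLevyCode : ℕ → Side → ∀ {n : ℕ}, Fin n → Fml n
  | 0, _, _, c => isDelta0Code c
  | k + 1, s, _, c => exF fun C => c ∊ C ⋏ allIn C fun c =>
      isLevyCode k s.swap c ⋎ (exF fun i => exIn C fun d => cQuant s c i d)

/-! ## Satisfaction inside set theory

Assignments are functions with domain `ω`. -/

/-- `a` is an assignment with values in `N`. -/
def isAsg {n : ℕ} (a N : Fin n) : Fml n :=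
  isSeq a ⋏ allF fun i => allF fun x => app a i x ⟶ₛ x ∊ N

/-- `b` is the assignment `a[i ↦ x]`. -/
def isUpd {n : ℕ} (a i x b : Fin n) : Fml n :=
  isSeq b ⋏ app b i x ⋏
    allF fun k => notF (k ≐ i) ⟶ₛ allF fun y => app b k y ⟷ₛ app a k y

/-- The relation `S` obeys Tarski's clauses for `⟨N, ∈⟩` and the formulas in `C`;
`⟨c, a⟩ ∈ S` says that `⟨N, ∈⟩ ⊨ c[a]`. -/
def isTarski {n : ℕ} (N C S : Fin n) : Fml n :=
  allIn C fun c => allF fun a => isAsg a N ⟶ₛ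
    ((allF fun i => allF fun j => cMem c i j ⟶ₛ
      (app S c a ⟷ₛ exF fun x => exF fun y => app a i x ⋏ app a j y ⋏ x ∊ y)) ⋏
    (allF fun i => allF fun j => cEq c i j ⟶ₛ
      (app S c a ⟷ₛ exF fun x => exF fun y => app a i x ⋏ app a j y ⋏ x ≐ y)) ⋏
    (allF fun d => cNot c d ⟶ₛ (app S c a ⟷ₛ notF (app S d a))) ⋏
    (allF fun d => allF fun e => cAnd c d e ⟶ₛ (app S c a ⟷ₛ (app S d a ⋏ app S e a))) ⋏
    (allF fun i => allF fun d => cEx c i d ⟶ₛ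
      (app S c a ⟷ₛ exIn N fun x => exF fun b => isUpd a i x b ⋏ app S d b)) ⋏
    (allF fun i => allF fun d => cAll c i d ⟶ₛ
      (app S c a ⟷ₛ allIn N fun x => allF fun b => isUpd a i x b ⟶ₛ app S d b)))

/-- `c` codes a formula. -/
def isForm {n : ℕ} (c : Fin n) : Fml n := exF fun C => c ∊ C ⋏ formClosed C

/-- `⟨N, ∈⟩ ⊨ c[a]` -/
def sat {n : ℕ} (N c a : Fin n) : Fml n :=
  exF fun C => exF fun S => c ∊ C ⋏ formClosed C ⋏ isTarski N C S ⋏ app S c a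

/-- `c` is a block of quantifiers (existential or universal, according to the side) in front of
`d`, and `b` is an assignment that arises from `a` by giving values to the variables of the block
one after the other. The set `R` collects the stages. -/
def isBlock {n : ℕ} (s : Side) (c a d b : Fin n) : Fml n :=
  exF fun R => app R c a ⋏ allF fun c' => allF fun a' => app R c' a' ⟶ₛ
    ((c' ≐ d ⋏ a' ≐ b) ⋎
      exF fun i => exF fun e => exF fun x => exF fun a'' =>
        cQuant s c' i e ⋏ isUpd a' i x a'' ⋏ app R e a'')

/-- `Sat_{Σ_k}(c, a)` and `Sat_{Π_k}(c, a)`: the `Σ_k`-formula (or `Π_k`-formula) `c` holds in the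
universe under the assignment `a`. -/
def satV : ℕ → Side → ∀ {n : ℕ}, Fin n → Fin n → Fml n
  | 0, _, _, c, a => isDelta0Code c ⋏ exF fun N => isTrans N ⋏ isAsg a N ⋏ sat N c a
  | k + 1, .sigma, _, c, a => exF fun d => exF fun b =>
      isLevyCode k .pi d ⋏ isBlock .sigma c a d b ⋏ satV k .pi d b
  | k + 1, .pi, _, c, a => isLevyCode (k + 1) .pi c ⋏ allF fun d => allF fun b =>
      (isLevyCode k .sigma d ⋏ isBlock .pi c a d b) ⟶ₛ satV k .sigma d b

/-- The nonempty set `N` is a `Π_m`-elementary submodel of the universe. -/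
def isPiElem {n : ℕ} (m : ℕ) (N : Fin n) : Fml n :=
  (exF fun x => x ∊ N) ⋏ allF fun c => allF fun a => (isLevyCode m .pi c ⋏ isAsg a N) ⟶ₛ
    (sat N c a ⟷ₛ satV m .pi c a)

/-! ## Transitive models -/

/-- The relativization of a formula to a set `N`: all quantifiers range over `N`, which is the
only free variable added. -/
def relativize : ∀ {n : ℕ}, Fml n → setLang.BoundedFormula (Fin 1) n
  | _, .falsum => .falsum
  | _, .equal t s => .equal (t.relabel (Sum.map Empty.elim id)) (s.relabel (Sum.map Empty.elim id))
  | _, .rel R ts => .rel R fun i => (ts i).relabel (Sum.map Empty.elim id)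
  | _, .imp φ ψ => .imp (relativize φ) (relativize ψ)
  | _, .all φ => .all ((memB newVar (Sum.inl 0)).imp (relativize φ))

/-- `⟨N, ∈⟩ ⊨ σ`, for a sentence `σ`. -/
def models {n : ℕ} (N : Fin n) (σ : setLang.Sentence) : Fml n := inst (relativize σ) fun _ => N

/-- `⟨N, ∈⟩ ⊨ c[a(i/x)]` -/
def sat₁ {n : ℕ} (N c a i x : Fin n) : Fml n := exF fun b => isUpd a i x b ⋏ sat N c b

/-- `⟨N, ∈⟩ ⊨ c[a(i/x)(j/y)]` -/
def sat₂ {n : ℕ} (N c a i x j y : Fin n) : Fml n := exF fun b => isUpd a i x b ⋏ sat₁ N c b j y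

/-- `⟨N, ∈⟩` satisfies separation for all formulas: for every formula `c`, every variable `v_i`
and all values of the other variables. -/
def modelsSep {n : ℕ} (N : Fin n) : Fml n :=
  allF fun c => allF fun a => allF fun i => (isForm c ⋏ isAsg a N ⋏ isNat i) ⟶ₛ
    allIn N fun w => exIn N fun y => allIn N fun x => x ∊ y ⟷ₛ (x ∊ w ⋏ sat₁ N c a i x)

/-- `⟨N, ∈⟩` satisfies `Π_m`-collection: for every `Π_m`-formula `c`, any two variables `v_i` and
`v_j`, and all values of the other variables. -/
def modelsColl {n : ℕ} (m : ℕ) (N : Fin n) : Fml n :=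
  allF fun c => allF fun a => allF fun i => allF fun j =>
    (isLevyCode m .pi c ⋏ isAsg a N ⋏ isNat i ⋏ isNat j ⋏ notF (i ≐ j)) ⟶ₛ
    allIn N fun w =>
      (allIn N fun x => x ∊ w ⟶ₛ exIn N fun y => sat₂ N c a i x j y) ⟶ₛ
      exIn N fun C => allIn N fun x => x ∊ w ⟶ₛ exIn N fun y => y ∊ C ⋏ sat₂ N c a i x j y

/-- `⟨N, ∈⟩` satisfies strong `Π_m`-collection. -/
def modelsStrongColl {n : ℕ} (m : ℕ) (N : Fin n) : Fml n :=
  allF fun c => allF fun a => allF fun i => allF fun j =>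
    (isLevyCode m .pi c ⋏ isAsg a N ⋏ isNat i ⋏ isNat j ⋏ notF (i ≐ j)) ⟶ₛ
    allIn N fun w => exIn N fun C => allIn N fun x => x ∊ w ⟶ₛ
      (exIn N fun y => sat₂ N c a i x j y) ⟶ₛ
      exIn N fun y => y ∊ C ⋏ sat₂ N c a i x j y

/-- `⟨N, ∈⟩` satisfies Zermelo set theory `Z`. -/
def modelsZ {n : ℕ} (N : Fin n) : Fml n :=
  models N axExt ⋏ models N axEmpty ⋏ models N axPair ⋏ models N axUnion ⋏ models N axDiff ⋏
  models N axPower ⋏ models N axInf ⋏ models N axFound ⋏ modelsSep N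

/-- `N` is the union of a strictly increasing `ω`-sequence of sets `V_γ` that are `Π_m`-elementary
submodels of the universe. -/
def isPiElemChainUnion {n : ℕ} (m : ℕ) (N : Fin n) : Fml n :=
  exF fun f => isSeq f ⋏
    (allF fun i => allF fun x => app f i x ⟶ₛ
      (isPiElem m x ⋏ exF fun γ => isOrd γ ⋏ isV γ x)) ⋏
    (allF fun i => allF fun j => allF fun x => allF fun y =>
      (isSucc i j ⋏ app f i x ⋏ app f j y) ⟶ₛ x ∊ y) ⋏
    (allF fun z => z ∊ N ⟷ₛ exF fun i => exF fun x => app f i x ⋏ z ∊ x)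

/-- Some `V_β` is a transitive model of `Z`, of `Π_m`-collection and of strong `Π_m`-collection,
and it is the union of an increasing `ω`-sequence of `Π_m`-elementary sets `V_γ`. -/
def transitiveModelSentence (m : ℕ) : setLang.Sentence :=
  closure (n := 0) (exF fun β => exF fun N => isOrd β ⋏ isV β N ⋏ isTrans N ⋏
    modelsZ N ⋏ modelsColl m N ⋏ modelsStrongColl m N ⋏ isPiElemChainUnion m N)

end Formulas

end FOSet

namespace FOSet

section Semantics

variable {M : Type} [setLang.Structure M]

/-- The membership relation of a structure for the language of set theory. -/
def E (x y : M) : Prop := Structure.RelMap (L := setLang) (SetRel.mem : setLang.Relations 2) ![x, y]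

infix:50 " ε " => E

/-! ## The meaning of the formulas -/

def Sub (x y : M) : Prop := ∀ z, z ε x → z ε y
def Emp (x : M) : Prop := ∀ z, ¬ z ε x
def IsSuc (x s : M) : Prop := ∀ z, z ε s ↔ (z ε x ∨ z = x)
def Tr (x : M) : Prop := ∀ y, y ε x → ∀ z, z ε y → z ε x
def Ordl (x : M) : Prop := Tr x ∧ ∀ y, y ε x → Tr y
def ZS (x : M) : Prop := Emp x ∨ ∃ y, y ε x ∧ IsSuc y x
def Nt (x : M) : Prop := Ordl x ∧ ZS x ∧ ∀ y, y ε x → ZS y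
def UP (p x y : M) : Prop := ∀ z, z ε p ↔ (z = x ∨ z = y)
def PR (p x y : M) : Prop := ∃ a b, UP a x x ∧ UP b x y ∧ UP p a b
def Ap (r x y : M) : Prop := ∃ p, PR p x y ∧ p ε r
def FunOn (f d : M) : Prop :=
  (∀ p, p ε f → ∃ x y, x ε d ∧ PR p x y) ∧
  (∀ x, x ε d → ∃ y, Ap f x y ∧ ∀ z, Ap f x z → z = y)
def SeqS (f : M) : Prop :=
  (∀ p, p ε f → ∃ x y, Nt x ∧ PR p x y) ∧
  (∀ x, Nt x → ∃ y, Ap f x y ∧ ∀ z, Ap f x z → z = y)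
def VV (β x : M) : Prop :=
  ∃ F s, IsSuc β s ∧ FunOn F s ∧
    (∀ γ, γ ε s → ∀ y, Ap F γ y → ∀ z, z ε y ↔ ∃ δ, δ ε γ ∧ ∃ u, Ap F δ u ∧ Sub z u) ∧
    Ap F β x
def Num : ℕ → M → Prop
  | 0, x => Emp x
  | k + 1, x => ∃ y, Num k y ∧ IsSuc y x
def Tag (k : ℕ) (c q : M) : Prop := ∃ t, Num k t ∧ PR c t q
def Tag2 (k : ℕ) (c a b : M) : Prop := ∃ q, PR q a b ∧ Tag k c q
def CMem (c i j : M) : Prop := Nt i ∧ Nt j ∧ Tag2 0 c i j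
def CEq (c i j : M) : Prop := Nt i ∧ Nt j ∧ Tag2 1 c i j
def CNot (c d : M) : Prop := Tag 2 c d
def CAnd (c d e : M) : Prop := Tag2 3 c d e
def CEx (c i d : M) : Prop := Nt i ∧ Tag2 4 c i d
def CAll (c i d : M) : Prop := Nt i ∧ Tag2 5 c i d
def CBEx (c i j d : M) : Prop := ¬ i = j ∧ ∃ e g, CMem e i j ∧ CAnd g e d ∧ CEx c i g
def CBAll (c i j d : M) : Prop := ¬ i = j ∧ ∃ e d' g h,
  CMem e i j ∧ CNot d' d ∧ CAnd g e d' ∧ CNot h g ∧ CAll c i h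
def CAtomic (c : M) : Prop := ∃ i j, CMem c i j ∨ CEq c i j
def FormClosed (C : M) : Prop :=
  ∀ c, c ε C → CAtomic c ∨ (∃ d, d ε C ∧ CNot c d) ∨
    (∃ d, d ε C ∧ ∃ e, e ε C ∧ CAnd c d e) ∨
    (∃ i d, d ε C ∧ (CEx c i d ∨ CAll c i d))
def D0Closed (C : M) : Prop :=
  ∀ c, c ε C → CAtomic c ∨ (∃ d, d ε C ∧ CNot c d) ∨
    (∃ d, d ε C ∧ ∃ e, e ε C ∧ CAnd c d e) ∨
    (∃ i j d, d ε C ∧ (CBEx c i j d ∨ CBAll c i j d))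
def D0Code (c : M) : Prop := ∃ C, c ε C ∧ D0Closed C
def CQuant : Side → M → M → M → Prop
  | .sigma, c, i, d => CEx c i d
  | .pi, c, i, d => CAll c i d
def LevyCode : ℕ → Side → M → Prop
  | 0, _, c => D0Code c
  | k + 1, s, c => ∃ C, c ε C ∧ ∀ c, c ε C →
      LevyCode k s.swap c ∨ (∃ i d, d ε C ∧ CQuant s c i d)
def Asg (a N : M) : Prop := SeqS a ∧ ∀ i x, Ap a i x → x ε N
def Upd (a i x b : M) : Prop := SeqS b ∧ Ap b i x ∧ ∀ k, ¬ k = i → ∀ y, Ap b k y ↔ Ap a k y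
def Tarski (N C S : M) : Prop :=
  ∀ c, c ε C → ∀ a, Asg a N →
    ((∀ i j, CMem c i j → (Ap S c a ↔ ∃ x y, Ap a i x ∧ Ap a j y ∧ x ε y)) ∧
    (∀ i j, CEq c i j → (Ap S c a ↔ ∃ x y, Ap a i x ∧ Ap a j y ∧ x = y)) ∧
    (∀ d, CNot c d → (Ap S c a ↔ ¬ Ap S d a)) ∧
    (∀ d e, CAnd c d e → (Ap S c a ↔ (Ap S d a ∧ Ap S e a))) ∧
    (∀ i d, CEx c i d → (Ap S c a ↔ ∃ x, x ε N ∧ ∃ b, Upd a i x b ∧ Ap S d b)) ∧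
    (∀ i d, CAll c i d → (Ap S c a ↔ ∀ x, x ε N → ∀ b, Upd a i x b → Ap S d b)))
def IsForm (c : M) : Prop := ∃ C, c ε C ∧ FormClosed C
def Sat (N c a : M) : Prop := ∃ C S, c ε C ∧ FormClosed C ∧ Tarski N C S ∧ Ap S c a
def Block (s : Side) (c a d b : M) : Prop :=
  ∃ R, Ap R c a ∧ ∀ c' a', Ap R c' a' →
    ((c' = d ∧ a' = b) ∨ ∃ i e x a'', CQuant s c' i e ∧ Upd a' i x a'' ∧ Ap R e a'')
def SatV : ℕ → Side → M → M → Prop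
  | 0, _, c, a => D0Code c ∧ ∃ N, Tr N ∧ Asg a N ∧ Sat N c a
  | k + 1, .sigma, c, a => ∃ d b, LevyCode k .pi d ∧ Block .sigma c a d b ∧ SatV k .pi d b
  | k + 1, .pi, c, a => LevyCode (k + 1) .pi c ∧ ∀ d b,
      (LevyCode k .sigma d ∧ Block .pi c a d b) → SatV k .sigma d b
def PiElem (m : ℕ) (N : M) : Prop :=
  (∃ x, x ε N) ∧ ∀ c a, (LevyCode m .pi c ∧ Asg a N) → (Sat N c a ↔ SatV m .pi c a)
def Sat1 (N c a i x : M) : Prop := ∃ b, Upd a i x b ∧ Sat N c b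
def Sat2 (N c a i x j y : M) : Prop := ∃ b, Upd a i x b ∧ Sat1 N c b j y
def ModelsSep (N : M) : Prop :=
  ∀ c a i, (IsForm c ∧ Asg a N ∧ Nt i) →
    ∀ w, w ε N → ∃ y, y ε N ∧ ∀ x, x ε N → (x ε y ↔ (x ε w ∧ Sat1 N c a i x))
def ModelsColl (m : ℕ) (N : M) : Prop :=
  ∀ c a i j, (LevyCode m .pi c ∧ Asg a N ∧ Nt i ∧ Nt j ∧ ¬ i = j) →
    ∀ w, w ε N → (∀ x, x ε N → x ε w → ∃ y, y ε N ∧ Sat2 N c a i x j y) →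
      ∃ C, C ε N ∧ ∀ x, x ε N → x ε w → ∃ y, y ε N ∧ y ε C ∧ Sat2 N c a i x j y
def ModelsStrongColl (m : ℕ) (N : M) : Prop :=
  ∀ c a i j, (LevyCode m .pi c ∧ Asg a N ∧ Nt i ∧ Nt j ∧ ¬ i = j) →
    ∀ w, w ε N → ∃ C, C ε N ∧ ∀ x, x ε N → x ε w → (∃ y, y ε N ∧ Sat2 N c a i x j y) →
      ∃ y, y ε N ∧ y ε C ∧ Sat2 N c a i x j y
def ChainUnion (m : ℕ) (N : M) : Prop :=
  ∃ f, SeqS f ∧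
    (∀ i x, Ap f i x → (PiElem m x ∧ ∃ γ, Ordl γ ∧ VV γ x)) ∧
    (∀ i j x y, (IsSuc i j ∧ Ap f i x ∧ Ap f j y) → x ε y) ∧
    (∀ z, z ε N ↔ ∃ i x, Ap f i x ∧ z ε x)

section Realize

variable {n : ℕ} (v : Empty → M) (xs : Fin n → M)

attribute [local instance] liftVar

@[simp] lemma realize_memB {α : Type} (v : α → M) (xs : Fin n → M) (x y : α ⊕ Fin n) :
    (memB x y).Realize v xs ↔ Sum.elim v xs x ε Sum.elim v xs y := by
  refine iff_of_eq (congrArg (Structure.RelMap (L := setLang) (SetRel.mem : setLang.Relations 2)) ?_)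
  ext i; fin_cases i <;> rfl

@[simp] lemma realize_memF (x y : Fin n) : (x ∊ y).Realize v xs ↔ xs x ε xs y := by
  simp [memF]
@[simp] lemma realize_eqF (x y : Fin n) : (x ≐ y).Realize v xs ↔ xs x = xs y := Iff.rfl
@[simp] lemma realize_notF (φ : Fml n) : (notF φ).Realize v xs ↔ ¬ φ.Realize v xs := Iff.rfl
@[simp] lemma realize_andF (φ ψ : Fml n) :
    (φ ⋏ ψ).Realize v xs ↔ (φ.Realize v xs ∧ ψ.Realize v xs) := BoundedFormula.realize_inf
@[simp] lemma realize_orF (φ ψ : Fml n) :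
    (φ ⋎ ψ).Realize v xs ↔ (φ.Realize v xs ∨ ψ.Realize v xs) := BoundedFormula.realize_sup
@[simp] lemma realize_impF (φ ψ : Fml n) :
    (φ ⟶ₛ ψ).Realize v xs ↔ (φ.Realize v xs → ψ.Realize v xs) := Iff.rfl
@[simp] lemma realize_iffF (φ ψ : Fml n) :
    (φ ⟷ₛ ψ).Realize v xs ↔ (φ.Realize v xs ↔ ψ.Realize v xs) := BoundedFormula.realize_iff
@[simp] lemma realize_allF (φ : Fin (n + 1) → Fml (n + 1)) :
    (allF φ).Realize v xs ↔ ∀ a : M, (φ (Fin.last n)).Realize v (Fin.snoc xs a) := Iff.rfl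
@[simp] lemma realize_exF (φ : Fin (n + 1) → Fml (n + 1)) :
    (exF φ).Realize v xs ↔ ∃ a : M, (φ (Fin.last n)).Realize v (Fin.snoc xs a) :=
  BoundedFormula.realize_ex
@[simp] lemma realize_allIn (x : Fin n) (φ : Fin (n + 1) → Fml (n + 1)) :
    (allIn x φ).Realize v xs ↔
      ∀ a : M, a ε xs x → (φ (Fin.last n)).Realize v (Fin.snoc xs a) := by
  simp [allIn]
@[simp] lemma realize_exIn (x : Fin n) (φ : Fin (n + 1) → Fml (n + 1)) :
    (exIn x φ).Realize v xs ↔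
      ∃ a : M, a ε xs x ∧ (φ (Fin.last n)).Realize v (Fin.snoc xs a) := by
  simp [exIn]
lemma realize_closure (φ : Fml n) : (closure φ).Realize M ↔ ∀ xs : Fin n → M, φ.Realize default xs :=
  BoundedFormula.realize_alls
lemma realize_inst {k : ℕ} (φ : setLang.Formula (Fin k)) (g : Fin k → Fin n) :
    (inst φ g).Realize v xs ↔ φ.Realize fun i => xs (g i) := by
  rw [inst, BoundedFormula.realize_relabel, Formula.Realize, iff_iff_eq]
  congr 1
  exact Subsingleton.elim _ _

@[simp] lemma realize_subF (x y : Fin n) : (subF x y).Realize v xs ↔ Sub (xs x) (xs y) := by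
  simp [subF, Sub]
@[simp] lemma realize_isEmpty (x : Fin n) : (isEmpty x).Realize v xs ↔ Emp (xs x) := by
  simp [isEmpty, Emp]
@[simp] lemma realize_isSucc (x s : Fin n) : (isSucc x s).Realize v xs ↔ IsSuc (xs x) (xs s) := by
  simp [isSucc, IsSuc]
@[simp] lemma realize_isTrans (x : Fin n) : (isTrans x).Realize v xs ↔ Tr (xs x) := by
  simp [isTrans, Tr]
@[simp] lemma realize_isOrd (x : Fin n) : (isOrd x).Realize v xs ↔ Ordl (xs x) := by
  simp [isOrd, Ordl]
@[simp] lemma realize_isZeroOrSucc (x : Fin n) :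
    (isZeroOrSucc x).Realize v xs ↔ ZS (xs x) := by
  simp [isZeroOrSucc, ZS]
@[simp] lemma realize_isNat (x : Fin n) : (isNat x).Realize v xs ↔ Nt (xs x) := by
  simp [isNat, Nt]
@[simp] lemma realize_isUPair (p x y : Fin n) :
    (isUPair p x y).Realize v xs ↔ UP (xs p) (xs x) (xs y) := by
  simp [isUPair, UP]
@[simp] lemma realize_isPair (p x y : Fin n) :
    (isPair p x y).Realize v xs ↔ PR (xs p) (xs x) (xs y) := by
  simp [isPair, PR]
@[simp] lemma realize_app (r x y : Fin n) :
    (app r x y).Realize v xs ↔ Ap (xs r) (xs x) (xs y) := by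
  simp [app, Ap]
@[simp] lemma realize_isFunOn (f d : Fin n) :
    (isFunOn f d).Realize v xs ↔ FunOn (xs f) (xs d) := by
  simp [isFunOn, FunOn]
@[simp] lemma realize_isSeq (f : Fin n) : (isSeq f).Realize v xs ↔ SeqS (xs f) := by
  simp [isSeq, SeqS]
@[simp] lemma realize_isV (β x : Fin n) : (isV β x).Realize v xs ↔ VV (xs β) (xs x) := by
  simp [isV, VV]
@[simp] lemma realize_isNum (k : ℕ) (x : Fin n) : (isNum k x).Realize v xs ↔ Num k (xs x) := by
  induction k generalizing n with
  | zero => simp [isNum, Num]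
  | succ k ih => simp [isNum, Num, ih]
@[simp] lemma realize_tagged (k : ℕ) (c q : Fin n) :
    (tagged k c q).Realize v xs ↔ Tag k (xs c) (xs q) := by
  simp [tagged, Tag]
@[simp] lemma realize_tagged₂ (k : ℕ) (c a b : Fin n) :
    (tagged₂ k c a b).Realize v xs ↔ Tag2 k (xs c) (xs a) (xs b) := by
  simp [tagged₂, Tag2]
@[simp] lemma realize_cMem (c i j : Fin n) :
    (cMem c i j).Realize v xs ↔ CMem (xs c) (xs i) (xs j) := by
  simp [cMem, CMem]
@[simp] lemma realize_cEq (c i j : Fin n) :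
    (cEq c i j).Realize v xs ↔ CEq (xs c) (xs i) (xs j) := by
  simp [cEq, CEq]
@[simp] lemma realize_cNot (c d : Fin n) :
    (cNot c d).Realize v xs ↔ CNot (xs c) (xs d) := by
  simp [cNot, CNot]
@[simp] lemma realize_cAnd (c d e : Fin n) :
    (cAnd c d e).Realize v xs ↔ CAnd (xs c) (xs d) (xs e) := by
  simp [cAnd, CAnd]
@[simp] lemma realize_cEx (c i d : Fin n) :
    (cEx c i d).Realize v xs ↔ CEx (xs c) (xs i) (xs d) := by
  simp [cEx, CEx]
@[simp] lemma realize_cAll (c i d : Fin n) :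
    (cAll c i d).Realize v xs ↔ CAll (xs c) (xs i) (xs d) := by
  simp [cAll, CAll]
@[simp] lemma realize_cBEx (c i j d : Fin n) :
    (cBEx c i j d).Realize v xs ↔ CBEx (xs c) (xs i) (xs j) (xs d) := by
  simp [cBEx, CBEx]
@[simp] lemma realize_cBAll (c i j d : Fin n) :
    (cBAll c i j d).Realize v xs ↔ CBAll (xs c) (xs i) (xs j) (xs d) := by
  simp [cBAll, CBAll]
@[simp] lemma realize_cAtomic (c : Fin n) : (cAtomic c).Realize v xs ↔ CAtomic (xs c) := by
  simp [cAtomic, CAtomic]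
@[simp] lemma realize_formClosed (C : Fin n) :
    (formClosed C).Realize v xs ↔ FormClosed (xs C) := by
  simp [formClosed, FormClosed]
@[simp] lemma realize_isDelta0Code (c : Fin n) :
    (isDelta0Code c).Realize v xs ↔ D0Code (xs c) := by
  simp [isDelta0Code, D0Code, D0Closed]
@[simp] lemma realize_cQuant (s : Side) (c i d : Fin n) :
    (cQuant s c i d).Realize v xs ↔ CQuant s (xs c) (xs i) (xs d) := by
  cases s <;> simp [cQuant, CQuant]
@[simp] lemma realize_isLevyCode (k : ℕ) (s : Side) (c : Fin n) :
    (isLevyCode k s c).Realize v xs ↔ LevyCode k s (xs c) := by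
  induction k generalizing n s with
  | zero => simp [isLevyCode, LevyCode]
  | succ k ih => simp [isLevyCode, LevyCode, ih]
@[simp] lemma realize_isAsg (a N : Fin n) : (isAsg a N).Realize v xs ↔ Asg (xs a) (xs N) := by
  simp [isAsg, Asg]
@[simp] lemma realize_isUpd (a i x b : Fin n) :
    (isUpd a i x b).Realize v xs ↔ Upd (xs a) (xs i) (xs x) (xs b) := by
  simp [isUpd, Upd]
@[simp] lemma realize_isTarski (N C S : Fin n) :
    (isTarski N C S).Realize v xs ↔ Tarski (xs N) (xs C) (xs S) := by
  simp [isTarski, Tarski]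
@[simp] lemma realize_isForm (c : Fin n) : (isForm c).Realize v xs ↔ IsForm (xs c) := by
  simp [isForm, IsForm]
@[simp] lemma realize_sat (N c a : Fin n) :
    (sat N c a).Realize v xs ↔ Sat (xs N) (xs c) (xs a) := by
  simp [sat, Sat]
@[simp] lemma realize_isBlock (s : Side) (c a d b : Fin n) :
    (isBlock s c a d b).Realize v xs ↔ Block s (xs c) (xs a) (xs d) (xs b) := by
  simp [isBlock, Block]
@[simp] lemma realize_satV (k : ℕ) (s : Side) (c a : Fin n) :
    (satV k s c a).Realize v xs ↔ SatV k s (xs c) (xs a) := by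
  induction k generalizing n s with
  | zero => simp [satV, SatV]
  | succ k ih => cases s <;> simp [satV, SatV, ih]
@[simp] lemma realize_isPiElem (m : ℕ) (N : Fin n) :
    (isPiElem m N).Realize v xs ↔ PiElem m (xs N) := by
  simp [isPiElem, PiElem]
@[simp] lemma realize_sat₁ (N c a i x : Fin n) :
    (sat₁ N c a i x).Realize v xs ↔ Sat1 (xs N) (xs c) (xs a) (xs i) (xs x) := by
  simp [sat₁, Sat1]
@[simp] lemma realize_sat₂ (N c a i x j y : Fin n) :
    (sat₂ N c a i x j y).Realize v xs ↔
      Sat2 (xs N) (xs c) (xs a) (xs i) (xs x) (xs j) (xs y) := by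
  simp [sat₂, Sat2]
@[simp] lemma realize_modelsSep (N : Fin n) :
    (modelsSep N).Realize v xs ↔ ModelsSep (xs N) := by
  simp [modelsSep, ModelsSep]
@[simp] lemma realize_modelsColl (m : ℕ) (N : Fin n) :
    (modelsColl m N).Realize v xs ↔ ModelsColl m (xs N) := by
  simp [modelsColl, ModelsColl]
@[simp] lemma realize_modelsStrongColl (m : ℕ) (N : Fin n) :
    (modelsStrongColl m N).Realize v xs ↔ ModelsStrongColl m (xs N) := by
  simp [modelsStrongColl, ModelsStrongColl]
@[simp] lemma realize_isPiElemChainUnion (m : ℕ) (N : Fin n) :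
    (isPiElemChainUnion m N).Realize v xs ↔ ChainUnion m (xs N) := by
  simp [isPiElemChainUnion, ChainUnion]

/-- The substructure of the elements of `N`. -/
def El (N : M) : Type := {x : M // x ε N}

instance (N : M) : setLang.Structure (El N) where
  funMap f := nomatch f
  RelMap R xs := Structure.RelMap R fun i => (xs i).1

lemma El.mem_iff {N : M} (x y : El N) : x ε y ↔ x.1 ε y.1 := by
  change Structure.RelMap (L := setLang) (M := M) (SetRel.mem : setLang.Relations 2)
    (fun i => (![x, y] i).1) ↔ _
  refine iff_of_eq (congrArg (Structure.RelMap (L := setLang) (SetRel.mem : setLang.Relations 2)) ?_)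
  ext i; fin_cases i <;> rfl

lemma realize_relativize {N : M} (w : Empty → El N) (φ : Fml n) (xs : Fin n → El N) :
    (relativize φ).Realize (fun _ : Fin 1 => N) (fun i => (xs i).1) ↔ φ.Realize w xs := by
  have hv : ∀ {n : ℕ} (t : setLang.Term (Empty ⊕ Fin n)) (xs : Fin n → El N),
      (t.relabel (Sum.map Empty.elim id)).realize
        (Sum.elim (fun _ : Fin 1 => N) fun i => (xs i).1) = (t.realize (Sum.elim w xs)).1 := by
    intro n t xs
    cases t with
    | var i => rcases i with i | i
               · exact i.elim
               · rfl
    | func f => exact nomatch f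
  induction φ with
  | falsum => exact Iff.rfl
  | equal t s =>
    change _ = _ ↔ _ = _
    rw [hv, hv]; exact Subtype.ext_iff.symm
  | rel R ts =>
    simp only [relativize, BoundedFormula.Realize, hv]
    exact Iff.rfl
  | imp φ ψ h1 h2 => exact imp_congr (h1 xs) (h2 xs)
  | all φ ih =>
    simp only [relativize, BoundedFormula.realize_all, BoundedFormula.realize_imp, realize_memB]
    have key : ∀ (a : El N), (fun i => ((Fin.snoc xs a : Fin _ → El N) i).1) =
        (Fin.snoc (fun i => (xs i).1) a.1 : Fin _ → M) := by
      intro a; ext i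
      refine Fin.lastCases ?_ (fun i => ?_) i <;> simp
    constructor
    · intro h a
      refine (ih _).1 ?_
      rw [key]
      exact h a.1 (by simpa [newVar] using a.2)
    · intro h a ha
      exact (iff_of_eq (congrArg ((relativize φ).Realize (fun _ : Fin 1 => N))
        (key ⟨a, by simpa [newVar] using ha⟩))).1 ((ih _).2 (h _))

lemma realize_models (N : Fin n) (σ : setLang.Sentence) :
    (models N σ).Realize v xs ↔ El (xs N) ⊨ σ := by
  have h := realize_relativize (N := xs N) (default : Empty → El (xs N)) σ default
  rw [models, realize_inst, Formula.Realize]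
  rw [Sentence.Realize, Formula.Realize, ← h]
  exact iff_of_eq (congrArg _ (Subsingleton.elim _ _))

end Realize

end Semantics

end FOSet

namespace FOSet

/-! ## Definability with parameters

A context is an iterated product `((M × M) × ⋯) × M`; a predicate on a context is definable when
it is given by a formula with parameters from `M`. -/

class Ctx (M : Type) (Γ : Type) where
  n : ℕ
  co : Γ → Fin n → M

instance Ctx.base (M : Type) : Ctx M M := ⟨1, fun x _ => x⟩

instance Ctx.prod (M Γ : Type) [Ctx M Γ] : Ctx M (Γ × M) :=
  ⟨Ctx.n M Γ + 1, fun p => Fin.snoc (Ctx.co p.1) p.2⟩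

section Classes

variable (M : Type) {Γ Δ : Type} [Ctx M Γ] [Ctx M Δ]

/-- A constant function or a coordinate function. -/
def IsCo (f : Γ → M) : Prop := (∃ c, f = fun _ => c) ∨ ∃ i, f = fun γ => Ctx.co γ i

/-- Maps of contexts that are given by coordinates and constants. -/
class CoMap (g : Γ → Δ) : Prop where
  comp : ∀ f : Δ → M, IsCo M f → IsCo M fun γ => f (g γ)

variable {M}

lemma IsCo.const (c : M) : IsCo M fun _ : Γ => c := Or.inl ⟨c, rfl⟩

lemma IsCo.snd : IsCo M (Prod.snd : Γ × M → M) :=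
  Or.inr ⟨Fin.last _, by funext p; exact (Fin.snoc_last (α := fun _ => M) _ _).symm⟩

lemma IsCo.fst {f : Γ → M} (h : IsCo M f) : IsCo M fun p : Γ × M => f p.1 := by
  rcases h with ⟨c, rfl⟩ | ⟨i, rfl⟩
  · exact IsCo.const c
  · exact Or.inr ⟨i.castSucc, by
      funext p; exact (Fin.snoc_castSucc (α := fun _ => M) _ _ _).symm⟩

lemma IsCo.self : IsCo M fun x : M => x := Or.inr ⟨(0 : Fin 1), rfl⟩

lemma IsCo.prod_cases {f : Γ × M → M} (h : IsCo M f) :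
    f = Prod.snd ∨ ∃ g : Γ → M, IsCo M g ∧ f = fun p => g p.1 := by
  rcases h with ⟨c, rfl⟩ | ⟨i, rfl⟩
  · exact Or.inr ⟨_, IsCo.const c, rfl⟩
  · refine Fin.lastCases (motive := fun i : Fin (Ctx.n M Γ + 1) =>
      (fun γ : Γ × M => Ctx.co (M := M) γ i) = Prod.snd ∨
        ∃ g : Γ → M, IsCo M g ∧ (fun γ : Γ × M => Ctx.co (M := M) γ i) = fun p => g p.1) ?_ ?_ i
    · exact Or.inl (by funext p; exact Fin.snoc_last (α := fun _ => M) _ _)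
    · intro i
      exact Or.inr ⟨fun γ => Ctx.co γ i, Or.inr ⟨i, rfl⟩, by
        funext p; exact Fin.snoc_castSucc (α := fun _ => M) _ _ _⟩

variable (M) in
lemma CoMap.id : CoMap M fun γ : Γ => γ := ⟨fun _ h => h⟩

variable (M) in
lemma CoMap.lift (g : Γ → Δ) (h : CoMap M g) :
    CoMap M fun p : Γ × M => ((g p.1, p.2) : Δ × M) := by
  refine ⟨fun f hf => ?_⟩
  rcases hf.prod_cases with rfl | ⟨f, h', rfl⟩
  · exact IsCo.snd
  · exact IsCo.fst (h.comp f h')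

lemma CoMap.pair (g : Γ → Δ) (f : Γ → M) (h : CoMap M g) (hf : IsCo M f) :
    CoMap M fun γ : Γ => ((g γ, f γ) : Δ × M) := by
  refine ⟨fun f' hf' => ?_⟩
  rcases hf'.prod_cases with rfl | ⟨f', h', rfl⟩
  · exact hf
  · exact h.comp f' h'

lemma CoMap.ofCo {f : Γ → M} (hf : IsCo M f) : CoMap M f := by
  refine ⟨fun _ hf' => ?_⟩
  rcases hf' with ⟨c, rfl⟩ | ⟨i, rfl⟩
  · exact IsCo.const c
  · exact hf

variable (M) in
lemma CoMap.fst (g : Γ → Δ × M) (h : CoMap M g) : CoMap M fun γ => (g γ).1 :=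
  ⟨fun _ hf => h.comp _ hf.fst⟩

lemma CoMap.snd (g : Γ → Δ × M) (h : CoMap M g) : IsCo M fun γ => (g γ).2 :=
  h.comp _ IsCo.snd

lemma CoMap.toCo (g : Γ → M) (h : CoMap M g) : IsCo M g := h.comp _ IsCo.self

lemma IsCo.exists_var {Γ : Type} [Ctx M Γ] {f : Γ → M} (h : IsCo M f) :
    ∃ s : Set M, s.Finite ∧ ∀ (β : Type) (n : ℕ) (var : Fin (Ctx.n M Γ) → β ⊕ Fin n)
      (pm : M → β ⊕ Fin n), ∃ x : β ⊕ Fin n, ∀ (v : β → M) (xs : Fin n → M) (γ : Γ),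
        (∀ i, Sum.elim v xs (var i) = Ctx.co γ i) →
        (∀ c ∈ s, Sum.elim v xs (pm c) = c) → Sum.elim v xs x = f γ := by
  rcases h with ⟨c, rfl⟩ | ⟨i, rfl⟩
  · exact ⟨{c}, Set.finite_singleton c, fun β n var pm => ⟨pm c, fun v xs γ _ h => h c rfl⟩⟩
  · exact ⟨∅, Set.finite_empty, fun β n var pm => ⟨var i, fun v xs γ h _ => h i⟩⟩

lemma elim_up {β : Type} {n : ℕ} (v : β → M) (xs : Fin n → M) (a : M) (x : β ⊕ Fin n) :
    Sum.elim v (Fin.snoc xs a : Fin (n + 1) → M) (up x) = Sum.elim v xs x := by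
  rcases x with x | x
  · rfl
  · exact Fin.snoc_castSucc (α := fun _ => M) _ _ _

lemma elim_newVar {β : Type} {n : ℕ} (v : β → M) (xs : Fin n → M) (a : M) :
    Sum.elim v (Fin.snoc xs a : Fin (n + 1) → M) newVar = a :=
  Fin.snoc_last (α := fun _ => M) _ _

/-- The variables of a context extended by one quantifier. -/
def upVar {β : Type} {n l : ℕ} (var : Fin l → β ⊕ Fin n) : Fin (l + 1) → β ⊕ Fin (n + 1) :=
  Fin.snoc (fun i => up (var i)) newVar

lemma upVar_spec {Γ : Type} [Ctx M Γ] {β : Type} {n : ℕ} {var : Fin (Ctx.n M Γ) → β ⊕ Fin n}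
    {v : β → M} {xs : Fin n → M} {γ : Γ} (h : ∀ i, Sum.elim v xs (var i) = Ctx.co γ i) (a : M)
    (i : Fin (Ctx.n M (Γ × M))) :
    Sum.elim v (Fin.snoc xs a : Fin (n + 1) → M) (upVar var i) = Ctx.co (γ, a) i := by
  refine Fin.lastCases (motive := fun i : Fin (Ctx.n M Γ + 1) =>
    Sum.elim v (Fin.snoc xs a : Fin (n + 1) → M) (upVar var i) =
      Ctx.co (M := M) (Γ := Γ × M) (γ, a) i) ?_ (fun i => ?_) i
  · simp only [upVar, Fin.snoc_last, elim_newVar]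
    exact (Fin.snoc_last (α := fun _ => M) _ _).symm
  · simp only [upVar, Fin.snoc_castSucc, elim_up, h]
    exact (Fin.snoc_castSucc (α := fun _ => M) _ _ _).symm

/-- A finite set of parameters, enumerated. -/
lemma exists_params {s : Set M} (hs : s.Finite) {l : ℕ} :
    ∃ (k : ℕ) (z : Fin k → M) (pm : M → Fin (k + (l + 1))),
      ∀ f : Fin (k + (l + 1)) → M,
        (∀ i : Fin k, f ⟨i + (l + 1), by omega⟩ = z i) → ∀ c ∈ s, f (pm c) = c := by
  classical
  have := hs.fintype
  let e := Fintype.equivFin s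
  refine ⟨Fintype.card s, fun i => (e.symm i).1,
    fun c => if h : c ∈ s then ⟨e ⟨c, h⟩ + (l + 1), by omega⟩ else ⟨0, by omega⟩, fun f hf c hc => ?_⟩
  simp only [dif_pos hc]
  rw [hf]; simp

end Classes

section Levels

variable (M : Type) [setLang.Structure M]

/-- The predicates given by `Δ₀`-formulas. -/
inductive Z : ∀ {Γ : Type} [Ctx M Γ], (Γ → Prop) → Prop
  | falsum {Γ : Type} [Ctx M Γ] : Z fun _ : Γ => False
  | mem {Γ : Type} [Ctx M Γ] {f g : Γ → M} : IsCo M f → IsCo M g → Z fun γ => f γ ε g γ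
  | eq {Γ : Type} [Ctx M Γ] {f g : Γ → M} : IsCo M f → IsCo M g → Z fun γ => f γ = g γ
  | imp {Γ : Type} [Ctx M Γ] {P Q : Γ → Prop} : Z P → Z Q → Z fun γ => P γ → Q γ
  | ball {Γ : Type} [Ctx M Γ] {f : Γ → M} {P : Γ × M → Prop} : IsCo M f → Z P →
      Z fun γ => ∀ x, x ε f γ → P (γ, x)

/-- The predicates given by formulas of the Levy classes. -/
inductive Lev : Side → ℕ → ∀ {Γ : Type} [Ctx M Γ], (Γ → Prop) → Prop
  | zero (s : Side) {Γ : Type} [Ctx M Γ] {P : Γ → Prop} : Z M P → Lev s 0 P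
  | next (s : Side) (k : ℕ) {Γ : Type} [Ctx M Γ] {P : Γ → Prop} : Lev s.swap k P → Lev s (k + 1) P
  | ex (k : ℕ) {Γ : Type} [Ctx M Γ] {P : Γ × M → Prop} :
      Lev .sigma (k + 1) P → Lev .sigma (k + 1) fun γ => ∃ x, P (γ, x)
  | all (k : ℕ) {Γ : Type} [Ctx M Γ] {P : Γ × M → Prop} :
      Lev .pi (k + 1) P → Lev .pi (k + 1) fun γ => ∀ x, P (γ, x)

variable {M}

/-- `φ` defines `P` when the coordinates of the context are read off by `var`, and the
parameters in `s` by `pm`. -/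
def Defines {Γ : Type} [Ctx M Γ] (P : Γ → Prop) (s : Set M) {β : Type} {n : ℕ}
    (var : Fin (Ctx.n M Γ) → β ⊕ Fin n) (pm : M → β ⊕ Fin n)
    (φ : setLang.BoundedFormula β n) : Prop :=
  ∀ (v : β → M) (xs : Fin n → M) (γ : Γ), (∀ i, Sum.elim v xs (var i) = Ctx.co γ i) →
    (∀ c ∈ s, Sum.elim v xs (pm c) = c) → (φ.Realize v xs ↔ P γ)

lemma Defines.quant {Γ : Type} [Ctx M Γ] {P : Γ × M → Prop} {s : Set M} {β : Type} {n : ℕ}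
    {var : Fin (Ctx.n M Γ) → β ⊕ Fin n} {pm : M → β ⊕ Fin n}
    {φ : setLang.BoundedFormula β (n + 1)}
    (h : Defines P s (upVar var) (fun c => up (pm c)) φ) {v : β → M} {xs : Fin n → M} {γ : Γ}
    (hv : ∀ i, Sum.elim v xs (var i) = Ctx.co γ i) (hp : ∀ c ∈ s, Sum.elim v xs (pm c) = c)
    (a : M) : φ.Realize v (Fin.snoc xs a) ↔ P (γ, a) :=
  h v _ _ (upVar_spec hv a) fun c hc => by rw [elim_up]; exact hp c hc

theorem Z.exists_formula {Γ : Type} [Ctx M Γ] {P : Γ → Prop} (h : Z M P) :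
    ∃ s : Set M, s.Finite ∧ ∀ (β : Type) (n : ℕ) (var : Fin (Ctx.n M Γ) → β ⊕ Fin n)
      (pm : M → β ⊕ Fin n), ∃ φ : setLang.BoundedFormula β n,
        IsDelta0 φ ∧ Defines P s var pm φ := by
  induction h with
  | falsum =>
    exact ⟨∅, Set.finite_empty, fun β n var pm => ⟨_, .falsum, fun v xs γ _ _ => Iff.rfl⟩⟩
  | mem hf hg =>
    obtain ⟨s, hs, h1⟩ := hf.exists_var
    obtain ⟨t, ht, h2⟩ := hg.exists_var
    refine ⟨s ∪ t, hs.union ht, fun β n var pm => ?_⟩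
    obtain ⟨x, hx⟩ := h1 β n var pm
    obtain ⟨y, hy⟩ := h2 β n var pm
    refine ⟨memB x y, .rel _ _, fun v xs γ h1 h2 => ?_⟩
    rw [realize_memB, hx v xs γ h1 fun c hc => h2 c (Or.inl hc),
      hy v xs γ h1 fun c hc => h2 c (Or.inr hc)]
  | eq hf hg =>
    obtain ⟨s, hs, h1⟩ := hf.exists_var
    obtain ⟨t, ht, h2⟩ := hg.exists_var
    refine ⟨s ∪ t, hs.union ht, fun β n var pm => ?_⟩
    obtain ⟨x, hx⟩ := h1 β n var pm
    obtain ⟨y, hy⟩ := h2 β n var pm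
    refine ⟨.equal (tv x) (tv y), .equal _ _, fun v xs γ h1 h2 => ?_⟩
    beta_reduce
    rw [← hx v xs γ h1 fun c hc => h2 c (Or.inl hc),
      ← hy v xs γ h1 fun c hc => h2 c (Or.inr hc)]
    exact Iff.rfl
  | imp _ _ ih1 ih2 =>
    obtain ⟨s, hs, h1⟩ := ih1
    obtain ⟨t, ht, h2⟩ := ih2
    refine ⟨s ∪ t, hs.union ht, fun β n var pm => ?_⟩
    obtain ⟨φ, hφ, hφ'⟩ := h1 β n var pm
    obtain ⟨ψ, hψ, hψ'⟩ := h2 β n var pm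
    exact ⟨φ.imp ψ, hφ.imp hψ, fun v xs γ h1 h2 => imp_congr
      (hφ' v xs γ h1 fun c hc => h2 c (Or.inl hc)) (hψ' v xs γ h1 fun c hc => h2 c (Or.inr hc))⟩
  | ball hf _ ih =>
    obtain ⟨s, hs, h1⟩ := hf.exists_var
    obtain ⟨t, ht, h2⟩ := ih
    refine ⟨s ∪ t, hs.union ht, fun β n var pm => ?_⟩
    obtain ⟨x, hx⟩ := h1 β n var pm
    obtain ⟨φ, hφ, hφ'⟩ := h2 β (n + 1) (upVar var) fun c => up (pm c)
    refine ⟨_, .ball x hφ, fun v xs γ h1 h2 => ?_⟩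
    rw [BoundedFormula.realize_all]
    refine forall_congr' fun a => ?_
    rw [BoundedFormula.realize_imp, realize_memB, elim_newVar, elim_up,
      hx v xs γ h1 fun c hc => h2 c (Or.inl hc), hφ'.quant h1 fun c hc => h2 c (Or.inr hc)]

theorem Lev.exists_formula {s : Side} {k : ℕ} {Γ : Type} [Ctx M Γ] {P : Γ → Prop}
    (h : Lev M s k P) :
    ∃ t : Set M, t.Finite ∧ ∀ (β : Type) (n : ℕ) (var : Fin (Ctx.n M Γ) → β ⊕ Fin n)
      (pm : M → β ⊕ Fin n), ∃ φ : setLang.BoundedFormula β n,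
        IsLevy s k φ ∧ Defines P t var pm φ := by
  induction h with
  | zero s h =>
    obtain ⟨t, ht, h⟩ := h.exists_formula
    refine ⟨t, ht, fun β n var pm => ?_⟩
    obtain ⟨φ, h1, h2⟩ := h β n var pm
    exact ⟨φ, .zero s h1, h2⟩
  | next s k _ ih =>
    obtain ⟨t, ht, h⟩ := ih
    refine ⟨t, ht, fun β n var pm => ?_⟩
    obtain ⟨φ, h1, h2⟩ := h β n var pm
    exact ⟨φ, .next s k h1, h2⟩
  | ex k _ ih =>
    obtain ⟨t, ht, h⟩ := ih
    refine ⟨t, ht, fun β n var pm => ?_⟩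
    obtain ⟨φ, h1, h2⟩ := h β (n + 1) (upVar var) fun c => up (pm c)
    refine ⟨φ.ex, .ex k h1, fun v xs γ hv hp => ?_⟩
    rw [BoundedFormula.realize_ex]
    exact exists_congr fun a => h2.quant hv hp a
  | all k _ ih =>
    obtain ⟨t, ht, h⟩ := ih
    refine ⟨t, ht, fun β n var pm => ?_⟩
    obtain ⟨φ, h1, h2⟩ := h β (n + 1) (upVar var) fun c => up (pm c)
    refine ⟨φ.all, .all k h1, fun v xs γ hv hp => ?_⟩
    rw [BoundedFormula.realize_all]
    exact forall_congr' fun a => h2.quant hv hp a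

variable (M) in
/-- A model of `M + Π_{m+1}`-collection `+ Σ_{m+2}`-induction on `ω`, with `m = lvl + 1`. -/
class TModel where
  lvl : ℕ
  ext : ∀ x y : M, (∀ z, z ε x ↔ z ε y) → x = y
  empty : ∃ x : M, Emp x
  pair : ∀ x y : M, ∃ p, UP p x y
  union : ∀ x : M, ∃ u, ∀ z, z ε u ↔ ∃ y, y ε x ∧ z ε y
  diff : ∀ x y : M, ∃ d, ∀ z, z ε d ↔ (z ε x ∧ ¬ z ε y)
  power : ∀ x : M, ∃ p, ∀ z, z ε p ↔ Sub z x
  tco : ∀ x : M, ∃ y, Tr y ∧ Sub x y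
  inf : ∃ x : M, (∃ e, e ε x ∧ Emp e) ∧ ∀ y, y ε x → ∃ s, s ε x ∧ IsSuc y s
  found : ∀ z : M, (∃ x, x ε z) → ∃ y, y ε z ∧ ∀ x, x ε y → ¬ x ε z
  sep0 : ∀ P : M → Prop, Z M P → ∀ w, ∃ y, ∀ x, x ε y ↔ (x ε w ∧ P x)
  coll : ∀ R : M × M → Prop, Lev M .pi (lvl + 2) R → ∀ w, (∀ x, x ε w → ∃ y, R (x, y)) →
    ∃ C, ∀ x, x ε w → ∃ y, y ε C ∧ R (x, y)
  ind : ∀ P : M → Prop, Lev M .sigma (lvl + 3) P → (∃ e, Emp e ∧ P e) →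
    (∀ x, Nt x → P x → ∃ s, IsSuc x s ∧ P s) → ∀ x, Nt x → P x

attribute [local instance] liftVar

lemma realize_axPower : M ⊨ axPower ↔ ∀ x : M, ∃ p, ∀ z, z ε p ↔ Sub z x := by
  rw [axPower, realize_closure]; simp; rfl

lemma realize_axExt : M ⊨ axExt ↔ ∀ x y : M, (∀ z, z ε x ↔ z ε y) → x = y := by
  rw [axExt, realize_closure]; simp; rfl
lemma realize_axEmpty : M ⊨ axEmpty ↔ ∃ x : M, Emp x := by
  rw [axEmpty, realize_closure]; simp; rfl
lemma realize_axPair : M ⊨ axPair ↔ ∀ x y : M, ∃ p, UP p x y := by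
  rw [axPair, realize_closure]; simp; rfl
lemma realize_axUnion : M ⊨ axUnion ↔ ∀ x : M, ∃ u, ∀ z, z ε u ↔ ∃ y, y ε x ∧ z ε y := by
  rw [axUnion, realize_closure]; simp; rfl
lemma realize_axDiff : M ⊨ axDiff ↔ ∀ x y : M, ∃ d, ∀ z, z ε d ↔ (z ε x ∧ ¬ z ε y) := by
  rw [axDiff, realize_closure]; simp; rfl
lemma realize_axTCo : M ⊨ axTCo ↔ ∀ x : M, ∃ y, Tr y ∧ Sub x y := by
  rw [axTCo, realize_closure]; simp; rfl
lemma realize_axInf : M ⊨ axInf ↔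
    ∃ x : M, (∃ e, e ε x ∧ Emp e) ∧ ∀ y, y ε x → ∃ s, s ε x ∧ IsSuc y s := by
  rw [axInf, realize_closure]; simp; rfl
lemma realize_axFound : M ⊨ axFound ↔
    ∀ z : M, (∃ x, x ε z) → ∃ y, y ε z ∧ ∀ x, x ε y → ¬ x ε z := by
  rw [axFound, realize_closure]; simp; rfl

lemma realize_sepInst {k : ℕ} (φ : setLang.Formula (Fin (k + 1))) : M ⊨ sepInst φ ↔
    ∀ (p : Fin k → M) (w : M), ∃ y, ∀ x, x ε y ↔ (x ε w ∧ φ.Realize (Fin.cons x p : Fin (k + 1) → M)) := by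
  have key : ∀ (p : Fin k → M) (w y x : M), (fun i => (Fin.snoc (Fin.snoc (Fin.snoc p w : Fin (k + 1) → M) y : Fin (k + 2) → M) x : Fin (k + 3) → M) ((Fin.cons (Fin.last _) fun i : Fin k => (((i : Fin (k + 1)) : Fin (k + 2)) : Fin (k + 3)) : Fin (k + 1) → Fin (k + 3)) i)) = (Fin.cons x p : Fin (k + 1) → M) := by
    intro p w y x; funext i
    refine Fin.cases ?_ (fun i => ?_) i <;> simp
  rw [sepInst, realize_closure]
  simp only [realize_allF, realize_exF, realize_iffF, realize_andF, realize_inst, key]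
  simp

lemma realize_collInst {k : ℕ} (φ : setLang.Formula (Fin (k + 2))) : M ⊨ collInst φ ↔
    ∀ (p : Fin k → M) (w : M),
      (∀ x, x ε w → ∃ y, φ.Realize (Fin.cons x (Fin.cons y p) : Fin (k + 2) → M)) →
      ∃ C, ∀ x, x ε w → ∃ y, y ε C ∧ φ.Realize (Fin.cons x (Fin.cons y p) : Fin (k + 2) → M) := by
  have key1 : ∀ (p : Fin k → M) (w x y : M), (fun i => (Fin.snoc (Fin.snoc (Fin.snoc p w : Fin (k + 1) → M) x : Fin (k + 2) → M) y : Fin (k + 3) → M) ((Fin.cons ((Fin.last _ : Fin (k + 2)) : Fin (k + 3)) (Fin.cons (Fin.last _) fun i : Fin k => (((i : Fin (k + 1)) : Fin (k + 2)) : Fin (k + 3))) : Fin (k + 2) → Fin (k + 3)) i)) = (Fin.cons x (Fin.cons y p) : Fin (k + 2) → M) := by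
    intro p w x y; funext i
    refine Fin.cases ?_ (fun i => Fin.cases ?_ (fun i => ?_) i) i <;> simp
  have key2 : ∀ (p : Fin k → M) (w C x y : M), (fun i => (Fin.snoc (Fin.snoc (Fin.snoc (Fin.snoc p w : Fin (k + 1) → M) C : Fin (k + 2) → M) x : Fin (k + 3) → M) y : Fin (k + 4) → M) ((Fin.cons ((Fin.last _ : Fin (k + 3)) : Fin (k + 4)) (Fin.cons (Fin.last _) fun i : Fin k => ((((i : Fin (k + 1)) : Fin (k + 2)) : Fin (k + 3)) : Fin (k + 4))) : Fin (k + 2) → Fin (k + 4)) i)) = (Fin.cons x (Fin.cons y p) : Fin (k + 2) → M) := by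
    intro p w C x y; funext i
    refine Fin.cases ?_ (fun i => Fin.cases ?_ (fun i => ?_) i) i <;> simp
  rw [collInst, realize_closure]
  simp only [realize_allF, realize_exF, realize_allIn, realize_exIn, realize_impF, realize_inst,
    key1, key2]
  simp

lemma realize_indInst {k : ℕ} (φ : setLang.Formula (Fin (k + 1))) : M ⊨ indInst φ ↔
    ∀ (p : Fin k → M), ((∃ e, Emp e ∧ φ.Realize (Fin.cons e p : Fin (k + 1) → M)) ∧
      ∀ x, Nt x → φ.Realize (Fin.cons x p : Fin (k + 1) → M) →
        ∃ s, IsSuc x s ∧ φ.Realize (Fin.cons s p : Fin (k + 1) → M)) →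
      ∀ x, Nt x → φ.Realize (Fin.cons x p : Fin (k + 1) → M) := by
  have key1 : ∀ (p : Fin k → M) (x : M), (fun i => (Fin.snoc p x : Fin (k + 1) → M) ((Fin.cons (Fin.last _) fun i : Fin k => (i : Fin (k + 1)) : Fin (k + 1) → Fin (k + 1)) i)) = (Fin.cons x p : Fin (k + 1) → M) := by
    intro p x; funext i
    refine Fin.cases ?_ (fun i => ?_) i <;> simp
  have key2 : ∀ (p : Fin k → M) (x s : M), (fun i => (Fin.snoc (Fin.snoc p x : Fin (k + 1) → M) s : Fin (k + 2) → M) ((Fin.cons (Fin.last _) fun i : Fin k => ((i : Fin (k + 1)) : Fin (k + 2)) : Fin (k + 1) → Fin (k + 2)) i)) = (Fin.cons s p : Fin (k + 1) → M) := by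
    intro p x s; funext i
    refine Fin.cases ?_ (fun i => ?_) i <;> simp
  rw [indInst, realize_closure]
  simp only [realize_allF, realize_exF, realize_andF, realize_impF, realize_inst, realize_isEmpty,
    realize_isNat, realize_isSucc, key1, key2]
  simp

/-- Formulas in one distinguished variable, from definable predicates. -/
lemma Defines.cons {P : M → Prop} {s : Set M} {k : ℕ} {z : Fin k → M} {pm : M → Fin (k + 1)}
    (hz : ∀ f : Fin (k + 1) → M, (∀ i : Fin k, f i.succ = z i) → ∀ c ∈ s, f (pm c) = c)
    {φ : setLang.BoundedFormula (Fin (k + 1)) 0}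
    (h : Defines P s (fun _ => Sum.inl 0) (fun c => Sum.inl (pm c)) φ) (x : M) :
    Formula.Realize φ (Fin.cons x z : Fin (k + 1) → M) ↔ P x :=
  h _ _ x (fun _ => rfl) fun c hc => hz (Fin.cons x z) (fun i => Fin.cons_succ (α := fun _ => M) _ _ i) c hc

lemma Defines.cons₂ {R : M × M → Prop} {s : Set M} {k : ℕ} {z : Fin k → M} {pm : M → Fin (k + 2)}
    (hz : ∀ f : Fin (k + 2) → M, (∀ i : Fin k, f i.succ.succ = z i) → ∀ c ∈ s, f (pm c) = c)
    {φ : setLang.BoundedFormula (Fin (k + 2)) 0}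
    (h : Defines R s (fun i => Sum.inl (if i = (0 : Fin 2) then 0 else 1))
      (fun c => Sum.inl (pm c)) φ) (x y : M) :
    Formula.Realize φ (Fin.cons x (Fin.cons y z) : Fin (k + 2) → M) ↔ R (x, y) := by
  refine h _ _ (x, y) ?_ fun c hc =>
    hz (Fin.cons x (Fin.cons y z) : Fin (k + 2) → M) (fun _ => rfl) c hc
  intro (i : Fin 2)
  fin_cases i <;> rfl

variable (M) in
/-- Models of the theory satisfy the semantic form of the axioms. -/
@[reducible] def TModel.ofTheory (l : ℕ) [Nonempty M]
    (h : M ⊨ theoryM ∪ piCollection (l + 2) ∪ sigmaInduction (l + 3)) : TModel M where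
  lvl := l
  ext := realize_axExt.1 (h.realize_of_mem _ (by simp [theoryM]))
  empty := realize_axEmpty.1 (h.realize_of_mem _ (by simp [theoryM]))
  pair := realize_axPair.1 (h.realize_of_mem _ (by simp [theoryM]))
  union := realize_axUnion.1 (h.realize_of_mem _ (by simp [theoryM]))
  diff := realize_axDiff.1 (h.realize_of_mem _ (by simp [theoryM]))
  power := realize_axPower.1 (h.realize_of_mem _ (by simp [theoryM]))
  tco := realize_axTCo.1 (h.realize_of_mem _ (by simp [theoryM]))
  inf := realize_axInf.1 (h.realize_of_mem _ (by simp [theoryM]))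
  found := realize_axFound.1 (h.realize_of_mem _ (by simp [theoryM]))
  sep0 P hP w := by
    obtain ⟨s, hs, hφ⟩ := hP.exists_formula
    obtain ⟨k, z, pm, hz⟩ := exists_params hs (l := 0)
    obtain ⟨φ, h1, h2⟩ := hφ (Fin (k + 1)) 0 (fun _ => Sum.inl 0) fun c => Sum.inl (pm c)
    have := realize_sepInst (M := M) φ |>.1 (h.realize_of_mem _
      (Or.inl (Or.inl (Or.inr ⟨k, φ, h1, rfl⟩)))) z w
    simpa only [h2.cons hz] using this
  coll R hR w := by
    obtain ⟨s, hs, hφ⟩ := hR.exists_formula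
    obtain ⟨k, z, pm, hz⟩ := exists_params hs (l := 1)
    obtain ⟨φ, h1, h2⟩ := hφ (Fin (k + 2)) 0 (fun i => Sum.inl (if i = (0 : Fin 2) then 0 else 1))
      fun c => Sum.inl (pm c)
    have := realize_collInst (M := M) φ |>.1 (h.realize_of_mem _
      (Or.inl (Or.inr ⟨k, φ, h1, rfl⟩))) z w
    simpa only [h2.cons₂ hz] using this
  ind P hP h0 h1' := by
    obtain ⟨s, hs, hφ⟩ := hP.exists_formula
    obtain ⟨k, z, pm, hz⟩ := exists_params hs (l := 0)
    obtain ⟨φ, h1, h2⟩ := hφ (Fin (k + 1)) 0 (fun _ => Sum.inl 0) fun c => Sum.inl (pm c)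
    have := realize_indInst (M := M) φ |>.1 (h.realize_of_mem _
      (Or.inr ⟨k, φ, h1, rfl⟩)) z
    simp only [h2.cons hz] at this
    exact this ⟨h0, h1'⟩

end Levels

end FOSet

namespace FOSet

section CoMaps

variable {M : Type} {Γ Δ Θ : Type} [Ctx M Γ] [Ctx M Δ] [Ctx M Θ]

lemma CoMap.constMap (d : Δ) : CoMap M fun _ : Γ => d := ⟨fun f _ => IsCo.const (f d)⟩

lemma coMap_fst : CoMap M fun p : Γ × M => p.1 := CoMap.fst M _ (CoMap.id M)

lemma CoMap.trans {g : Γ → Δ} {h : Δ → Θ} (hg : CoMap M g) (hh : CoMap M h) :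
    CoMap M fun γ => h (g γ) := ⟨fun f hf => hg.comp _ (hh.comp f hf)⟩

end CoMaps

section Calculus

variable {M : Type} [setLang.Structure M] {Γ Δ : Type} [Ctx M Γ] [Ctx M Δ]

lemma Side.swap_swap (s : Side) : s.swap.swap = s := by cases s <;> rfl

lemma Z.comp {P : Δ → Prop} (h : Z M P) : ∀ {Γ : Type} [Ctx M Γ] {g : Γ → Δ}, CoMap M g →
    Z M fun γ => P (g γ) := by
  induction h with
  | falsum => exact fun _ => .falsum
  | mem h1 h2 => exact fun hg => .mem (hg.comp _ h1) (hg.comp _ h2)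
  | eq h1 h2 => exact fun hg => .eq (hg.comp _ h1) (hg.comp _ h2)
  | imp _ _ h1 h2 => exact fun hg => .imp (h1 hg) (h2 hg)
  | ball h1 _ h2 => exact fun hg => .ball (hg.comp _ h1) (h2 (CoMap.lift M _ hg))

lemma Z.not {P : Γ → Prop} (h : Z M P) : Z M fun γ => ¬ P γ := h.imp .falsum

lemma Z.and {P Q : Γ → Prop} (h : Z M P) (h' : Z M Q) : Z M fun γ => P γ ∧ Q γ := by
  have := (h.imp h'.not).not
  simpa only [Classical.not_imp, not_not] using this

lemma Lev.comp {s : Side} {k : ℕ} {P : Δ → Prop} (h : Lev M s k P) :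
    ∀ {Γ : Type} [Ctx M Γ] {g : Γ → Δ}, CoMap M g → Lev M s k fun γ => P (g γ) := by
  induction h with
  | zero s h => exact fun hg => .zero s (h.comp hg)
  | next s k _ ih => exact fun hg => .next s k (ih hg)
  | ex k _ ih => exact fun hg => .ex k (ih (CoMap.lift M _ hg))
  | all k _ ih => exact fun hg => .all k (ih (CoMap.lift M _ hg))

lemma Lev.neg {s : Side} {k : ℕ} {P : Γ → Prop} (h : Lev M s k P) :
    Lev M s.swap k fun γ => ¬ P γ := by
  induction h with
  | zero s h => exact .zero _ h.not
  | next s k _ ih => exact .next _ _ ih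
  | ex k _ ih => simp only [not_exists]; exact .all k ih
  | all k _ ih => simp only [not_forall]; exact .ex k ih

lemma Lev.lift {s : Side} {k : ℕ} {P : Γ → Prop} (h : Lev M s k P) : Lev M s (k + 1) P := by
  induction h with
  | zero s h => exact .next _ _ (.zero _ h)
  | next s k _ ih => exact .next _ _ ih
  | ex k _ ih => exact .ex _ ih
  | all k _ ih => exact .all _ ih

lemma Lev.mono {s : Side} {k l : ℕ} (hkl : k ≤ l) {P : Γ → Prop} (h : Lev M s k P) :
    Lev M s l P := by
  induction hkl with
  | refl => exact h
  | step _ ih => exact ih.lift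

/-- Induction over the outermost block of quantifiers. -/
lemma Lev.block_induction {s : Side} {k : ℕ}
    {motive : ∀ {Γ : Type} [Ctx M Γ], (Γ → Prop) → Prop}
    (next : ∀ {Γ : Type} [Ctx M Γ] {P : Γ → Prop}, Lev M s.swap k P → motive P)
    (ex : ∀ {Γ : Type} [Ctx M Γ] {P : Γ × M → Prop}, s = .sigma → motive P →
      motive fun γ => ∃ x, P (γ, x))
    (all : ∀ {Γ : Type} [Ctx M Γ] {P : Γ × M → Prop}, s = .pi → motive P →
      motive fun γ => ∀ x, P (γ, x))
    {P : Γ → Prop} (h : Lev M s (k + 1) P) : motive P := by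
  generalize hn : k + 1 = n at h
  induction h with
  | zero => omega
  | next s k' h => obtain rfl : k = k' := by omega
                   exact next h
  | ex _ _ ih => exact ex rfl (ih next ex all hn)
  | all _ _ ih => exact all rfl (ih next ex all hn)

lemma Lev.quant {s : Side} {k : ℕ} {P : Γ × M → Prop} (h : Lev M s (k + 1) P) :
    (s = .sigma → Lev M s (k + 1) fun γ => ∃ x, P (γ, x)) ∧
      (s = .pi → Lev M s (k + 1) fun γ => ∀ x, P (γ, x)) :=
  ⟨fun hs => by subst hs; exact .ex _ h, fun hs => by subst hs; exact .all _ h⟩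

lemma Lev.and [Nonempty M] {k : ℕ} : ∀ {s : Side} {Γ : Type} [Ctx M Γ] {P Q : Γ → Prop},
    Lev M s k P → Lev M s k Q → Lev M s k fun γ => P γ ∧ Q γ := by
  induction k with
  | zero =>
    intro s Γ _ P Q h1 h2
    have key : ∀ {P : Γ → Prop}, Lev M s 0 P → Z M P := by
      intro P h; cases h; assumption
    exact .zero s ((key h1).and (key h2))
  | succ k ih =>
    intro s Γ _ P Q h1
    revert Q
    refine Lev.block_induction (motive := fun {Γ} _ P => ∀ {Q : Γ → Prop}, Lev M s (k + 1) Q →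
      Lev M s (k + 1) fun γ => P γ ∧ Q γ) ?_ ?_ ?_ h1
    · intro Γ _ P h1 Q h2
      revert P
      refine Lev.block_induction (motive := fun {Γ} _ Q => ∀ {P : Γ → Prop}, Lev M s.swap k P →
        Lev M s (k + 1) fun γ => P γ ∧ Q γ) ?_ ?_ ?_ h2
      · exact fun h2 _ h1 => .next _ _ (ih h1 h2)
      · intro Γ _ Q hs h2 P h1
        have := (h2 (h1.comp coMap_fst)).quant.1 hs
        simpa only [exists_and_left] using this
      · intro Γ _ Q hs h2 P h1
        have := (h2 (h1.comp coMap_fst)).quant.2 hs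
        simpa only [forall_and, forall_const] using this
    · intro Γ _ P hs h1 Q h2
      have := (h1 (h2.comp coMap_fst)).quant.1 hs
      simpa only [exists_and_right] using this
    · intro Γ _ P hs h1 Q h2
      have := (h1 (h2.comp coMap_fst)).quant.2 hs
      simpa only [forall_and, forall_const] using this

/-- Closure of a Levy class under bounded universal quantification. -/
def BQ (M : Type) [setLang.Structure M] (k : ℕ) : Prop :=
  ∀ (s : Side) {Γ : Type} [Ctx M Γ] {P : Γ × M → Prop} {f : Γ → M}, IsCo M f → Lev M s k P →
    Lev M s k fun γ => ∀ x, x ε f γ → P (γ, x)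

lemma BQ.bex {k : ℕ} (h : BQ M k) {s : Side} {P : Γ × M → Prop} {f : Γ → M} (hf : IsCo M f)
    (hP : Lev M s k P) : Lev M s k fun γ => ∃ x, x ε f γ ∧ P (γ, x) := by
  have := (h _ hf hP.neg).neg
  rw [Side.swap_swap] at this
  simpa only [not_forall, Classical.not_not, exists_prop] using this

variable [TModel M]

open TModel (lvl)

instance : Nonempty M := ⟨(TModel.empty (M := M)).choose⟩

/-- A block of existential quantifiers can be contracted to one. -/
lemma Lev.contract {k : ℕ} (hk : BQ M k) {P : Γ → Prop} (h : Lev M .sigma (k + 1) P) :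
    ∃ Q : Γ × M → Prop, Lev M .pi k Q ∧ ∀ γ, P γ ↔ ∃ c, Q (γ, c) := by
  refine Lev.block_induction (motive := fun {Γ} _ P => ∃ Q : Γ × M → Prop, Lev M .pi k Q ∧
    ∀ γ, P γ ↔ ∃ c, Q (γ, c)) ?_ ?_ ?_ h
  · intro Γ _ P h
    exact ⟨fun p => P p.1, h.comp coMap_fst, fun γ => (exists_const M).symm⟩
  · rintro Γ _ P - ⟨Q, hQ, hPQ⟩
    refine ⟨fun p => ∃ x, x ε p.2 ∧ ∃ y, y ε p.2 ∧ Q ((p.1, x), y), ?_, fun γ => ?_⟩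
    · have hg : CoMap M fun p : ((Γ × M) × M) × M => ((p.1.1.1, p.1.2), p.2) :=
        CoMap.lift M (fun q : (Γ × M) × M => (q.1.1, q.2)) (CoMap.lift M _ coMap_fst)
      have := hk.bex (f := fun p : (Γ × M) × M => p.1.2) IsCo.snd.fst (hQ.comp hg)
      exact hk.bex (f := fun p : Γ × M => p.2) IsCo.snd this
    · simp only [hPQ]
      constructor
      · rintro ⟨x, y, h⟩
        obtain ⟨p, hp⟩ := TModel.pair x y
        exact ⟨p, x, (hp x).2 (Or.inl rfl), y, (hp y).2 (Or.inr rfl), h⟩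
      · rintro ⟨_, x, -, y, -, h⟩
        exact ⟨x, y, h⟩
  · intro _ _ _ h; cases h

lemma BQ.succ {k : ℕ} (hk : k ≤ lvl M + 2) (h : BQ M k) : BQ M (k + 1) := by
  have key : ∀ {Γ : Type} [Ctx M Γ] {P : Γ × M → Prop} {f : Γ → M}, IsCo M f →
      Lev M .sigma (k + 1) P → Lev M .sigma (k + 1) fun γ => ∀ x, x ε f γ → P (γ, x) := by
    intro Γ _ P f hf hP
    obtain ⟨Q, hQ, hPQ⟩ := hP.contract h
    have hg : CoMap M fun p : ((Γ × M) × M) × M => ((p.1.1.1, p.1.2), p.2) :=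
      CoMap.lift M (fun q : (Γ × M) × M => (q.1.1, q.2)) (CoMap.lift M _ coMap_fst)
    have h1 := h.bex (f := fun p : (Γ × M) × M => p.1.2) IsCo.snd.fst (hQ.comp hg)
    have h2 := h .pi (f := fun p : Γ × M => f p.1) hf.fst h1
    have h3 : Lev M .sigma (k + 1) _ := .ex k (.next .sigma k h2)
    convert h3 using 3 with γ
    simp only [hPQ]
    constructor
    · intro hx
      exact TModel.coll (fun p : M × M => Q ((γ, p.1), p.2))
        ((hQ.mono hk).comp (CoMap.lift M (fun x : M => (γ, x))
          (CoMap.pair _ _ (CoMap.constMap γ) IsCo.self))) (f γ) hx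
    · rintro ⟨C, hC⟩ x hx
      obtain ⟨y, -, hy⟩ := hC x hx
      exact ⟨y, hy⟩
  have key' : ∀ {Γ : Type} [Ctx M Γ] {P : Γ × M → Prop} {f : Γ → M}, IsCo M f →
      Lev M .pi (k + 1) P → Lev M .pi (k + 1) fun γ => ∀ x, x ε f γ → P (γ, x) := by
    intro Γ _ P f hf hP
    refine Lev.block_induction (motive := fun {Δ} _ P => ∀ {Γ : Type} [Ctx M Γ] (f : Γ → M)
      (g : Γ × M → Δ), IsCo M f → CoMap M g →
        Lev M .pi (k + 1) fun γ => ∀ x, x ε f γ → P (g (γ, x))) ?_ ?_ ?_ hP _ _ hf (CoMap.id M)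
    · exact fun hP Γ _ f g hf hg => .next _ _ (h _ hf (hP.comp hg))
    · intro _ _ _ h; cases h
    · intro Δ _ P _ ih Γ _ f g hf hg
      have := Lev.all k (ih (fun p : Γ × M => f p.1) (fun p : (Γ × M) × M => (g (p.1.1, p.2), p.1.2))
        hf.fst (CoMap.pair _ _ (CoMap.trans (CoMap.lift M _ coMap_fst) hg) IsCo.snd.fst))
      refine (iff_of_eq (congrArg (Lev M _ _) (funext fun γ => propext ?_))).2 this
      exact ⟨fun h y x hx => h x hx y, fun h x hx y => h y x hx⟩
  intro s Γ _ P f hf hP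
  cases s
  · exact key hf hP
  · exact key' hf hP

lemma bq {k : ℕ} (hk : k ≤ lvl M + 3) : BQ M k := by
  induction k with
  | zero =>
    intro s Γ _ P f hf h
    cases h with
    | zero _ h => exact .zero _ (.ball hf h)
  | succ k ih => exact (ih (by omega)).succ (by omega)

variable (M) in
/-- The separation scheme for a class of predicates. -/
def Sep (P : M → Prop) : Prop := ∀ w : M, ∃ y, ∀ x, x ε y ↔ (x ε w ∧ P x)

lemma Sep.compl {P : M → Prop} (h : Sep M P) : Sep M fun x => ¬ P x := by
  intro w
  obtain ⟨y, hy⟩ := h w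
  obtain ⟨d, hd⟩ := TModel.diff w y
  refine ⟨d, fun x => ?_⟩
  rw [hd, hy]; tauto

lemma Lev.or {s : Side} {k : ℕ} {P Q : Γ → Prop} (h1 : Lev M s k P) (h2 : Lev M s k Q) :
    Lev M s k fun γ => P γ ∨ Q γ := by
  have := (h1.neg.and h2.neg).neg
  rw [Side.swap_swap] at this
  simpa only [not_and_or, not_not] using this

/-- Separation for a predicate such that each element of `w` has a witness that decides it. -/
lemma sep_of_decide {k : ℕ} (hk : k ≤ lvl M + 2)
    (ih : ∀ P : M → Prop, Lev M .pi k P → Sep M P) {Q : M × M → Prop} (hQ : Lev M .pi k Q)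
    {D : M × M → Prop} (hD : Lev M .pi (lvl M + 2) D) (hdec : ∀ x, ∃ c, D (x, c))
    {P : M → Prop} (hP : ∀ x, P x ↔ ∃ c, Q (x, c)) (hDQ : ∀ x c, D (x, c) → P x → Q (x, c)) :
    Sep M P := by
  intro w
  obtain ⟨C, hC⟩ := TModel.coll D hD w fun x _ => hdec x
  obtain ⟨y, hy⟩ := ih (fun x => ∃ c, c ε C ∧ Q (x, c))
    ((bq (by omega)).bex (IsCo.const C) hQ) w
  refine ⟨y, fun x => ?_⟩
  rw [hy]
  refine and_congr_right fun hx => ⟨?_, fun h => ?_⟩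
  · rintro ⟨c, -, h⟩; exact (hP x).2 ⟨c, h⟩
  · obtain ⟨c, hc, h'⟩ := hC x hx
    exact ⟨c, hc, hDQ x c h' h⟩

lemma sep_pi {k : ℕ} (hk : k ≤ lvl M + 2) : ∀ P : M → Prop, Lev M .pi k P → Sep M P := by
  induction k with
  | zero =>
    intro P hP
    cases hP with
    | zero _ h => exact TModel.sep0 P h
  | succ k ih =>
    intro P hP
    obtain ⟨Q, hQ, hPQ⟩ := hP.neg.contract (bq (by omega))
    have h1 : Sep M fun x => ¬ P x := by
      refine sep_of_decide (k := k) (by omega) (ih (by omega)) hQ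
        (D := fun p => Q p ∨ P p.1) ?_ ?_ hPQ ?_
      · exact ((hQ.lift).or (hP.comp coMap_fst)).mono hk
      · intro x
        by_cases h : P x
        · exact ⟨x, Or.inr h⟩
        · obtain ⟨c, hc⟩ := (hPQ x).1 h
          exact ⟨c, Or.inl hc⟩
      · exact fun x c h h' => h.resolve_right h'
    simpa only [not_not] using h1.compl

lemma sep_delta {P : M → Prop} (h1 : Lev M .sigma (lvl M + 3) P)
    (h2 : Lev M .pi (lvl M + 3) P) : Sep M P := by
  obtain ⟨Q, hQ, hPQ⟩ := h1.contract (bq (by omega))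
  obtain ⟨Q', hQ', hPQ'⟩ := h2.neg.contract (bq (by omega))
  refine sep_of_decide (k := lvl M + 2) le_rfl (sep_pi le_rfl) hQ (D := fun p => Q p ∨ Q' p)
    (hQ.or hQ') ?_ hPQ ?_
  · intro x
    by_cases h : P x
    · obtain ⟨c, hc⟩ := (hPQ x).1 h; exact ⟨c, Or.inl hc⟩
    · obtain ⟨c, hc⟩ := (hPQ' x).1 h; exact ⟨c, Or.inr hc⟩
  · exact fun x c h h' => h.resolve_right fun h'' => (hPQ' x).2 ⟨c, h''⟩ h'

lemma coll_sigma {R : M × M → Prop} (hR : Lev M .sigma (lvl M + 3) R) (w : M)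
    (h : ∀ x, x ε w → ∃ y, R (x, y)) : ∃ C, ∀ x, x ε w → ∃ y, y ε C ∧ R (x, y) := by
  obtain ⟨Q, hQ, hPQ⟩ := hR.contract (bq (by omega))
  have hg : CoMap M fun p : ((M × M) × M) × M => ((p.1.1.1, p.1.2), p.2) :=
    CoMap.lift M (fun q : (M × M) × M => (q.1.1, q.2)) (CoMap.lift M _ coMap_fst)
  have h1 := (bq (by omega)).bex (f := fun p : (M × M) × M => p.1.2) IsCo.snd.fst (hQ.comp hg)
  have h2 := (bq (by omega)).bex (f := fun p : M × M => p.2) IsCo.snd h1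
  obtain ⟨C, hC⟩ := TModel.coll _ h2 w (by
    intro x hx
    obtain ⟨y, hy⟩ := h x hx
    obtain ⟨c, hc⟩ := (hPQ _).1 hy
    obtain ⟨p, hp⟩ := TModel.pair y c
    exact ⟨p, y, (hp y).2 (Or.inl rfl), c, (hp c).2 (Or.inr rfl), hc⟩)
  obtain ⟨U, hU⟩ := TModel.union C
  refine ⟨U, fun x hx => ?_⟩
  obtain ⟨p, hp, y, hy, c, -, hc⟩ := hC x hx
  exact ⟨y, (hU y).2 ⟨p, hp, hy⟩, (hPQ _).2 ⟨c, hc⟩⟩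

end Calculus

section Instances

variable (M : Type) [setLang.Structure M] [TModel M]

open TModel (lvl)

variable {Γ Δ : Type} [Ctx M Γ] [Ctx M Δ]

/-- `Σ_{n+1}`-predicates (no condition beyond the levels for which collection is available). -/
class Sg (n : ℕ) (P : Γ → Prop) : Prop where
  lev : n ≤ lvl M + 2 → Lev M .sigma (n + 1) P

/-- `Π_{n+1}`-predicates. -/
class Pg (n : ℕ) (P : Γ → Prop) : Prop where
  lev : n ≤ lvl M + 2 → Lev M .pi (n + 1) P

/-- `Δ_{n+1}`-predicates. -/
class Dg (n : ℕ) (P : Γ → Prop) : Prop where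
  sg : Sg M n P
  pg : Pg M n P

/-- Functions with a `Σ_{n+1}`-graph. -/
class DFun (n : ℕ) (f : Γ → M) : Prop where
  graph : Sg M n fun p : Γ × M => p.2 = f p.1

variable (n : ℕ) {P Q : Γ → Prop}

instance (priority := 50) Dg.toSg [h : Dg M n P] : Sg M n P := h.sg
instance (priority := 50) Dg.toPg [h : Dg M n P] : Pg M n P := h.pg

instance (priority := 20) Sg.toDg [h : Sg M n P] : Dg M (n + 1) P :=
  ⟨⟨fun hn => (h.lev (by omega)).lift⟩, ⟨fun hn => .next .pi (n + 1) (h.lev (by omega))⟩⟩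
instance (priority := 10) Pg.toDg [h : Pg M n P] : Dg M (n + 1) P :=
  ⟨⟨fun hn => .next .sigma (n + 1) (h.lev (by omega))⟩, ⟨fun hn => (h.lev (by omega)).lift⟩⟩

instance Sg.and [h1 : Sg M n P] [h2 : Sg M n Q] : Sg M n fun γ => P γ ∧ Q γ :=
  ⟨fun hn => (h1.lev hn).and (h2.lev hn)⟩
instance Pg.and [h1 : Pg M n P] [h2 : Pg M n Q] : Pg M n fun γ => P γ ∧ Q γ :=
  ⟨fun hn => (h1.lev hn).and (h2.lev hn)⟩
instance Dg.and [h1 : Dg M n P] [h2 : Dg M n Q] : Dg M n fun γ => P γ ∧ Q γ :=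
  ⟨inferInstance, inferInstance⟩
instance Sg.or [h1 : Sg M n P] [h2 : Sg M n Q] : Sg M n fun γ => P γ ∨ Q γ :=
  ⟨fun hn => (h1.lev hn).or (h2.lev hn)⟩
instance Pg.or [h1 : Pg M n P] [h2 : Pg M n Q] : Pg M n fun γ => P γ ∨ Q γ :=
  ⟨fun hn => (h1.lev hn).or (h2.lev hn)⟩
instance Dg.or [h1 : Dg M n P] [h2 : Dg M n Q] : Dg M n fun γ => P γ ∨ Q γ :=
  ⟨inferInstance, inferInstance⟩
instance Sg.not [h : Pg M n P] : Sg M n fun γ => ¬ P γ := ⟨fun hn => (h.lev hn).neg⟩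
instance Pg.not [h : Sg M n P] : Pg M n fun γ => ¬ P γ := ⟨fun hn => (h.lev hn).neg⟩
instance Dg.not [h : Dg M n P] : Dg M n fun γ => ¬ P γ := ⟨inferInstance, inferInstance⟩
instance Sg.imp [h1 : Pg M n P] [h2 : Sg M n Q] : Sg M n fun γ => P γ → Q γ := by
  simp only [imp_iff_not_or]; infer_instance
instance Pg.imp [h1 : Sg M n P] [h2 : Pg M n Q] : Pg M n fun γ => P γ → Q γ := by
  simp only [imp_iff_not_or]; infer_instance
instance Dg.imp [h1 : Dg M n P] [h2 : Dg M n Q] : Dg M n fun γ => P γ → Q γ :=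
  ⟨inferInstance, inferInstance⟩
instance Dg.iff [h1 : Dg M n P] [h2 : Dg M n Q] : Dg M n fun γ => P γ ↔ Q γ := by
  simp only [iff_iff_implies_and_implies]; infer_instance

instance Sg.ex {Q : Γ → M → Prop} [h : Sg M n fun p : Γ × M => Q p.1 p.2] :
    Sg M n fun γ => ∃ x, Q γ x := ⟨fun hn => .ex n (h.lev hn)⟩
instance Pg.all {Q : Γ → M → Prop} [h : Pg M n fun p : Γ × M => Q p.1 p.2] :
    Pg M n fun γ => ∀ x, Q γ x := ⟨fun hn => .all n (h.lev hn)⟩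

instance coMap_id' : CoMap M fun γ : Γ => γ := CoMap.id M
instance coMap_fst' {g : Γ → Δ × M} [h : CoMap M g] : CoMap M fun γ => (g γ).1 := CoMap.fst M _ h

lemma dFun_of_isCo {f : Γ → M} (h : IsCo M f) : DFun M n f :=
  ⟨⟨fun _ => Lev.mono (Nat.zero_le _) (.zero _ (.eq IsCo.snd h.fst))⟩⟩

instance dFun_const (c : M) : DFun M n fun _ : Γ => c := dFun_of_isCo M n (IsCo.const c)
instance dFun_snd {g : Γ → Δ × M} [h : CoMap M g] : DFun M n fun γ => (g γ).2 :=
  dFun_of_isCo M n h.snd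
instance dFun_self : DFun M n fun x : M => x := dFun_of_isCo M n IsCo.self
instance dFun_fst {g : Γ → M × M} [h : CoMap M g] : DFun M n fun γ => (g γ).1 :=
  dFun_of_isCo M n (CoMap.fst M _ h).toCo

variable {M n}

lemma Sg.comp {P : Δ → Prop} (h : Sg M n P) {g : Γ → Δ} (hg : CoMap M g) : Sg M n fun γ => P (g γ) :=
  ⟨fun hn => (h.lev hn).comp hg⟩
lemma Pg.comp {P : Δ → Prop} (h : Pg M n P) {g : Γ → Δ} (hg : CoMap M g) : Pg M n fun γ => P (g γ) :=
  ⟨fun hn => (h.lev hn).comp hg⟩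
lemma Dg.comp {P : Δ → Prop} (h : Dg M n P) {g : Γ → Δ} (hg : CoMap M g) : Dg M n fun γ => P (g γ) :=
  ⟨h.sg.comp hg, h.pg.comp hg⟩

lemma Dg.ofZ {P : Γ → Prop} (h : Z M P) : Dg M n P :=
  ⟨⟨fun _ => Lev.mono (Nat.zero_le _) (.zero _ h)⟩, ⟨fun _ => Lev.mono (Nat.zero_le _) (.zero _ h)⟩⟩

/-- Substituting a definable function for the last coordinate. -/
lemma Sg.subst {P : Γ × M → Prop} (h : Sg M n P) {f : Γ → M} (hf : DFun M n f) :
    Sg M n fun γ => P (γ, f γ) := by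
  have := hf.graph
  have : Sg M n fun γ => ∃ x, x = f γ ∧ P (γ, x) := inferInstance
  simpa only [exists_eq_left] using this
lemma Pg.subst {P : Γ × M → Prop} (h : Pg M n P) {f : Γ → M} (hf : DFun M n f) :
    Pg M n fun γ => P (γ, f γ) := by
  have := hf.graph
  have : Pg M n fun γ => ∀ x, x = f γ → P (γ, x) := inferInstance
  simpa only [forall_eq] using this
lemma Dg.subst {P : Γ × M → Prop} (h : Dg M n P) {f : Γ → M} (hf : DFun M n f) :
    Dg M n fun γ => P (γ, f γ) := ⟨h.sg.subst hf, h.pg.subst hf⟩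

lemma DFun.comp {f : Δ → M} (hf : DFun M n f) {g : Γ → Δ} (hg : CoMap M g) :
    DFun M n fun γ => f (g γ) := ⟨hf.graph.comp (CoMap.lift M _ hg)⟩

lemma DFun.subst {F : Γ × M → M} (h : DFun M n F) {f : Γ → M} (hf : DFun M n f) :
    DFun M n fun γ => F (γ, f γ) := by
  refine ⟨?_⟩
  have h1 : Sg M n fun q : (Γ × M) × M => q.1.2 = F (q.1.1, q.2) :=
    h.graph.comp (g := fun q : (Γ × M) × M => ((q.1.1, q.2), q.1.2))
      (CoMap.pair _ _ (CoMap.lift M _ coMap_fst) IsCo.snd.fst)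
  exact h1.subst (f := fun p : Γ × M => f p.1) (hf.comp coMap_fst)

section Substitution

variable {f g h k : Γ → M}

lemma Dg.comp₁ {R : M → Prop} (hR : Dg M n R) (hf : DFun M n f) : Dg M n fun γ => R (f γ) :=
  (hR.comp (g := fun p : Γ × M => p.2) (CoMap.ofCo IsCo.snd)).subst hf
lemma Dg.comp₂ {R : M × M → Prop} (hR : Dg M n R) (hf : DFun M n f) (hg : DFun M n g) :
    Dg M n fun γ => R (f γ, g γ) := by
  have h1 : Dg M n fun q : (Γ × M) × M => R (q.1.2, q.2) :=
    hR.comp (CoMap.pair _ _ (CoMap.ofCo IsCo.snd.fst) IsCo.snd)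
  exact (h1.subst (f := fun q : Γ × M => g q.1) (hg.comp coMap_fst)).subst hf
lemma Dg.comp₃ {R : (M × M) × M → Prop} (hR : Dg M n R) (hf : DFun M n f) (hg : DFun M n g)
    (hh : DFun M n h) : Dg M n fun γ => R ((f γ, g γ), h γ) := by
  have h1 : Dg M n fun q : ((Γ × M) × M) × M => R ((q.1.1.2, q.1.2), q.2) :=
    hR.comp (CoMap.pair _ _ (CoMap.pair _ _ (CoMap.ofCo IsCo.snd.fst.fst) IsCo.snd.fst) IsCo.snd)
  exact ((h1.subst (f := fun q : (Γ × M) × M => h q.1.1)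
    (hh.comp (coMap_fst.trans coMap_fst))).subst (f := fun q : Γ × M => g q.1)
      (hg.comp coMap_fst)).subst hf
lemma Sg.comp₁ {R : M → Prop} (hR : Sg M n R) (hf : DFun M n f) : Sg M n fun γ => R (f γ) :=
  (hR.comp (g := fun p : Γ × M => p.2) (CoMap.ofCo IsCo.snd)).subst hf
lemma Sg.comp₂ {R : M × M → Prop} (hR : Sg M n R) (hf : DFun M n f) (hg : DFun M n g) :
    Sg M n fun γ => R (f γ, g γ) := by
  have h1 : Sg M n fun q : (Γ × M) × M => R (q.1.2, q.2) :=
    hR.comp (CoMap.pair _ _ (CoMap.ofCo IsCo.snd.fst) IsCo.snd)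
  exact (h1.subst (f := fun q : Γ × M => g q.1) (hg.comp coMap_fst)).subst hf
lemma DFun.comp₁ {F : M → M} (hF : DFun M n F) (hf : DFun M n f) : DFun M n fun γ => F (f γ) :=
  (hF.comp (g := fun p : Γ × M => p.2) (CoMap.ofCo IsCo.snd)).subst hf
lemma DFun.comp₂ {F : M × M → M} (hF : DFun M n F) (hf : DFun M n f) (hg : DFun M n g) :
    DFun M n fun γ => F (f γ, g γ) := by
  have h1 : DFun M n fun q : (Γ × M) × M => F (q.1.2, q.2) :=
    hF.comp (CoMap.pair _ _ (CoMap.ofCo IsCo.snd.fst) IsCo.snd)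
  exact (h1.subst (f := fun q : Γ × M => g q.1) (hg.comp coMap_fst)).subst hf
lemma DFun.comp₃ {F : (M × M) × M → M} (hF : DFun M n F) (hf : DFun M n f) (hg : DFun M n g)
    (hh : DFun M n h) : DFun M n fun γ => F ((f γ, g γ), h γ) := by
  have h1 : DFun M n fun q : ((Γ × M) × M) × M => F ((q.1.1.2, q.1.2), q.2) :=
    hF.comp (CoMap.pair _ _ (CoMap.pair _ _ (CoMap.ofCo IsCo.snd.fst.fst) IsCo.snd.fst) IsCo.snd)
  exact ((h1.subst (f := fun q : (Γ × M) × M => h q.1.1)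
    (hh.comp (coMap_fst.trans coMap_fst))).subst (f := fun q : Γ × M => g q.1)
      (hg.comp coMap_fst)).subst hf

instance dg_mem [hf : DFun M n f] [hg : DFun M n g] : Dg M n fun γ => f γ ε g γ :=
  Dg.comp₂ (R := fun p : M × M => p.1 ε p.2) (Dg.ofZ (.mem IsCo.self.fst IsCo.snd)) hf hg
instance dg_eq [hf : DFun M n f] [hg : DFun M n g] : Dg M n fun γ => f γ = g γ :=
  Dg.comp₂ (R := fun p : M × M => p.1 = p.2) (Dg.ofZ (.eq IsCo.self.fst IsCo.snd)) hf hg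

instance (c : M) : Dg M n (E c) := dg_mem (f := fun _ => c) (g := fun x => x)
instance (c : M) : Dg M n (Eq c) := dg_eq (f := fun _ => c) (g := fun x => x)

instance Sg.ball {Q : Γ → M → Prop} [hf : DFun M n f] [h : Sg M n fun p : Γ × M => Q p.1 p.2] :
    Sg M n fun γ => ∀ x, x ε f γ → Q γ x := by
  have h1 : Sg M n fun p : Γ × M => ∀ x, x ε p.2 → Q p.1 x :=
    ⟨fun hn => bq (M := M) (by omega) .sigma (f := fun p : Γ × M => p.2) IsCo.snd
      (P := fun q : (Γ × M) × M => Q q.1.1 q.2)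
      ((h.comp (g := fun q : (Γ × M) × M => (q.1.1, q.2)) (CoMap.lift M _ coMap_fst)).lev hn)⟩
  exact h1.subst hf
instance Pg.bex {Q : Γ → M → Prop} [hf : DFun M n f] [h : Pg M n fun p : Γ × M => Q p.1 p.2] :
    Pg M n fun γ => ∃ x, x ε f γ ∧ Q γ x := by
  have h1 : Sg M n fun γ => ∀ x, x ε f γ → ¬ Q γ x := inferInstance
  have h2 : Pg M n fun γ => ¬ ∀ x, x ε f γ → ¬ Q γ x := inferInstance
  simpa only [not_forall, not_not, exists_prop] using h2
instance Dg.ball {Q : Γ → M → Prop} [hf : DFun M n f] [h : Dg M n fun p : Γ × M => Q p.1 p.2] :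
    Dg M n fun γ => ∀ x, x ε f γ → Q γ x :=
  have : DFun M n fun p : Γ × M => f p.1 := hf.comp coMap_fst
  ⟨inferInstance, inferInstance⟩
instance Dg.bex {Q : Γ → M → Prop} [hf : DFun M n f] [h : Dg M n fun p : Γ × M => Q p.1 p.2] :
    Dg M n fun γ => ∃ x, x ε f γ ∧ Q γ x :=
  have : DFun M n fun p : Γ × M => f p.1 := hf.comp coMap_fst
  ⟨inferInstance, inferInstance⟩

end Substitution

/-! ## Separation, collection and induction -/

lemma sep (P : M → Prop) [h : Dg M (lvl M + 2) P] (w : M) : ∃ y, ∀ x, x ε y ↔ (x ε w ∧ P x) :=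
  sep_delta (h.sg.lev le_rfl) (h.pg.lev le_rfl) w

lemma coll (R : M → M → Prop) [h : Sg M (lvl M + 2) fun p : M × M => R p.1 p.2] (w : M)
    (hw : ∀ x, x ε w → ∃ y, R x y) : ∃ C, ∀ x, x ε w → ∃ y, y ε C ∧ R x y :=
  coll_sigma (h.lev le_rfl) w hw

lemma mem_induction (P : M → Prop) [h : Dg M (lvl M + 2) P]
    (ih : ∀ x, (∀ y, y ε x → P y) → P x) (x : M) : P x := by
  by_contra hx
  obtain ⟨t, ht, hxt⟩ := TModel.tco x
  obtain ⟨y, hy⟩ := sep (fun z => ¬ P z) t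
  have h0 : ¬ ∀ z, z ε x → P z := fun h => hx (ih x h)
  push Not at h0
  obtain ⟨z, hz, hPz⟩ := h0
  obtain ⟨u, hu, hu'⟩ := TModel.found y ⟨z, (hy z).2 ⟨hxt z hz, hPz⟩⟩
  obtain ⟨hut, hPu⟩ := (hy u).1 hu
  exact hPu (ih u fun v hv => by_contra fun hPv => hu' v hv ((hy v).2 ⟨ht u hut v hv, hPv⟩))

lemma nat_induction (P : M → Prop) [h : Sg M (lvl M + 2) P] (h0 : ∀ e, Emp e → P e)
    (h1 : ∀ x s, Nt x → IsSuc x s → P x → P s) (x : M) (hx : Nt x) : P x := by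
  obtain ⟨e, he⟩ := TModel.empty (M := M)
  refine TModel.ind P (h.lev le_rfl) ⟨e, he, h0 e he⟩ (fun x hx hP => ?_) x hx
  obtain ⟨p, hp⟩ := TModel.pair x x
  obtain ⟨q, hq⟩ := TModel.pair x p
  obtain ⟨s, hs⟩ := TModel.union q
  have : IsSuc x s := fun z => by
    rw [hs]
    constructor
    · rintro ⟨y, hy, hz⟩
      rcases (hq y).1 hy with rfl | rfl
      · exact Or.inl hz
      · exact Or.inr (by simpa using (hp z).1 hz)
    · rintro (h | rfl)
      · exact ⟨x, (hq x).2 (Or.inl rfl), h⟩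
      · exact ⟨p, (hq p).2 (Or.inr rfl), (hp z).2 (Or.inl rfl)⟩
  exact ⟨s, this, h1 x s hx this hP⟩

end Instances

end FOSet

namespace FOSet

noncomputable section Basic

set_option linter.unusedSectionVars false

open TModel (lvl)

variable {M : Type} [setLang.Structure M] [TModel M] {Γ : Type} [Ctx M Γ] {n : ℕ}

lemma Dg.congr {P Q : Γ → Prop} (h : ∀ γ, P γ ↔ Q γ) [hQ : Dg M n Q] : Dg M n P := by
  rwa [show P = Q from funext fun γ => propext (h γ)]

lemma Sg.congr {P Q : Γ → Prop} (h : ∀ γ, P γ ↔ Q γ) [hQ : Sg M n Q] : Sg M n P := by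
  rwa [show P = Q from funext fun γ => propext (h γ)]

lemma DFun.of_iff {F : Γ → M} {Q : Γ → M → Prop} (h : ∀ γ y, y = F γ ↔ Q γ y)
    [Sg M n fun p : Γ × M => Q p.1 p.2] : DFun M n F := ⟨Sg.congr fun p => h p.1 p.2⟩

@[ext] lemma ext {x y : M} (h : ∀ z, z ε x ↔ z ε y) : x = y := TModel.ext x y h

def emp : M := (TModel.empty (M := M)).choose
@[simp] lemma not_mem_emp (x : M) : ¬ x ε emp := (TModel.empty (M := M)).choose_spec x
lemma emp_iff {x : M} : Emp x ↔ x = emp :=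
  ⟨fun h => ext fun z => by simp [h z], by rintro rfl; exact not_mem_emp⟩

def upr (x y : M) : M := (TModel.pair x y).choose
@[simp] lemma mem_upr {x y z : M} : z ε upr x y ↔ (z = x ∨ z = y) := (TModel.pair x y).choose_spec z
lemma up_iff {p x y : M} : UP p x y ↔ p = upr x y :=
  ⟨fun h => ext fun z => by rw [h z, mem_upr], by rintro rfl z; exact mem_upr⟩

def un (x : M) : M := (TModel.union x).choose
lemma mem_un {x z : M} : z ε un x ↔ ∃ y, y ε x ∧ z ε y := (TModel.union x).choose_spec z

def cup (x y : M) : M := un (upr x y)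
@[simp] lemma mem_cup {x y z : M} : z ε cup x y ↔ (z ε x ∨ z ε y) := by simp [cup, mem_un]

def sing (x : M) : M := upr x x
@[simp] lemma mem_sing {x z : M} : z ε sing x ↔ z = x := by simp [sing]

def suc (x : M) : M := cup x (sing x)
@[simp] lemma mem_suc {x z : M} : z ε suc x ↔ (z ε x ∨ z = x) := by simp [suc]
lemma isSuc_iff {x s : M} : IsSuc x s ↔ s = suc x :=
  ⟨fun h => ext fun z => by rw [h z, mem_suc], by rintro rfl z; exact mem_suc⟩

def pw (x : M) : M := (TModel.power x).choose
@[simp] lemma mem_pw {x z : M} : z ε pw x ↔ Sub z x := (TModel.power x).choose_spec z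

def pr (x y : M) : M := upr (sing x) (upr x y)
lemma pr_iff {p x y : M} : PR p x y ↔ p = pr x y := by
  simp [PR, up_iff, pr, sing]

lemma upr_inj {x y z : M} (h : upr x y = upr x z) : y = z := by
  have h1 : y ε upr x z := by rw [← h]; simp
  have h2 : z ε upr x y := by rw [h]; simp
  rw [mem_upr] at h1 h2
  rcases h1 with rfl | h1
  · rcases h2 with h2 | h2 <;> exact h2.symm
  · exact h1

lemma pr_inj {x y x' y' : M} : pr x y = pr x' y' ↔ (x = x' ∧ y = y') := by
  constructor
  · intro h
    have hx : x = x' := by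
      have : sing x' ε pr x y := by rw [h]; simp [pr]
      rw [pr, mem_upr] at this
      rcases this with h | h
      · have : x ε sing x' := by rw [h]; simp
        simpa using this
      · have : x ε sing x' := by rw [h]; simp
        simpa using this
    subst hx
    exact ⟨rfl, upr_inj (upr_inj h)⟩
  · rintro ⟨rfl, rfl⟩; rfl

lemma ap_iff {r x y : M} : Ap r x y ↔ pr x y ε r := by simp [Ap, pr_iff]

lemma left_mem_un_pr (x y : M) : x ε un (pr x y) := mem_un.2 ⟨sing x, by simp [pr], by simp⟩
lemma right_mem_un_pr (x y : M) : y ε un (pr x y) := mem_un.2 ⟨upr x y, by simp [pr], by simp⟩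

open Classical in
/-- The first component of an ordered pair. -/
def fst (p : M) : M := if h : ∃ x y, p = pr x y then h.choose else emp
open Classical in
/-- The second component of an ordered pair. -/
def snd (p : M) : M := if h : ∃ y x, p = pr x y then h.choose else emp

@[simp] lemma fst_pr (x y : M) : fst (pr x y) = x := by
  have h : ∃ x' y', pr x y = pr x' y' := ⟨x, y, rfl⟩
  rw [fst, dif_pos h]
  obtain ⟨y', hy⟩ := h.choose_spec
  exact (pr_inj.1 hy).1.symm
@[simp] lemma snd_pr (x y : M) : snd (pr x y) = y := by
  have h : ∃ y' x', pr x y = pr x' y' := ⟨y, x, rfl⟩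
  rw [snd, dif_pos h]
  obtain ⟨x', hx⟩ := h.choose_spec
  exact (pr_inj.1 hx).2.symm

instance dFun_un {f : Γ → M} [hf : DFun M n f] : DFun M n fun γ => un (f γ) := by
  refine DFun.comp₁ (F := un) (.of_iff (Q := fun x u => (∀ z, z ε u → ∃ y, y ε x ∧ z ε y) ∧
    ∀ y, y ε x → ∀ z, z ε y → z ε u) fun x u => ?_) hf
  constructor
  · rintro rfl
    exact ⟨fun z hz => mem_un.1 hz, fun y hy z hz => mem_un.2 ⟨y, hy, hz⟩⟩
  · rintro ⟨h1, h2⟩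
    ext z
    exact ⟨fun h => mem_un.2 (h1 z h), fun h => by
      obtain ⟨y, hy, hz⟩ := mem_un.1 h; exact h2 y hy z hz⟩

instance dFun_upr {f g : Γ → M} [hf : DFun M n f] [hg : DFun M n g] :
    DFun M n fun γ => upr (f γ) (g γ) := by
  refine DFun.comp₂ (F := fun p : M × M => upr p.1 p.2) (.of_iff (Q := fun p u => p.1 ε u ∧
    p.2 ε u ∧ ∀ z, z ε u → z = p.1 ∨ z = p.2) fun p u => ?_) hf hg
  constructor
  · rintro rfl; simp
  · rintro ⟨h1, h2, h3⟩
    ext z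
    rw [mem_upr]
    exact ⟨h3 z, by rintro (rfl | rfl) <;> assumption⟩

instance dFun_cup {f g : Γ → M} [DFun M n f] [DFun M n g] : DFun M n fun γ => cup (f γ) (g γ) := by
  unfold cup; infer_instance
instance dFun_sing {f : Γ → M} [DFun M n f] : DFun M n fun γ => sing (f γ) := by
  unfold sing; infer_instance
instance dFun_suc {f : Γ → M} [DFun M n f] : DFun M n fun γ => suc (f γ) := by
  unfold suc; infer_instance
instance dFun_pr {f g : Γ → M} [DFun M n f] [DFun M n g] : DFun M n fun γ => pr (f γ) (g γ) := by
  unfold pr; infer_instance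

instance dFun_fst' {f : Γ → M} [hf : DFun M n f] : DFun M n fun γ => fst (f γ) := by
  refine DFun.comp₁ (F := fst) (.of_iff (Q := fun p u =>
    (∃ x, x ε un p ∧ ∃ y, y ε un p ∧ p = pr x y ∧ u = x) ∨
    ((∀ x, x ε un p → ∀ y, y ε un p → ¬ p = pr x y) ∧ u = emp)) fun p u => ?_) hf
  by_cases h : ∃ x y, p = pr x y
  · obtain ⟨x, y, rfl⟩ := h
    constructor
    · rintro rfl
      exact Or.inl ⟨x, left_mem_un_pr x y, y, right_mem_un_pr x y, rfl, fst_pr x y⟩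
    · rintro (⟨x', -, y', -, h, rfl⟩ | ⟨h, -⟩)
      · rw [h, fst_pr]
      · exact absurd rfl (h x (left_mem_un_pr x y) y (right_mem_un_pr x y))
  · rw [fst, dif_neg h]
    push Not at h
    simp [h]
instance : DFun M n (fst : M → M) := dFun_fst' (f := fun x => x)

instance dFun_snd' {f : Γ → M} [hf : DFun M n f] : DFun M n fun γ => snd (f γ) := by
  refine DFun.comp₁ (F := snd) (.of_iff (Q := fun p u =>
    (∃ x, x ε un p ∧ ∃ y, y ε un p ∧ p = pr x y ∧ u = y) ∨
    ((∀ x, x ε un p → ∀ y, y ε un p → ¬ p = pr x y) ∧ u = emp)) fun p u => ?_) hf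
  by_cases h : ∃ y x, p = pr x y
  · obtain ⟨y, x, rfl⟩ := h
    constructor
    · rintro rfl
      exact Or.inl ⟨x, left_mem_un_pr x y, y, right_mem_un_pr x y, rfl, snd_pr x y⟩
    · rintro (⟨x', -, y', -, h, rfl⟩ | ⟨h, -⟩)
      · rw [h, snd_pr]
      · exact absurd rfl (h x (left_mem_un_pr x y) y (right_mem_un_pr x y))
  · rw [snd, dif_neg h]
    push Not at h
    have h' : ∀ x y, ¬ p = pr x y := fun x y => h y x
    simp [h']
instance : DFun M n (snd : M → M) := dFun_snd' (f := fun x => x)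

instance dg_sub {f g : Γ → M} [hf : DFun M n f] [hg : DFun M n g] : Dg M n fun γ => Sub (f γ) (g γ) :=
  Dg.comp₂ (R := fun p : M × M => Sub p.1 p.2) (by unfold Sub; infer_instance) hf hg
instance dg_tr {f : Γ → M} [hf : DFun M n f] : Dg M n fun γ => Tr (f γ) :=
  Dg.comp₁ (R := Tr) (by unfold Tr; infer_instance) hf
instance : Dg M n (Tr : M → Prop) := dg_tr (f := fun x => x)
instance dg_ordl {f : Γ → M} [hf : DFun M n f] : Dg M n fun γ => Ordl (f γ) :=
  Dg.comp₁ (R := Ordl) (by unfold Ordl; infer_instance) hf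
instance : Dg M n (Ordl : M → Prop) := dg_ordl (f := fun x => x)

lemma Sub.refl (x : M) : Sub x x := fun _ h => h
lemma Sub.trans {x y z : M} (h : Sub x y) (h' : Sub y z) : Sub x z := fun w hw => h' w (h w hw)
lemma Sub.antisymm {x y : M} (h : Sub x y) (h' : Sub y x) : x = y := ext fun z => ⟨h z, h' z⟩

lemma mem_irrefl (x : M) : ¬ x ε x := by
  intro h
  obtain ⟨y, hy, h'⟩ := TModel.found (sing x) ⟨x, by simp⟩
  obtain rfl := mem_sing.1 hy
  exact h' y h (by simp)

/-- Every set belongs to a transitive set. -/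
lemma exists_tr (x : M) : ∃ t, Tr t ∧ x ε t := by
  obtain ⟨t, ht, h⟩ := TModel.tco (sing x)
  exact ⟨t, ht, h x (by simp)⟩

/-! ## Functions -/

open Classical in
/-- The value of a function. -/
def ev (f x : M) : M := if h : ∃ y, pr x y ε f ∧ ∀ z, pr x z ε f → z = y then h.choose else emp

lemma right_mem_of_pr {x y f : M} (h : pr x y ε f) : y ε un (un f) :=
  mem_un.2 ⟨_, mem_un.2 ⟨_, h, by simp [pr]⟩, (by simp : y ε upr x y)⟩

instance dFun_ev {f g : Γ → M} [hf : DFun M n f] [hg : DFun M n g] :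
    DFun M n fun γ => ev (f γ) (g γ) := by
  refine DFun.comp₂ (F := fun p : M × M => ev p.1 p.2) (.of_iff (Q := fun p y =>
    (pr p.2 y ε p.1 ∧ ∀ z, z ε un (un p.1) → pr p.2 z ε p.1 → z = y) ∨
    ((¬ ∃ w, w ε un (un p.1) ∧ pr p.2 w ε p.1 ∧
      ∀ z, z ε un (un p.1) → pr p.2 z ε p.1 → z = w) ∧ y = emp)) fun p y => ?_) hf hg
  obtain ⟨f, x⟩ := p
  by_cases h : ∃ y, pr x y ε f ∧ ∀ z, pr x z ε f → z = y
  · have h' := h.choose_spec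
    simp only [ev, dif_pos h]
    constructor
    · rintro rfl
      exact Or.inl ⟨h'.1, fun z _ hz => h'.2 z hz⟩
    · rintro (⟨h1, -⟩ | ⟨h1, -⟩)
      · exact h'.2 y h1
      · exact absurd ⟨_, right_mem_of_pr h'.1, h'.1, fun z _ hz => h'.2 z hz⟩ h1
  · simp only [ev, dif_neg h]
    constructor
    · rintro rfl
      refine Or.inr ⟨?_, rfl⟩
      rintro ⟨w, -, h1, h2⟩
      exact h ⟨w, h1, fun z hz => h2 z (right_mem_of_pr hz) hz⟩
    · rintro (⟨h1, h2⟩ | ⟨-, h1⟩)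
      · exact absurd ⟨y, h1, fun z hz => h2 z (right_mem_of_pr hz) hz⟩ h
      · exact h1
instance (c : M) : DFun M n (ev c) := dFun_ev (f := fun _ => c) (g := fun x => x)

/-- `f` is a function with domain `d`. -/
def Fn (f d : M) : Prop :=
  (∀ p, p ε f → ∃ x, x ε d ∧ p = pr x (ev f x)) ∧ ∀ x, x ε d → pr x (ev f x) ε f

instance dg_fn {f g : Γ → M} [hf : DFun M n f] [hg : DFun M n g] : Dg M n fun γ => Fn (f γ) (g γ) :=
  Dg.comp₂ (R := fun p : M × M => Fn p.1 p.2) (by unfold Fn; infer_instance) hf hg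

lemma Fn.pr_mem {f d x y : M} (h : Fn f d) : pr x y ε f ↔ (x ε d ∧ y = ev f x) := by
  constructor
  · intro h'
    obtain ⟨x', hx', he⟩ := h.1 _ h'
    obtain ⟨rfl, rfl⟩ := pr_inj.1 he
    exact ⟨hx', rfl⟩
  · rintro ⟨hx, rfl⟩; exact h.2 x hx

lemma Fn.ev_eq {f d x y : M} (h : Fn f d) (h' : pr x y ε f) : ev f x = y := (h.pr_mem.1 h').2.symm

lemma ev_of_unique {f x y : M} (h : pr x y ε f) (h' : ∀ z, pr x z ε f → z = y) : ev f x = y := by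
  have h0 : ∃ y, pr x y ε f ∧ ∀ z, pr x z ε f → z = y := ⟨y, h, h'⟩
  rw [ev, dif_pos h0]
  exact h' _ h0.choose_spec.1

lemma Fn.of_unique {f d : M} (h1 : ∀ p, p ε f → ∃ x y, x ε d ∧ p = pr x y)
    (h2 : ∀ x, x ε d → ∃ y, pr x y ε f ∧ ∀ z, pr x z ε f → z = y) : Fn f d := by
  constructor
  · intro p hp
    obtain ⟨x, y, hx, rfl⟩ := h1 p hp
    obtain ⟨y', hy', hu⟩ := h2 x hx
    exact ⟨x, hx, by rw [ev_of_unique hy' hu, hu y hp]⟩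
  · intro x hx
    obtain ⟨y', hy', hu⟩ := h2 x hx
    rwa [ev_of_unique hy' hu]

lemma funOn_iff {f d : M} : FunOn f d ↔ Fn f d := by
  simp only [FunOn, pr_iff, ap_iff]
  refine ⟨fun h => Fn.of_unique h.1 h.2, fun h => ⟨fun p hp => ?_, fun x hx => ?_⟩⟩
  · obtain ⟨x, hx, rfl⟩ := h.1 p hp; exact ⟨x, _, hx, rfl⟩
  · exact ⟨ev f x, h.2 x hx, fun z hz => (h.ev_eq hz).symm⟩

lemma Fn.ext {f g d : M} (hf : Fn f d) (hg : Fn g d) (h : ∀ x, x ε d → ev f x = ev g x) : f = g := by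
  have key : ∀ {f g : M}, Fn f d → Fn g d → (∀ x, x ε d → ev f x = ev g x) → Sub f g := by
    intro f g hf hg h p hp
    obtain ⟨x, hx, rfl⟩ := hf.1 p hp
    exact hg.pr_mem.2 ⟨hx, h x hx⟩
  exact (key hf hg h).antisymm (key hg hf fun x hx => (h x hx).symm)

/-- Replacement: a definable function on a set is a set. -/
lemma exists_lam (d : M) (F : M → M) [hF : DFun M (lvl M + 2) F] :
    ∃ f, Fn f d ∧ ∀ x, x ε d → ev f x = F x := by
  have h1 : DFun M (lvl M + 2) fun p : M × M => F p.1 := hF.comp coMap_fst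
  have h2 : DFun M (lvl M + 2) fun p : M × M => F p.2 := hF.comp (CoMap.ofCo IsCo.snd)
  obtain ⟨C, hC⟩ := coll (fun x p => p = pr x (F x)) d fun x _ => ⟨_, rfl⟩
  obtain ⟨f, hf⟩ := sep (fun p => ∃ x, x ε d ∧ p = pr x (F x)) C
  have hmem : ∀ {x y}, x ε d → (pr x y ε f ↔ y = F x) := by
    intro x y hx
    rw [hf]
    constructor
    · rintro ⟨-, x', -, h⟩
      obtain ⟨rfl, rfl⟩ := pr_inj.1 h
      rfl
    · rintro rfl
      obtain ⟨p, hp, rfl⟩ := hC x hx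
      exact ⟨hp, x, hx, rfl⟩
  have hfn : Fn f d := by
    refine Fn.of_unique (fun p hp => ?_) fun x hx => ⟨F x, (hmem hx).2 rfl, fun z => (hmem hx).1⟩
    obtain ⟨-, x, hx, rfl⟩ := (hf p).1 hp
    exact ⟨x, _, hx, rfl⟩
  exact ⟨f, hfn, fun x hx => hfn.ev_eq ((hmem hx).2 rfl)⟩

/-! ## Ordinals -/

lemma Ordl.mem {α β : M} (h : Ordl α) (hβ : β ε α) : Ordl β :=
  ⟨h.2 β hβ, fun γ hγ => h.2 γ (h.1 β hβ γ hγ)⟩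
lemma Ordl.trans {α β γ : M} (h : Ordl α) (hβ : β ε α) (hγ : γ ε β) : γ ε α := h.1 β hβ γ hγ
lemma ordl_emp : Ordl (emp : M) := by simp [Ordl, Tr]
lemma Ordl.succ {α : M} (h : Ordl α) : Ordl (suc α) := by
  constructor
  · intro β hβ γ hγ
    rw [mem_suc] at hβ ⊢
    rcases hβ with hβ | rfl
    · exact Or.inl (h.trans hβ hγ)
    · exact Or.inl hγ
  · intro β hβ
    rcases mem_suc.1 hβ with hβ | rfl
    · exact h.2 β hβ
    · exact h.1
lemma ordl_un {x : M} (h : ∀ α, α ε x → Ordl α) : Ordl (un x) := by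
  constructor
  · intro β hβ γ hγ
    obtain ⟨α, hα, hβ⟩ := mem_un.1 hβ
    exact mem_un.2 ⟨α, hα, (h α hα).trans hβ hγ⟩
  · intro β hβ
    obtain ⟨α, hα, hβ⟩ := mem_un.1 hβ
    exact (h α hα).2 β hβ

lemma Ordl.trichotomy {α β : M} (hα : Ordl α) (hβ : Ordl β) : α ε β ∨ α = β ∨ β ε α := by
  have key := mem_induction (M := M) (fun α => ∀ β, Ordl α → Ordl β → α ε β ∨ α = β ∨ β ε α) ?_
  · exact key α β hα hβ
  intro α ih1 β
  refine mem_induction (fun β => Ordl α → Ordl β → α ε β ∨ α = β ∨ β ε α) (fun β ih2 hα hβ => ?_) β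
  by_contra hc
  push Not at hc
  obtain ⟨h1, h2, h3⟩ := hc
  refine h2 (Sub.antisymm (fun x hx => ?_) fun y hy => ?_)
  · rcases ih1 x hx β (hα.mem hx) hβ with h | rfl | h
    · exact h
    · exact absurd hx h3
    · exact absurd (hα.trans hx h) h3
  · rcases ih2 y hy hα (hβ.mem hy) with h | rfl | h
    · exact absurd (hβ.trans hy h) h1
    · exact absurd hy h1
    · exact h

lemma Ordl.sub_or_mem {α β : M} (hα : Ordl α) (hβ : Ordl β) : Sub α β ∨ β ε α := by
  rcases hα.trichotomy hβ with h | rfl | h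
  · exact Or.inl fun γ hγ => hβ.trans h hγ
  · exact Or.inl (Sub.refl _)
  · exact Or.inr h

lemma Ordl.sub_iff {α β : M} (hα : Ordl α) (hβ : Ordl β) : Sub α β ↔ α ε suc β := by
  rw [mem_suc]
  constructor
  · intro h
    rcases hα.trichotomy hβ with h' | rfl | h'
    · exact Or.inl h'
    · exact Or.inr rfl
    · exact absurd (h β h') (mem_irrefl β)
  · rintro (h | rfl)
    · exact fun γ hγ => hβ.trans h hγ
    · exact Sub.refl _

lemma exists_least (P : M → Prop) [Dg M (lvl M + 2) P] {x : M} (hx : P x) :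
    ∃ y, P y ∧ ∀ z, z ε y → ¬ P z := by
  by_contra hc
  push Not at hc
  refine mem_induction (fun x => ¬ P x) (fun y ih hy => ?_) x hx
  obtain ⟨z, hz, hPz⟩ := hc y hy
  exact ih z hz hPz

/-! ## Natural numbers -/

instance dg_zs {f : Γ → M} [hf : DFun M n f] : Dg M n fun γ => ZS (f γ) := by
  refine Dg.comp₁ (R := ZS) (Dg.congr (Q := fun x => x = emp ∨ ∃ y, y ε x ∧ x = suc y) fun x => ?_) hf
  simp only [ZS, emp_iff, isSuc_iff]
instance : Dg M n (ZS : M → Prop) := dg_zs (f := fun x => x)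

instance dg_nt {f : Γ → M} [hf : DFun M n f] : Dg M n fun γ => Nt (f γ) :=
  Dg.comp₁ (R := Nt) (by unfold Nt; infer_instance) hf
instance : Dg M n (Nt : M → Prop) := dg_nt (f := fun x => x)

lemma Nt.ordl {x : M} (h : Nt x) : Ordl x := h.1
lemma nt_emp : Nt (emp : M) := ⟨ordl_emp, Or.inl not_mem_emp, by simp⟩
lemma Nt.succ {x : M} (h : Nt x) : Nt (suc x) := by
  refine ⟨h.1.succ, Or.inr ⟨x, by simp, isSuc_iff.2 rfl⟩, fun y hy => ?_⟩
  rcases mem_suc.1 hy with hy | rfl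
  · exact h.2.2 y hy
  · exact h.2.1
lemma Nt.mem {x y : M} (h : Nt x) (hy : y ε x) : Nt y :=
  ⟨h.1.mem hy, h.2.2 y hy, fun z hz => h.2.2 z (h.1.trans hy hz)⟩

lemma nt_induction (P : M → Prop) [Sg M (lvl M + 2) P] (h0 : P emp)
    (h1 : ∀ x, Nt x → P x → P (suc x)) {x : M} (hx : Nt x) : P x :=
  nat_induction P (fun _ he => by rwa [emp_iff.1 he])
    (fun x s hx hs h => by rw [isSuc_iff.1 hs]; exact h1 x hx h) x hx

lemma Nt.cases {x : M} (h : Nt x) : x = emp ∨ ∃ y, Nt y ∧ x = suc y := by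
  rcases h.2.1 with h' | ⟨y, hy, h'⟩
  · exact Or.inl (emp_iff.1 h')
  · exact Or.inr ⟨y, h.mem hy, isSuc_iff.1 h'⟩

lemma exists_om : ∃ w : M, ∀ x, x ε w ↔ Nt x := by
  obtain ⟨I, ⟨e, he, he'⟩, hI⟩ := TModel.inf (M := M)
  obtain ⟨w, hw⟩ := sep Nt I
  refine ⟨w, fun x => (hw x).trans (and_iff_right_of_imp fun hx => ?_)⟩
  refine nt_induction (fun x => x ε I) (by rwa [← emp_iff.1 he']) (fun x _ h => ?_) hx
  obtain ⟨s, hs, h'⟩ := hI x h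
  rwa [← isSuc_iff.1 h']

/-- The set of natural numbers. -/
def om : M := (exists_om (M := M)).choose
@[simp] lemma mem_om {x : M} : x ε om ↔ Nt x := (exists_om (M := M)).choose_spec x

lemma seqS_iff {f : M} : SeqS f ↔ Fn f om := by
  rw [← funOn_iff]; simp only [SeqS, FunOn, mem_om]

lemma ordl_om : Ordl (om : M) :=
  ⟨fun _ hx _ hy => mem_om.2 ((mem_om.1 hx).mem hy), fun _ hx => (mem_om.1 hx).1.1⟩

/-! ## The cumulative hierarchy -/

/-- `F` satisfies the recursion of the cumulative hierarchy on the transitive set `d`. -/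
def VA (F d : M) : Prop :=
  Fn F d ∧ Tr d ∧ ∀ γ, γ ε d → ∀ z, z ε ev F γ ↔ ∃ δ, δ ε γ ∧ Sub z (ev F δ)

def IsVr (x N : M) : Prop := ∃ F d, VA F d ∧ x ε d ∧ N = ev F x

instance sg_isVr {f g : Γ → M} [hf : DFun M (n + 1) f] [hg : DFun M (n + 1) g] :
    Sg M (n + 1) fun γ => IsVr (f γ) (g γ) :=
  Sg.comp₂ (R := fun p : M × M => IsVr p.1 p.2) (by unfold IsVr VA; infer_instance) hf hg

lemma VA.unique {F d F' d' x : M} (h : VA F d) (h' : VA F' d') (hx : x ε d) (hx' : x ε d') :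
    ev F x = ev F' x := by
  have key := mem_induction (M := M) (fun x => x ε d → x ε d' → ev F x = ev F' x) ?_
  · exact key x hx hx'
  intro x ih hx hx'
  ext z
  rw [h.2.2 x hx, h'.2.2 x hx']
  refine exists_congr fun δ => and_congr_right fun hδ => ?_
  rw [ih δ hδ (h.2.1 x hx δ hδ) (h'.2.1 x hx' δ hδ)]

lemma IsVr.unique {x N N' : M} (h : IsVr x N) (h' : IsVr x N') : N = N' := by
  obtain ⟨F, d, h, hx, rfl⟩ := h
  obtain ⟨F', d', h', hx', rfl⟩ := h'
  exact h.unique h' hx hx'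

lemma exists_isVr (x : M) : ∃ N, IsVr x N := by
  refine mem_induction (fun x => ∃ N, IsVr x N) (fun x ih => ?_) x
  obtain ⟨t, ht, hxt⟩ := TModel.tco x
  obtain ⟨d, hd⟩ := sep (fun z => ∃ N, IsVr z N) t
  have hdt : Tr d := by
    intro y hy z hz
    obtain ⟨hyt, N, F, e, hF, hye, -⟩ := (hd y).1 hy
    exact (hd z).2 ⟨ht y hyt z hz, _, F, e, hF, hF.2.1 y hye z hz, rfl⟩
  obtain ⟨C, hC⟩ := coll (fun z p => ∃ N, p = pr z N ∧ IsVr z N) d fun z hz => by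
    obtain ⟨-, N, hN⟩ := (hd z).1 hz
    exact ⟨_, N, rfl, hN⟩
  obtain ⟨f, hf⟩ := sep (fun p => ∃ z, z ε d ∧ ∃ N, p = pr z N ∧ IsVr z N) C
  have hfm : ∀ {z N}, pr z N ε f ↔ (z ε d ∧ IsVr z N) := by
    intro z N
    rw [hf]
    constructor
    · rintro ⟨-, z', hz', N', h, h'⟩
      obtain ⟨rfl, rfl⟩ := pr_inj.1 h
      exact ⟨hz', h'⟩
    · rintro ⟨hz, hN⟩
      obtain ⟨p, hp, N', rfl, hN'⟩ := hC z hz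
      obtain rfl := hN.unique hN'
      exact ⟨hp, z, hz, N, rfl, hN⟩
  have hev : ∀ {z}, z ε d → IsVr z (ev f z) := by
    intro z hz
    obtain ⟨-, N, hN⟩ := (hd z).1 hz
    rwa [ev_of_unique (hfm.2 ⟨hz, hN⟩) fun N' h => (hfm.1 h).2.unique hN]
  have hrec : ∀ {z}, z ε d → ∀ w, w ε ev f z ↔ ∃ y, y ε z ∧ Sub w (ev f y) := by
    intro z hz w
    obtain ⟨F, e, hF, hze, h⟩ := hev hz
    rw [h, hF.2.2 z hze]
    refine exists_congr fun y => and_congr_right fun hy => ?_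
    rw [(hev (hdt z hz y hy)).unique ⟨F, e, hF, hF.2.1 z hze y hy, rfl⟩]
  have hstep : ∀ z, ∃ N, ∀ w, w ε N ↔ (w ε pw (un (un (un f))) ∧ ∃ y, y ε z ∧ Sub w (ev f y)) :=
    fun z => sep (fun w => ∃ y, y ε z ∧ Sub w (ev f y)) _
  choose G hG using hstep
  have hG' : ∀ z, (∀ y, y ε z → y ε d) → ∀ w, w ε G z ↔ ∃ y, y ε z ∧ Sub w (ev f y) := by
    intro z hz w
    rw [hG, and_iff_right_iff_imp]
    rintro ⟨y, hy, hw⟩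
    rw [mem_pw]
    exact fun v hv => mem_un.2 ⟨_, right_mem_of_pr (hfm.2 ⟨hz y hy, hev (hz y hy)⟩), hw v hv⟩
  have : DFun M (lvl M + 2) G := by
    refine .of_iff (Q := fun z N => (∀ w, w ε N → (w ε pw (un (un (un f))) ∧
        ∃ y, y ε z ∧ Sub w (ev f y))) ∧
      ∀ w, w ε pw (un (un (un f))) → (∃ y, y ε z ∧ Sub w (ev f y)) → w ε N) fun z N => ?_
    constructor
    · rintro rfl
      exact ⟨fun w => (hG z w).1, fun w h1 h2 => (hG z w).2 ⟨h1, h2⟩⟩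
    · rintro ⟨h1, h2⟩
      ext w
      rw [hG]
      exact ⟨h1 w, fun h => h2 w h.1 h.2⟩
  obtain ⟨F, hF, hFG⟩ := exists_lam (cup d (sing x)) G
  have hxd : ∀ y, y ε x → y ε d := fun y hy => (hd y).2 ⟨hxt y hy, ih y hy⟩
  have hsub : ∀ z, z ε cup d (sing x) → ∀ y, y ε z → y ε d := by
    intro z hz y hy
    rcases mem_cup.1 hz with hz | hz
    · exact hdt z hz y hy
    · rw [mem_sing] at hz; subst hz; exact hxd y hy
  have hFf : ∀ y, y ε d → ev F y = ev f y := by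
    intro y hy
    rw [hFG y (by simp [hy])]
    ext w
    rw [hG' y (fun z hz => hdt y hy z hz), hrec hy]
  refine ⟨_, F, cup d (sing x), ⟨hF, fun z hz y hy => by simp [hsub z hz y hy], ?_⟩, by simp, rfl⟩
  intro z hz w
  rw [hFG z hz, hG' z (hsub z hz)]
  refine exists_congr fun y => and_congr_right fun hy => ?_
  rw [hFf y (hsub z hz y hy)]

/-- The cumulative hierarchy, indexed by arbitrary sets: `V x = ⋃_{y ∈ x} 𝒫(V y)`. -/
def V (x : M) : M := (exists_isVr x).choose

lemma eq_V_iff {x N : M} : N = V x ↔ IsVr x N :=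
  ⟨by rintro rfl; exact (exists_isVr x).choose_spec, fun h => h.unique (exists_isVr x).choose_spec⟩

instance dFun_V {f : Γ → M} [hf : DFun M (n + 1) f] : DFun M (n + 1) fun γ => V (f γ) :=
  DFun.comp₁ (F := V) (.of_iff (Q := IsVr) fun _ _ => eq_V_iff) hf
instance : DFun M (n + 1) (V : M → M) := dFun_V (f := fun x => x)

lemma mem_V {x z : M} : z ε V x ↔ ∃ y, y ε x ∧ Sub z (V y) := by
  obtain ⟨F, d, hF, hx, h⟩ := eq_V_iff.1 (rfl : V x = V x)
  rw [h, hF.2.2 x hx]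
  refine exists_congr fun y => and_congr_right fun hy => ?_
  rw [← eq_V_iff.2 ⟨F, d, hF, hF.2.1 x hx y hy, rfl⟩]

lemma V_of_sub {x z w : M} (h : z ε V x) (hw : Sub w z) : w ε V x := by
  obtain ⟨y, hy, h⟩ := mem_V.1 h
  exact mem_V.2 ⟨y, hy, hw.trans h⟩

lemma V_mono {x y : M} (h : Sub x y) : Sub (V x) (V y) := by
  intro z hz
  obtain ⟨w, hw, h'⟩ := mem_V.1 hz
  exact mem_V.2 ⟨w, h w hw, h'⟩

lemma V_mem {x y : M} (h : x ε y) : V x ε V y := mem_V.2 ⟨x, h, Sub.refl _⟩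

lemma tr_V (x : M) : Tr (V x) := by
  refine mem_induction (fun x => Tr (V x)) (fun x ih y hy z hz => ?_) x
  obtain ⟨w, hw, h⟩ := mem_V.1 hy
  exact mem_V.2 ⟨w, hw, fun v hv => ih w hw z (h z hz) v hv⟩

lemma sub_V (x : M) : Sub x (V x) :=
  mem_induction (fun x => Sub x (V x)) (fun _ ih y hy => mem_V.2 ⟨y, hy, ih y hy⟩) x

lemma Ordl.vv {β : M} (hβ : Ordl β) : VV β (V β) := by
  obtain ⟨F, hF, hFV⟩ := exists_lam (M := M) (suc β) V
  have hmem : ∀ γ, γ ε suc β → ∀ y, Ap F γ y ↔ y = V γ := by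
    intro γ hγ y
    rw [ap_iff, hF.pr_mem, hFV γ hγ]; simp only [hγ, true_and]
  refine ⟨F, suc β, isSuc_iff.2 rfl, funOn_iff.2 hF, fun γ hγ y hy z => ?_, ?_⟩
  · rw [(hmem γ hγ y).1 hy, mem_V]
    refine exists_congr fun δ => and_congr_right fun hδ => ?_
    simp only [hmem δ (hβ.succ.trans hγ hδ), exists_eq_left]
  · exact (hmem β (by simp) _).2 rfl

/-- Every set is included in some `V α`, for an ordinal `α`. -/
lemma exists_sub_V (x : M) : ∃ α, Ordl α ∧ Sub x (V α) := by
  refine mem_induction (fun x => ∃ α, Ordl α ∧ Sub x (V α)) (fun x ih => ?_) x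
  obtain ⟨C, hC⟩ := coll (fun y α => Ordl α ∧ Sub y (V α)) x ih
  obtain ⟨D, hD⟩ := sep (fun α => Ordl α) C
  refine ⟨suc (un D), (ordl_un fun α hα => ((hD α).1 hα).2).succ, fun y hy => ?_⟩
  obtain ⟨α, hα, h1, h2⟩ := hC y hy
  refine mem_V.2 ⟨un D, by simp, h2.trans (V_mono fun γ hγ => ?_)⟩
  exact mem_un.2 ⟨α, (hD α).2 ⟨hα, h1⟩, hγ⟩

/-- Induction on rank. -/
lemma rank_induction (P : M → Prop) [hP : Dg M (lvl M + 2) P]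
    (ih : ∀ x α, Ordl α → Sub x (V α) → (∀ y, y ε V α → P y) → P x) (x : M) : P x := by
  have : Dg M (lvl M + 2) fun p : M × M => P p.2 := hP.comp (CoMap.ofCo IsCo.snd)
  have key := mem_induction (fun α => Ordl α → ∀ x, x ε V α → P x) (fun α h hα x hx => ?_)
  · obtain ⟨α, hα, hx⟩ := exists_sub_V x
    exact key (suc α) hα.succ x (mem_V.2 ⟨α, by simp, hx⟩)
  · obtain ⟨β, hβ, hx⟩ := mem_V.1 hx
    exact ih x β (hα.mem hβ) hx (h β hβ (hα.mem hβ))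

lemma V_pr {x y α : M} (hx : x ε V α) (hy : y ε V α) : pr x y ε V (suc (suc α)) := by
  have h1 : ∀ {a b}, a ε V α → b ε V α → upr a b ε V (suc α) := fun ha hb =>
    mem_V.2 ⟨α, by simp, fun z hz => by rcases mem_upr.1 hz with rfl | rfl <;> assumption⟩
  refine mem_V.2 ⟨suc α, by simp, fun z hz => ?_⟩
  rcases mem_upr.1 hz with rfl | rfl
  · exact h1 hx hx
  · exact h1 hx hy

lemma mem_V_of_pr {x y α : M} (h : pr x y ε V α) : x ε V α ∧ y ε V α := by
  have h1 : upr x y ε V α := tr_V α _ h _ (by simp [pr])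
  exact ⟨tr_V α _ h1 x (by simp), tr_V α _ h1 y (by simp)⟩

/-- The components of a pair have smaller rank. -/
lemma pr_sub_V {x y α : M} (h : Sub (pr x y) (V α)) : x ε V α ∧ y ε V α := by
  have h1 : upr x y ε V α := h _ (by simp [pr])
  exact ⟨tr_V α _ h1 x (by simp), tr_V α _ h1 y (by simp)⟩

/-- A limit ordinal. -/
def Lim (α : M) : Prop := Ordl α ∧ emp ε α ∧ ∀ β, β ε α → suc β ε α

lemma lim_om : Lim (om : M) :=
  ⟨ordl_om, mem_om.2 nt_emp, fun _ h => mem_om.2 (mem_om.1 h).succ⟩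

lemma Lim.exists_mem {α x : M} (h : Lim α) (hx : x ε V α) : ∃ β, β ε α ∧ x ε V β := by
  obtain ⟨β, hβ, hx⟩ := mem_V.1 hx
  exact ⟨suc β, h.2.2 β hβ, mem_V.2 ⟨β, by simp, hx⟩⟩

lemma Lim.exists_common {α x y : M} (h : Lim α) (hx : x ε V α) (hy : y ε V α) :
    ∃ β, β ε α ∧ x ε V β ∧ y ε V β := by
  obtain ⟨β, hβ, hx⟩ := h.exists_mem hx
  obtain ⟨γ, hγ, hy⟩ := h.exists_mem hy
  rcases (h.1.mem hβ).sub_or_mem (h.1.mem hγ) with h' | h'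
  · exact ⟨γ, hγ, V_mono h' x hx, hy⟩
  · exact ⟨β, hβ, hx, V_mono (fun δ hδ => (h.1.mem hβ).trans h' hδ) y hy⟩

lemma Lim.pr_mem {α x y : M} (h : Lim α) : pr x y ε V α ↔ (x ε V α ∧ y ε V α) := by
  refine ⟨mem_V_of_pr, fun ⟨hx, hy⟩ => ?_⟩
  obtain ⟨β, hβ, hx, hy⟩ := h.exists_common hx hy
  refine V_mono (fun δ hδ => ?_) _ (V_pr hx hy)
  exact h.1.trans (h.2.2 _ (h.2.2 _ hβ)) hδ

lemma Ordl.sub_V {α : M} (h : Ordl α) {β : M} : β ε V α ∧ Ordl β ↔ β ε α := by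
  constructor
  · rintro ⟨h1, h2⟩
    refine mem_induction (fun α => Ordl α → ∀ β, β ε V α → Ordl β → β ε α) (fun α ih hα β h1 h2 => ?_)
      α h β h1 h2
    obtain ⟨γ, hγ, h3⟩ := mem_V.1 h1
    rcases h2.sub_or_mem (hα.mem hγ) with h' | h'
    · rcases h2.trichotomy hα with h4 | rfl | h4
      · exact h4
      · exact absurd (h' γ hγ) (mem_irrefl γ)
      · exact absurd (hα.trans hγ (h' _ h4)) (mem_irrefl _)
    · exact absurd (ih γ hγ (hα.mem hγ) γ (h3 γ h') (hα.mem hγ)) (mem_irrefl γ)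
  · exact fun hβ => ⟨FOSet.sub_V α β hβ, h.mem hβ⟩

end Basic

end FOSet

namespace FOSet

noncomputable section Codes

set_option linter.unusedSectionVars false
set_option synthInstance.maxHeartbeats 400000
set_option synthInstance.maxSize 2000

open TModel (lvl)

variable {M : Type} [setLang.Structure M] [TModel M] {Γ : Type} [Ctx M Γ] {n : ℕ}

lemma Sg.comp₄ {R : ((M × M) × M) × M → Prop} (hR : Sg M n R) {f g h k : Γ → M} (hf : DFun M n f)
    (hg : DFun M n g) (hh : DFun M n h) (hk : DFun M n k) :
    Sg M n fun γ => R (((f γ, g γ), h γ), k γ) := by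
  have h1 : Sg M n fun q : (((Γ × M) × M) × M) × M => R (((q.1.1.1.2, q.1.1.2), q.1.2), q.2) :=
    hR.comp (CoMap.pair _ _ (CoMap.pair _ _ (CoMap.pair _ _ (CoMap.ofCo IsCo.snd.fst.fst.fst)
      IsCo.snd.fst.fst) IsCo.snd.fst) IsCo.snd)
  exact (((h1.subst (f := fun q : ((Γ × M) × M) × M => k q.1.1.1)
    (hk.comp (coMap_fst.trans (coMap_fst.trans coMap_fst)))).subst
      (f := fun q : (Γ × M) × M => h q.1.1) (hh.comp (coMap_fst.trans coMap_fst))).subst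
      (f := fun q : Γ × M => g q.1) (hg.comp coMap_fst)).subst hf

lemma Dg.comp₄ {R : ((M × M) × M) × M → Prop} (hR : Dg M n R) {f g h k : Γ → M} (hf : DFun M n f)
    (hg : DFun M n g) (hh : DFun M n h) (hk : DFun M n k) :
    Dg M n fun γ => R (((f γ, g γ), h γ), k γ) := by
  refine ⟨hR.sg.comp₄ hf hg hh hk, ?_⟩
  have h1 : Sg M n fun p => ¬ R p := ⟨fun hn => (hR.pg.lev hn).neg⟩
  have h2 := h1.comp₄ hf hg hh hk
  have h3 : Pg M n fun γ => ¬ ¬ R (((f γ, g γ), h γ), k γ) := inferInstance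
  simpa only [not_not] using h3

/-! ## Codes of formulas -/

def num : ℕ → M
  | 0 => emp
  | k + 1 => suc (num k)

lemma num_iff {k : ℕ} {x : M} : Num k x ↔ x = num k := by
  induction k generalizing x with
  | zero => exact emp_iff
  | succ k ih => simp [Num, ih, isSuc_iff, num]

lemma nt_num (k : ℕ) : Nt (num k : M) := by
  induction k with
  | zero => exact nt_emp
  | succ k ih => exact ih.succ

lemma num_mem {j k : ℕ} (h : j < k) : (num j : M) ε num k := by
  induction h with
  | refl => simp [num]
  | step _ ih => simp [num, ih]

lemma num_inj {j k : ℕ} : (num j : M) = num k ↔ j = k := by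
  refine ⟨fun h => ?_, fun h => by rw [h]⟩
  rcases lt_trichotomy j k with h' | h' | h'
  · exact absurd (h ▸ num_mem h') (mem_irrefl _)
  · exact h'
  · exact absurd (h ▸ num_mem h') (mem_irrefl _)

def qMem (i j : M) : M := pr (num 0) (pr i j)
def qEq (i j : M) : M := pr (num 1) (pr i j)
def qNot (d : M) : M := pr (num 2) d
def qAnd (d e : M) : M := pr (num 3) (pr d e)
def qEx (i d : M) : M := pr (num 4) (pr i d)
def qAll (i d : M) : M := pr (num 5) (pr i d)

lemma tag2_iff {k : ℕ} {c a b : M} : Tag2 k c a b ↔ c = pr (num k) (pr a b) := by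
  simp [Tag2, Tag, num_iff, pr_iff]
lemma cMem_iff {c i j : M} : CMem c i j ↔ Nt i ∧ Nt j ∧ c = qMem i j := by
  simp [CMem, tag2_iff, qMem]
lemma cEq_iff {c i j : M} : CEq c i j ↔ Nt i ∧ Nt j ∧ c = qEq i j := by
  simp [CEq, tag2_iff, qEq]
lemma cNot_iff {c d : M} : CNot c d ↔ c = qNot d := by
  simp [CNot, Tag, num_iff, pr_iff, qNot]
lemma cAnd_iff {c d e : M} : CAnd c d e ↔ c = qAnd d e := by simp [CAnd, tag2_iff, qAnd]
lemma cEx_iff {c i d : M} : CEx c i d ↔ Nt i ∧ c = qEx i d := by simp [CEx, tag2_iff, qEx]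
lemma cAll_iff {c i d : M} : CAll c i d ↔ Nt i ∧ c = qAll i d := by simp [CAll, tag2_iff, qAll]

section
variable {f g : Γ → M} [DFun M n f] [DFun M n g]
instance : DFun M n fun γ => qMem (f γ) (g γ) := by unfold qMem; infer_instance
instance : DFun M n fun γ => qEq (f γ) (g γ) := by unfold qEq; infer_instance
instance : DFun M n fun γ => qNot (f γ) := by unfold qNot; infer_instance
instance : DFun M n fun γ => qAnd (f γ) (g γ) := by unfold qAnd; infer_instance
instance : DFun M n fun γ => qEx (f γ) (g γ) := by unfold qEx; infer_instance
instance : DFun M n fun γ => qAll (f γ) (g γ) := by unfold qAll; infer_instance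
end

/-- The possible shapes of an element of a set `C` of formulas closed under subformulas. -/
def Shape (C c : M) : Prop :=
  (∃ i j, Nt i ∧ Nt j ∧ c = qMem i j) ∨ (∃ i j, Nt i ∧ Nt j ∧ c = qEq i j) ∨
  (∃ d, d ε C ∧ c = qNot d) ∨ (∃ d, d ε C ∧ ∃ e, e ε C ∧ c = qAnd d e) ∨
  (∃ i d, Nt i ∧ d ε C ∧ c = qEx i d) ∨ (∃ i d, Nt i ∧ d ε C ∧ c = qAll i d)

lemma formClosed_iff {C : M} : FormClosed C ↔ ∀ c, c ε C → Shape C c := by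
  refine forall_congr' fun c => imp_congr_right fun _ => ?_
  simp only [CAtomic, cMem_iff, cEq_iff, cNot_iff, cAnd_iff, cEx_iff, cAll_iff, Shape, exists_or,
    and_or_left]
  have h : ∀ q : M → M → M, (∃ i d, d ε C ∧ Nt i ∧ c = q i d) ↔ ∃ i d, Nt i ∧ d ε C ∧ c = q i d :=
    fun q => exists_congr fun i => exists_congr fun d => and_left_comm
  rw [h, h, or_assoc]

instance sg_formClosed {f : Γ → M} [hf : DFun M n f] : Sg M n fun γ => FormClosed (f γ) :=
  Sg.comp₁ (R := FormClosed) (Sg.congr (Q := fun C => ∀ c, c ε C → Shape C c)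
    (hQ := by unfold Shape; infer_instance) fun _ => formClosed_iff) hf

lemma FormClosed.not {C d : M} (h : FormClosed C) (hc : qNot d ε C) : d ε C := by
  have := formClosed_iff.1 h _ hc
  simp only [Shape, qMem, qEq, qNot, qAnd, qEx, qAll, pr_inj, num_inj] at this
  simpa using this
lemma FormClosed.and {C d e : M} (h : FormClosed C) (hc : qAnd d e ε C) : d ε C ∧ e ε C := by
  have := formClosed_iff.1 h _ hc
  simp only [Shape, qMem, qEq, qNot, qAnd, qEx, qAll, pr_inj, num_inj] at this
  simpa using this
lemma FormClosed.ex {C i d : M} (h : FormClosed C) (hc : qEx i d ε C) : Nt i ∧ d ε C := by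
  have := formClosed_iff.1 h _ hc
  simp only [Shape, qMem, qEq, qNot, qAnd, qEx, qAll, pr_inj, num_inj] at this
  simpa using this
lemma FormClosed.all {C i d : M} (h : FormClosed C) (hc : qAll i d ε C) : Nt i ∧ d ε C := by
  have := formClosed_iff.1 h _ hc
  simp only [Shape, qMem, qEq, qNot, qAnd, qEx, qAll, pr_inj, num_inj] at this
  simpa using this

lemma Shape.mono {C C' c : M} (hC : Sub C C') (h : Shape C c) : Shape C' c := by
  rcases h with h | h | ⟨d, hd, h⟩ | ⟨d, hd, e, he, h⟩ | ⟨i, d, hi, hd, h⟩ | ⟨i, d, hi, hd, h⟩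
  · exact .inl h
  · exact .inr (.inl h)
  · exact .inr (.inr (.inl ⟨d, hC d hd, h⟩))
  · exact .inr (.inr (.inr (.inl ⟨d, hC d hd, e, hC e he, h⟩)))
  · exact .inr (.inr (.inr (.inr (.inl ⟨i, d, hi, hC d hd, h⟩))))
  · exact .inr (.inr (.inr (.inr (.inr ⟨i, d, hi, hC d hd, h⟩))))

lemma FormClosed.cup {C D : M} (h : FormClosed C) (h' : FormClosed D) : FormClosed (cup C D) := by
  rw [formClosed_iff] at *
  intro c hc
  rcases mem_cup.1 hc with hc | hc
  · exact (h c hc).mono fun x hx => by simp [hx]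
  · exact (h' c hc).mono fun x hx => by simp [hx]

lemma FormClosed.insert {C c : M} (h : FormClosed C) (hc : Shape C c) :
    FormClosed (FOSet.cup C (sing c)) := by
  rw [formClosed_iff] at *
  intro d hd
  rcases mem_cup.1 hd with hd | hd
  · exact (h d hd).mono fun x hx => by simp [hx]
  · rw [mem_sing] at hd; subst hd
    exact hc.mono fun x hx => by simp [hx]

lemma formClosed_emp : FormClosed (emp : M) := fun c hc => absurd hc (not_mem_emp c)

lemma isForm_of_shape {C c : M} (h : FormClosed C) (hc : Shape C c) : IsForm c :=
  ⟨_, by simp, h.insert hc⟩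

lemma isForm_mem {i j : M} (hi : Nt i) (hj : Nt j) : IsForm (qMem i j) :=
  isForm_of_shape formClosed_emp (.inl ⟨i, j, hi, hj, rfl⟩)
lemma isForm_eq {i j : M} (hi : Nt i) (hj : Nt j) : IsForm (qEq i j) :=
  isForm_of_shape formClosed_emp (.inr (.inl ⟨i, j, hi, hj, rfl⟩))
lemma isForm_not {d : M} : IsForm (qNot d) ↔ IsForm d := by
  constructor
  · rintro ⟨C, h, hC⟩; exact ⟨C, hC.not h, hC⟩
  · rintro ⟨C, h, hC⟩; exact isForm_of_shape hC (.inr (.inr (.inl ⟨d, h, rfl⟩)))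
lemma isForm_and {d e : M} : IsForm (qAnd d e) ↔ IsForm d ∧ IsForm e := by
  constructor
  · rintro ⟨C, h, hC⟩; exact ⟨⟨C, (hC.and h).1, hC⟩, ⟨C, (hC.and h).2, hC⟩⟩
  · rintro ⟨⟨C, h, hC⟩, ⟨D, h', hD⟩⟩
    exact isForm_of_shape (hC.cup hD)
      (.inr (.inr (.inr (.inl ⟨d, by simp [h], e, by simp [h'], rfl⟩))))
lemma isForm_ex {i d : M} : IsForm (qEx i d) ↔ Nt i ∧ IsForm d := by
  constructor
  · rintro ⟨C, h, hC⟩; exact ⟨(hC.ex h).1, C, (hC.ex h).2, hC⟩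
  · rintro ⟨hi, C, h, hC⟩
    exact isForm_of_shape hC (.inr (.inr (.inr (.inr (.inl ⟨i, d, hi, h, rfl⟩)))))
lemma isForm_all {i d : M} : IsForm (qAll i d) ↔ Nt i ∧ IsForm d := by
  constructor
  · rintro ⟨C, h, hC⟩; exact ⟨(hC.all h).1, C, (hC.all h).2, hC⟩
  · rintro ⟨hi, C, h, hC⟩
    exact isForm_of_shape hC (.inr (.inr (.inr (.inr (.inr ⟨i, d, hi, h, rfl⟩)))))

instance sg_isForm {f : Γ → M} [hf : DFun M n f] : Sg M n fun γ => IsForm (f γ) :=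
  Sg.comp₁ (R := IsForm) (by unfold IsForm; infer_instance) hf
instance : Sg M n (IsForm : M → Prop) := sg_isForm (f := fun x => x)

/-- The immediate subformulas of `c` have smaller rank. -/
lemma sub_V_of_pr₂ {k : ℕ} {α a b : M} (h : Sub (pr (num k) (pr a b)) (V α)) :
    a ε V α ∧ b ε V α := mem_V_of_pr (pr_sub_V h).2

/-- Induction on formulas, restricted to a subformula-closed set. -/
lemma IsForm.induct (P : M → Prop) [hP : Dg M (lvl M + 2) P]
    (hmem : ∀ i j, Nt i → Nt j → P (qMem i j)) (heq : ∀ i j, Nt i → Nt j → P (qEq i j))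
    (hnot : ∀ d, IsForm d → P d → P (qNot d))
    (hand : ∀ d e, IsForm d → IsForm e → P d → P e → P (qAnd d e))
    (hex : ∀ i d, Nt i → IsForm d → P d → P (qEx i d))
    (hall : ∀ i d, Nt i → IsForm d → P d → P (qAll i d)) {c : M} (hc : IsForm c) : P c := by
  refine rank_induction (fun c => IsForm c → P c) (fun c α hα hcα ih h => ?_) c hc
  obtain ⟨C, hcC, hC⟩ := h
  have hF : ∀ {d}, d ε C → IsForm d := fun hd => ⟨C, hd, hC⟩
  rcases formClosed_iff.1 hC c hcC with ⟨i, j, hi, hj, rfl⟩ | ⟨i, j, hi, hj, rfl⟩ | ⟨d, hd, rfl⟩ |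
    ⟨d, hd, e, he, rfl⟩ | ⟨i, d, hi, hd, rfl⟩ | ⟨i, d, hi, hd, rfl⟩
  · exact hmem i j hi hj
  · exact heq i j hi hj
  · exact hnot d (hF hd) (ih d (pr_sub_V hcα).2 (hF hd))
  · exact hand d e (hF hd) (hF he) (ih d (sub_V_of_pr₂ hcα).1 (hF hd))
      (ih e (sub_V_of_pr₂ hcα).2 (hF he))
  · exact hex i d hi (hF hd) (ih d (sub_V_of_pr₂ hcα).2 (hF hd))
  · exact hall i d hi (hF hd) (ih d (sub_V_of_pr₂ hcα).2 (hF hd))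

lemma Nt.mem_V_om {x : M} (h : Nt x) : x ε V om := sub_V om x (mem_om.2 h)

lemma IsForm.mem_V_om {c : M} (h : IsForm c) : c ε V om := by
  have hp : ∀ {x y : M}, x ε V om → y ε V om → pr x y ε V om := fun hx hy => lim_om.pr_mem.2 ⟨hx, hy⟩
  have hn : ∀ k, (num k : M) ε V om := fun k => (nt_num k).mem_V_om
  refine IsForm.induct (fun c => c ε V om) ?_ ?_ ?_ ?_ ?_ ?_ h
  · exact fun i j hi hj => hp (hn 0) (hp hi.mem_V_om hj.mem_V_om)
  · exact fun i j hi hj => hp (hn 1) (hp hi.mem_V_om hj.mem_V_om)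
  · exact fun d _ h => hp (hn 2) h
  · exact fun d e _ _ h h' => hp (hn 3) (hp h h')
  · exact fun i d hi _ h => hp (hn 4) (hp hi.mem_V_om h)
  · exact fun i d hi _ h => hp (hn 5) (hp hi.mem_V_om h)

/-- A definable class of codes is a set, so that it can be used as a parameter. -/
lemma dg_of_forms (P : M → Prop) [Dg M (lvl M + 2) P] (h : ∀ c, P c → IsForm c) :
    Dg M n P := by
  obtain ⟨L, hL⟩ := sep P (V om)
  exact Dg.congr (Q := fun c => c ε L) fun c =>
    ((hL c).trans (and_iff_right_of_imp fun hc => (h c hc).mem_V_om)).symm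

instance : Dg M n (IsForm : M → Prop) := dg_of_forms IsForm fun _ h => h
instance {f : Γ → M} [hf : DFun M n f] : Dg M n fun γ => IsForm (f γ) :=
  Dg.comp₁ (R := IsForm) inferInstance hf

/-! ## Assignments -/

lemma asg_iff {a N : M} : Asg a N ↔ Fn a om ∧ ∀ i, i ε om → ev a i ε N := by
  rw [Asg, seqS_iff]
  refine and_congr_right fun h => ?_
  simp only [ap_iff, h.pr_mem]
  exact ⟨fun h' i hi => h' i _ ⟨hi, rfl⟩, fun h' i x ⟨hi, hx⟩ => hx ▸ h' i hi⟩

instance dg_asg {f g : Γ → M} [hf : DFun M n f] [hg : DFun M n g] :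
    Dg M n fun γ => Asg (f γ) (g γ) :=
  Dg.comp₂ (R := fun p : M × M => Asg p.1 p.2) (Dg.congr fun _ => asg_iff) hf hg

open Classical in
lemma exists_upd (a i x : M) :
    ∃ b, Fn b om ∧ ∀ k, k ε om → ev b k = if k = i then x else ev a k := by
  have : DFun M (lvl M + 2) fun k => if k = i then x else ev a k := by
    refine .of_iff (Q := fun k y => (k = i ∧ y = x) ∨ (¬ k = i ∧ y = ev a k)) fun k y => ?_
    by_cases h : k = i <;> simp [h]
  exact exists_lam om fun k => if k = i then x else ev a k

/-- The assignment `a[i ↦ x]`. -/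
def upd (a i x : M) : M := (exists_upd a i x).choose
lemma fn_upd (a i x : M) : Fn (upd a i x) om := (exists_upd a i x).choose_spec.1
open Classical in
lemma ev_upd {a i x k : M} (hk : Nt k) : ev (upd a i x) k = if k = i then x else ev a k :=
  (exists_upd a i x).choose_spec.2 k (mem_om.2 hk)
lemma ev_upd_self {a i x : M} (hi : Nt i) : ev (upd a i x) i = x := by rw [ev_upd hi, if_pos rfl]
lemma ev_upd_ne {a i x k : M} (hk : Nt k) (h : k ≠ i) : ev (upd a i x) k = ev a k := by
  rw [ev_upd hk, if_neg h]

lemma eq_upd_iff {a i x b : M} : b = upd a i x ↔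
    (Fn b om ∧ ∀ k, k ε om → (k = i → ev b k = x) ∧ (¬ k = i → ev b k = ev a k)) := by
  constructor
  · rintro rfl
    refine ⟨fn_upd a i x, fun k hk => ?_⟩
    rw [mem_om] at hk
    exact ⟨by rintro rfl; exact ev_upd_self hk, ev_upd_ne hk⟩
  · rintro ⟨h1, h2⟩
    refine h1.ext (fn_upd a i x) fun k hk => ?_
    by_cases h : k = i
    · rw [(h2 k hk).1 h, ev_upd (mem_om.1 hk), if_pos h]
    · rw [(h2 k hk).2 h, ev_upd (mem_om.1 hk), if_neg h]

instance dFun_upd {f g h : Γ → M} [hf : DFun M n f] [hg : DFun M n g] [hh : DFun M n h] :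
    DFun M n fun γ => upd (f γ) (g γ) (h γ) :=
  DFun.comp₃ (F := fun p : (M × M) × M => upd p.1.1 p.1.2 p.2)
    (.of_iff (Q := fun p b => (Fn b om ∧ ∀ k, k ε om →
      (k = p.1.2 → ev b k = p.2) ∧ (¬ k = p.1.2 → ev b k = ev p.1.1 k))) fun _ _ => eq_upd_iff)
    hf hg hh
instance (a i : M) : DFun M n (upd a i) := dFun_upd (f := fun _ => a) (g := fun _ => i) (h := fun x => x)

lemma upd_iff {a i x b : M} (ha : Fn a om) (hi : Nt i) : Upd a i x b ↔ b = upd a i x := by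
  rw [Upd, seqS_iff, eq_upd_iff]
  refine and_congr_right fun hb => ?_
  simp only [ap_iff, hb.pr_mem, ha.pr_mem, mem_om]
  constructor
  · rintro ⟨⟨-, h1⟩, h2⟩ k hk
    refine ⟨by rintro rfl; exact h1.symm, fun hki => ((h2 k hki _).1 ⟨hk, rfl⟩).2⟩
  · intro h
    refine ⟨⟨hi, ((h i hi).1 rfl).symm⟩, fun k hki y => and_congr_right fun hk => ?_⟩
    rw [(h k hk).2 hki]

lemma Upd.fn {a i x b : M} (h : Upd a i x b) : Fn b om := seqS_iff.1 h.1

instance sg_upd {f g h k : Γ → M} [hf : DFun M n f] [hg : DFun M n g] [hh : DFun M n h]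
    [hk : DFun M n k] : Dg M n fun γ => Upd (f γ) (g γ) (h γ) (k γ) := by
  refine Dg.comp₄ (R := fun p : ((M × M) × M) × M => Upd p.1.1.1 p.1.1.2 p.1.2 p.2)
    (Dg.congr (Q := fun p => Fn p.2 om ∧ pr p.1.1.2 p.1.2 ε p.2 ∧
      (∀ q, q ε p.2 → ¬ fst q = p.1.1.2 → q ε p.1.1.1) ∧
      (∀ q, q ε p.1.1.1 → q = pr (fst q) (snd q) → ¬ fst q = p.1.1.2 → q ε p.2)) ?_) hf hg hh hk
  rintro ⟨⟨⟨a, i⟩, x⟩, b⟩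
  simp only [Upd, seqS_iff, ap_iff]
  refine and_congr_right fun hb => and_congr_right fun _ => ?_
  constructor
  · refine fun h => ⟨fun q hq hi => ?_, fun q hq hqp hi => ?_⟩
    · obtain ⟨k, hk, rfl⟩ := hb.1 q hq
      rw [fst_pr] at hi
      exact (h k hi _).1 hq
    · rw [hqp] at hq ⊢
      exact (h _ hi _).2 hq
  · rintro ⟨h1, h2⟩ k hk y
    exact ⟨fun h => h1 _ h (by rwa [fst_pr]), fun h => h2 _ h (by simp) (by rwa [fst_pr])⟩

lemma asg_upd {a i x N : M} (ha : Asg a N) (hx : x ε N) : Asg (upd a i x) N := by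
  rw [asg_iff] at *
  refine ⟨fn_upd a i x, fun k hk => ?_⟩
  rw [ev_upd (mem_om.1 hk)]
  split_ifs
  · exact hx
  · exact ha.2 k hk

lemma Asg.fn {a N : M} (h : Asg a N) : Fn a om := (asg_iff.1 h).1
lemma Asg.ev_mem {a N i : M} (h : Asg a N) (hi : Nt i) : ev a i ε N := (asg_iff.1 h).2 i (mem_om.2 hi)

lemma exists_prod (A B : M) : ∃ P, ∀ x, x ε A → ∀ y, y ε B → pr x y ε P := by
  obtain ⟨α, -, h⟩ := exists_sub_V (cup A B)
  exact ⟨V (suc (suc α)), fun x hx y hy => V_pr (h x (by simp [hx])) (h y (by simp [hy]))⟩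

lemma exists_AS (N : M) : ∃ A, ∀ a, a ε A ↔ Asg a N := by
  obtain ⟨P, hP⟩ := exists_prod om N
  obtain ⟨A, hA⟩ := sep (fun a => Asg a N) (pw P)
  refine ⟨A, fun a => (hA a).trans (and_iff_right_of_imp fun ha => ?_)⟩
  rw [mem_pw]
  intro p hp
  obtain ⟨x, hx, rfl⟩ := ha.fn.1 p hp
  exact hP x hx _ (ha.ev_mem (mem_om.1 hx))

/-- The set of assignments with values in `N`. -/
def AS (N : M) : M := (exists_AS N).choose
@[simp] lemma mem_AS {N a : M} : a ε AS N ↔ Asg a N := (exists_AS N).choose_spec a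

/-! ## Satisfaction -/

/-- The right-hand sides of Tarski's clauses. -/
def Val (N S c a : M) : Prop :=
  (fst c = num 0 ∧ ev a (fst (snd c)) ε ev a (snd (snd c))) ∨
  (fst c = num 1 ∧ ev a (fst (snd c)) = ev a (snd (snd c))) ∨
  (fst c = num 2 ∧ ¬ pr (snd c) a ε S) ∨
  (fst c = num 3 ∧ pr (fst (snd c)) a ε S ∧ pr (snd (snd c)) a ε S) ∨
  (fst c = num 4 ∧ ∃ x, x ε N ∧ pr (snd (snd c)) (upd a (fst (snd c)) x) ε S) ∨
  (fst c = num 5 ∧ ∀ x, x ε N → pr (snd (snd c)) (upd a (fst (snd c)) x) ε S)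

instance dg_val {f g h k : Γ → M} [hf : DFun M n f] [hg : DFun M n g] [hh : DFun M n h]
    [hk : DFun M n k] : Dg M n fun γ => Val (f γ) (g γ) (h γ) (k γ) :=
  Dg.comp₄ (R := fun p : ((M × M) × M) × M => Val p.1.1.1 p.1.1.2 p.1.2 p.2)
    (by unfold Val; infer_instance) hf hg hh hk

section
variable {N S a i j d e : M}
lemma val_mem : Val N S (qMem i j) a ↔ ev a i ε ev a j := by simp [Val, qMem, num_inj]
lemma val_eq : Val N S (qEq i j) a ↔ ev a i = ev a j := by simp [Val, qEq, num_inj]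
lemma val_not : Val N S (qNot d) a ↔ ¬ pr d a ε S := by simp [Val, qNot, num_inj]
lemma val_and : Val N S (qAnd d e) a ↔ (pr d a ε S ∧ pr e a ε S) := by simp [Val, qAnd, num_inj]
lemma val_ex : Val N S (qEx i d) a ↔ ∃ x, x ε N ∧ pr d (upd a i x) ε S := by
  simp [Val, qEx, num_inj]
lemma val_all : Val N S (qAll i d) a ↔ ∀ x, x ε N → pr d (upd a i x) ε S := by
  simp [Val, qAll, num_inj]
end

/-- `B` is a set of assignments with values in `N` that is closed under changes of one value. -/
def BC (B N : M) : Prop :=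
  (∀ a, a ε B → Asg a N) ∧ ∀ a, a ε B → ∀ i, i ε om → ∀ x, x ε N → upd a i x ε B

/-- `S` obeys Tarski's clauses on the formulas in `C` and the assignments in `B`. -/
def TarskiOn (N C B S : M) : Prop := ∀ c, c ε C → ∀ a, a ε B → (pr c a ε S ↔ Val N S c a)

lemma bc_AS (N : M) : BC (AS N) N :=
  ⟨fun _ ha => mem_AS.1 ha, fun _ ha _ _ _ hx => mem_AS.2 (asg_upd (mem_AS.1 ha) hx)⟩

lemma val_congr {N C B S S' : M} (hB : BC B N)
    (h : ∀ d, d ε C → ∀ b, b ε B → (pr d b ε S ↔ pr d b ε S')) {c a : M} (hc : Shape C c) (ha : a ε B) :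
    Val N S c a ↔ Val N S' c a := by
  have hu : ∀ {i x : M}, Nt i → x ε N → upd a i x ε B := fun hi hx => hB.2 a ha _ (mem_om.2 hi) _ hx
  rcases hc with ⟨i, j, hi, hj, rfl⟩ | ⟨i, j, hi, hj, rfl⟩ | ⟨d, hd, rfl⟩ |
    ⟨d, hd, e, he, rfl⟩ | ⟨i, d, hi, hd, rfl⟩ | ⟨i, d, hi, hd, rfl⟩
  · rw [val_mem, val_mem]
  · rw [val_eq, val_eq]
  · rw [val_not, val_not, h d hd a ha]
  · rw [val_and, val_and, h d hd a ha, h e he a ha]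
  · rw [val_ex, val_ex]
    exact exists_congr fun x => and_congr_right fun hx => h d hd _ (hu hi hx)
  · rw [val_all, val_all]
    exact forall_congr' fun x => imp_congr_right fun hx => h d hd _ (hu hi hx)

lemma TarskiOn.unique {N C B S C' B' S' : M} (hC : FormClosed C) (hC' : FormClosed C') (hB : BC B N)
    (hB' : BC B' N) (h : TarskiOn N C B S) (h' : TarskiOn N C' B' S') {c a : M} (hc : c ε C)
    (hc' : c ε C') (ha : a ε B) (ha' : a ε B') : pr c a ε S ↔ pr c a ε S' := by
  refine IsForm.induct (fun c => c ε C → c ε C' → ∀ a, a ε B → a ε B' → (pr c a ε S ↔ pr c a ε S'))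
    ?_ ?_ ?_ ?_ ?_ ?_ ⟨C, hc, hC⟩ hc hc' a ha ha'
  · intro i j hi hj hc hc' a ha ha'
    rw [h _ hc _ ha, h' _ hc' _ ha', val_mem, val_mem]
  · intro i j hi hj hc hc' a ha ha'
    rw [h _ hc _ ha, h' _ hc' _ ha', val_eq, val_eq]
  · intro d _ ih hc hc' a ha ha'
    rw [h _ hc _ ha, h' _ hc' _ ha', val_not, val_not, ih (hC.not hc) (hC'.not hc') a ha ha']
  · intro d e _ _ ih ih' hc hc' a ha ha'
    rw [h _ hc _ ha, h' _ hc' _ ha', val_and, val_and, ih (hC.and hc).1 (hC'.and hc').1 a ha ha',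
      ih' (hC.and hc).2 (hC'.and hc').2 a ha ha']
  · intro i d hi _ ih hc hc' a ha ha'
    rw [h _ hc _ ha, h' _ hc' _ ha', val_ex, val_ex]
    exact exists_congr fun x => and_congr_right fun hx => ih (hC.ex hc).2 (hC'.ex hc').2 _
      (hB.2 a ha i (mem_om.2 hi) x hx) (hB'.2 a ha' i (mem_om.2 hi) x hx)
  · intro i d hi _ ih hc hc' a ha ha'
    rw [h _ hc _ ha, h' _ hc' _ ha', val_all, val_all]
    exact forall_congr' fun x => imp_congr_right fun hx => ih (hC.all hc).2 (hC'.all hc').2 _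
      (hB.2 a ha i (mem_om.2 hi) x hx) (hB'.2 a ha' i (mem_om.2 hi) x hx)

lemma TarskiOn.union {N B C S C' S' : M} (hB : BC B N) (hC : FormClosed C) (hC' : FormClosed C')
    (h : TarskiOn N C B S) (h' : TarskiOn N C' B S') : ∃ T, TarskiOn N (cup C C') B T := by
  obtain ⟨T, hT⟩ := sep (fun p => (fst p ε C ∧ p ε S) ∨ (fst p ε C' ∧ p ε S')) (cup S S')
  have h1 : ∀ d, d ε C → ∀ b, b ε B → (pr d b ε T ↔ pr d b ε S) := by
    intro d hd b hb
    rw [hT, fst_pr, mem_cup]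
    constructor
    · rintro ⟨-, ⟨-, h⟩ | ⟨hd', h2⟩⟩
      · exact h
      · exact (TarskiOn.unique hC hC' hB hB h h' hd hd' hb hb).2 h2
    · exact fun h => ⟨.inl h, .inl ⟨hd, h⟩⟩
  have h2 : ∀ d, d ε C' → ∀ b, b ε B → (pr d b ε T ↔ pr d b ε S') := by
    intro d hd b hb
    rw [hT, fst_pr, mem_cup]
    constructor
    · rintro ⟨-, ⟨hd', h2⟩ | ⟨-, h⟩⟩
      · exact (TarskiOn.unique hC hC' hB hB h h' hd' hd hb hb).1 h2
      · exact h
    · exact fun h => ⟨.inr h, .inr ⟨hd, h⟩⟩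
  refine ⟨T, fun c hc a ha => ?_⟩
  rcases mem_cup.1 hc with hc | hc
  · rw [h1 c hc a ha, h c hc a ha, val_congr hB h1 (formClosed_iff.1 hC c hc) ha]
  · rw [h2 c hc a ha, h' c hc a ha, val_congr hB h2 (formClosed_iff.1 hC' c hc) ha]

lemma TarskiOn.insert {N B C S c : M} (hB : BC B N) (hC : FormClosed C) (hc : Shape C c)
    (h : TarskiOn N C B S) : ∃ T, TarskiOn N (FOSet.cup C (sing c)) B T := by
  by_cases hcC : c ε C
  · refine ⟨S, fun d hd => h d ?_⟩
    rcases mem_cup.1 hd with hd | hd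
    · exact hd
    · rwa [mem_sing.1 hd]
  obtain ⟨P, hP⟩ := exists_prod (sing c) B
  obtain ⟨T, hT⟩ := sep (fun p => (fst p ε C ∧ p ε S) ∨ (fst p = c ∧ Val N S c (snd p)))
    (FOSet.cup S P)
  have h1 : ∀ d, d ε C → ∀ b, b ε B → (pr d b ε T ↔ pr d b ε S) := by
    intro d hd b hb
    rw [hT, fst_pr, mem_cup]
    constructor
    · rintro ⟨-, ⟨-, h⟩ | ⟨rfl, -⟩⟩
      · exact h
      · exact absurd hd hcC
    · exact fun h => ⟨.inl h, .inl ⟨hd, h⟩⟩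
  refine ⟨T, fun d hd a ha => ?_⟩
  rcases mem_cup.1 hd with hd | hd
  · rw [h1 d hd a ha, h d hd a ha, val_congr hB h1 (formClosed_iff.1 hC d hd) ha]
  · rw [mem_sing] at hd; subst hd
    rw [val_congr hB h1 hc ha, hT, fst_pr, snd_pr, mem_cup]
    constructor
    · rintro ⟨-, ⟨h, -⟩ | ⟨-, h⟩⟩
      · exact absurd h hcC
      · exact h
    · exact fun h => ⟨.inr (hP _ (by simp) _ ha), .inr ⟨rfl, h⟩⟩

instance dg_bc {f g : Γ → M} [hf : DFun M n f] [hg : DFun M n g] : Dg M n fun γ => BC (f γ) (g γ) :=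
  Dg.comp₂ (R := fun p : M × M => BC p.1 p.2) (by unfold BC; infer_instance) hf hg

instance dg_tarskiOn {f g h k : Γ → M} [hf : DFun M n f] [hg : DFun M n g] [hh : DFun M n h]
    [hk : DFun M n k] : Dg M n fun γ => TarskiOn (f γ) (g γ) (h γ) (k γ) :=
  Dg.comp₄ (R := fun p : ((M × M) × M) × M => TarskiOn p.1.1.1 p.1.1.2 p.1.2 p.2)
    (by unfold TarskiOn; infer_instance) hf hg hh hk

/-- Satisfaction relations exist. -/
lemma exists_tarskiOn {N B : M} (hB : BC B N) {c : M} (hc : IsForm c) :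
    ∃ C S, c ε C ∧ FormClosed C ∧ TarskiOn N C B S := by
  have ins : ∀ {C S c : M}, FormClosed C → TarskiOn N C B S → Shape C c →
      ∃ C S, c ε C ∧ FormClosed C ∧ TarskiOn N C B S := by
    intro C S c hC hS hc
    obtain ⟨T, hT⟩ := hS.insert hB hC hc
    exact ⟨_, T, by simp, hC.insert hc, hT⟩
  have h0 : TarskiOn N emp B emp := fun c hc => absurd hc (not_mem_emp c)
  refine IsForm.induct (fun c => ∃ C S, c ε C ∧ FormClosed C ∧ TarskiOn N C B S) ?_ ?_ ?_ ?_ ?_ ?_ hc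
  · exact fun i j hi hj => ins formClosed_emp h0 (.inl ⟨i, j, hi, hj, rfl⟩)
  · exact fun i j hi hj => ins formClosed_emp h0 (.inr (.inl ⟨i, j, hi, hj, rfl⟩))
  · rintro d - ⟨C, S, h1, h2, h3⟩
    exact ins h2 h3 (.inr (.inr (.inl ⟨d, h1, rfl⟩)))
  · rintro d e - - ⟨C, S, h1, h2, h3⟩ ⟨C', S', h1', h2', h3'⟩
    obtain ⟨T, hT⟩ := h3.union hB h2 h2' h3'
    exact ins (h2.cup h2') hT (.inr (.inr (.inr (.inl ⟨d, by simp [h1], e, by simp [h1'], rfl⟩))))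
  · rintro i d hi - ⟨C, S, h1, h2, h3⟩
    exact ins h2 h3 (.inr (.inr (.inr (.inr (.inl ⟨i, d, hi, h1, rfl⟩)))))
  · rintro i d hi - ⟨C, S, h1, h2, h3⟩
    exact ins h2 h3 (.inr (.inr (.inr (.inr (.inr ⟨i, d, hi, h1, rfl⟩)))))

lemma tarski_iff {N C S : M} (hC : FormClosed C) : Tarski N C S ↔ TarskiOn N C (AS N) S := by
  refine forall_congr' fun c => imp_congr_right fun hc => forall_congr' fun a => ?_
  rw [mem_AS]
  refine imp_congr_right fun ha => ?_
  have hev : ∀ {i}, Nt i → ∀ {x}, Ap a i x ↔ x = ev a i := by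
    intro i hi x
    rw [ap_iff, ha.fn.pr_mem, mem_om]; simp only [hi, true_and]
  have hup : ∀ {i x b}, Nt i → (Upd a i x b ↔ b = upd a i x) := fun hi => upd_iff ha.fn hi
  simp only [cMem_iff, cEq_iff, cNot_iff, cAnd_iff, cEx_iff, cAll_iff]
  rcases formClosed_iff.1 hC c hc with ⟨i, j, hi, hj, rfl⟩ | ⟨i, j, hi, hj, rfl⟩ | ⟨d, hd, rfl⟩ |
    ⟨d, hd, e, he, rfl⟩ | ⟨i, d, hi, hd, rfl⟩ | ⟨i, d, hi, hd, rfl⟩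
  · have h1 : (∃ x, Ap a i x ∧ ∃ y, Ap a j y ∧ x ε y) ↔ ev a i ε ev a j := by
      simp only [hev hi, hev hj, exists_eq_left]
    rw [val_mem, ← h1, ← ap_iff]
    simp only [qMem, qEq, qNot, qAnd, qEx, qAll, pr_inj, num_inj]
    simp only [OfNat.zero_ne_ofNat, zero_ne_one, false_and, and_false, false_imp_iff, implies_true, and_true, true_and, and_imp, exists_and_left]
    exact ⟨fun h => h i j hi hj rfl rfl, by rintro h i j - - rfl rfl; exact h⟩
  · have h1 : (∃ x, Ap a i x ∧ ∃ y, Ap a j y ∧ x = y) ↔ ev a i = ev a j := by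
      simp only [hev hi, hev hj, exists_eq_left]
    rw [val_eq, ← h1, ← ap_iff]
    simp only [qMem, qEq, qNot, qAnd, qEx, qAll, pr_inj, num_inj]
    simp only [OfNat.one_ne_ofNat, one_ne_zero, false_and, and_false, false_imp_iff, implies_true, and_true, true_and, and_imp, exists_and_left]
    exact ⟨fun h => h i j hi hj rfl rfl, by rintro h i j - - rfl rfl; exact h⟩
  · rw [val_not]
    simp [qMem, qEq, qNot, qAnd, qEx, qAll, pr_inj, num_inj, ap_iff]
  · rw [val_and]
    simp [qMem, qEq, qNot, qAnd, qEx, qAll, pr_inj, num_inj, ap_iff]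
  · rw [val_ex]
    simp only [qMem, qEq, qNot, qAnd, qEx, qAll, pr_inj, num_inj]
    simp only [OfNat.ofNat_ne_zero, OfNat.ofNat_ne_one, Nat.reduceEqDiff, false_and, and_false,
      false_imp_iff, implies_true, and_true, true_and, and_imp, ap_iff]
    constructor
    · intro h
      have := h i d hi rfl rfl
      simpa only [hup hi, exists_eq_left] using this
    · rintro h i d - rfl rfl
      simpa only [hup hi, exists_eq_left] using h
  · rw [val_all]
    simp only [qMem, qEq, qNot, qAnd, qEx, qAll, pr_inj, num_inj]
    simp only [OfNat.ofNat_ne_zero, OfNat.ofNat_ne_one, Nat.reduceEqDiff, false_and, and_false,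
      false_imp_iff, implies_true, and_true, true_and, and_imp, ap_iff]
    constructor
    · intro h
      have := h i d hi rfl rfl
      simpa only [hup hi, forall_eq] using this
    · rintro h i d - rfl rfl
      simpa only [hup hi, forall_eq] using h

/-- Satisfaction, read off from any satisfaction relation on enough assignments. -/
lemma sat_iff_mem {N C B S c a : M} (hB : BC B N) (hC : FormClosed C) (h : TarskiOn N C B S)
    (hc : c ε C) (ha : a ε B) : Sat N c a ↔ pr c a ε S := by
  have ha' : a ε AS N := mem_AS.2 (hB.1 a ha)
  simp only [Sat, ap_iff]
  constructor
  · rintro ⟨C', S', hc', hC', h', hS'⟩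
    exact (h.unique hC hC' hB (bc_AS N) ((tarski_iff hC').1 h') hc hc' ha ha').2 hS'
  · intro hS
    obtain ⟨C', S', hc', hC', h'⟩ := exists_tarskiOn (bc_AS N) ⟨C, hc, hC⟩
    exact ⟨C', S', hc', hC', (tarski_iff hC').2 h',
      (h.unique hC hC' hB (bc_AS N) h' hc hc' ha ha').1 hS⟩

section
variable {N a i j d e : M}

lemma sat_val {c : M} (ha : Asg a N) (hc : IsForm c) : ∃ C S, c ε C ∧ FormClosed C ∧
    (∀ d, d ε C → ∀ b, Asg b N → (Sat N d b ↔ pr d b ε S)) ∧ (Sat N c a ↔ Val N S c a) := by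
  obtain ⟨C, S, h1, h2, h3⟩ := exists_tarskiOn (bc_AS N) hc
  have h4 : ∀ d, d ε C → ∀ b, Asg b N → (Sat N d b ↔ pr d b ε S) :=
    fun d hd b hb => sat_iff_mem (bc_AS N) h2 h3 hd (mem_AS.2 hb)
  exact ⟨C, S, h1, h2, h4, (h4 c h1 a ha).trans (h3 c h1 a (mem_AS.2 ha))⟩

lemma sat_mem (ha : Asg a N) (hi : Nt i) (hj : Nt j) : Sat N (qMem i j) a ↔ ev a i ε ev a j := by
  obtain ⟨C, S, -, -, -, h⟩ := sat_val ha (isForm_mem hi hj)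
  rw [h, val_mem]
lemma sat_eq (ha : Asg a N) (hi : Nt i) (hj : Nt j) : Sat N (qEq i j) a ↔ ev a i = ev a j := by
  obtain ⟨C, S, -, -, -, h⟩ := sat_val ha (isForm_eq hi hj)
  rw [h, val_eq]
lemma sat_not (ha : Asg a N) (hd : IsForm d) : Sat N (qNot d) a ↔ ¬ Sat N d a := by
  obtain ⟨C, S, h1, h2, h3, h⟩ := sat_val ha (isForm_not.2 hd)
  rw [h, val_not, h3 d (h2.not h1) a ha]
lemma sat_and (ha : Asg a N) (hd : IsForm d) (he : IsForm e) :
    Sat N (qAnd d e) a ↔ (Sat N d a ∧ Sat N e a) := by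
  obtain ⟨C, S, h1, h2, h3, h⟩ := sat_val ha (isForm_and.2 ⟨hd, he⟩)
  rw [h, val_and, h3 d (h2.and h1).1 a ha, h3 e (h2.and h1).2 a ha]
lemma sat_ex (ha : Asg a N) (hi : Nt i) (hd : IsForm d) :
    Sat N (qEx i d) a ↔ ∃ x, x ε N ∧ Sat N d (upd a i x) := by
  obtain ⟨C, S, h1, h2, h3, h⟩ := sat_val ha (isForm_ex.2 ⟨hi, hd⟩)
  rw [h, val_ex]
  exact exists_congr fun x => and_congr_right fun hx => (h3 d (h2.ex h1).2 _ (asg_upd ha hx)).symm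
lemma sat_all (ha : Asg a N) (hi : Nt i) (hd : IsForm d) :
    Sat N (qAll i d) a ↔ ∀ x, x ε N → Sat N d (upd a i x) := by
  obtain ⟨C, S, h1, h2, h3, h⟩ := sat_val ha (isForm_all.2 ⟨hi, hd⟩)
  rw [h, val_all]
  exact forall_congr' fun x => imp_congr_right fun hx => (h3 d (h2.all h1).2 _ (asg_upd ha hx)).symm
end

/-- Satisfaction for formulas and assignments. -/
def Tru (N c a : M) : Prop := IsForm c ∧ Asg a N ∧ Sat N c a

lemma tru_iff {N c a : M} (hc : IsForm c) (ha : Asg a N) : Tru N c a ↔ Sat N c a := by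
  simp [Tru, hc, ha]

lemma tru_iff_exists {N c a : M} : Tru N c a ↔ ∃ C B S, c ε C ∧ FormClosed C ∧ BC B N ∧ a ε B ∧
    TarskiOn N C B S ∧ pr c a ε S := by
  constructor
  · rintro ⟨hc, ha, h⟩
    obtain ⟨C, S, h1, h2, h3⟩ := exists_tarskiOn (bc_AS N) hc
    exact ⟨C, AS N, S, h1, h2, bc_AS N, mem_AS.2 ha, h3,
      (sat_iff_mem (bc_AS N) h2 h3 h1 (mem_AS.2 ha)).1 h⟩
  · rintro ⟨C, B, S, h1, h2, h3, h4, h5, h6⟩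
    exact ⟨⟨C, h1, h2⟩, h3.1 a h4, (sat_iff_mem h3 h2 h5 h1 h4).2 h6⟩

lemma sg_tru : Sg M n fun p : (M × M) × M => Tru p.1.1 p.1.2 p.2 :=
  Sg.congr fun _ => tru_iff_exists

instance dg_tru {f g h : Γ → M} [hf : DFun M n f] [hg : DFun M n g] [hh : DFun M n h] :
    Dg M n fun γ => Tru (f γ) (g γ) (h γ) := by
  refine Dg.comp₃ (R := fun p : (M × M) × M => Tru p.1.1 p.1.2 p.2) ⟨sg_tru, ?_⟩ hf hg hh
  have h1 : Sg M n fun p : (M × M) × M => Tru p.1.1 (qNot p.1.2) p.2 := by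
    refine Sg.congr (Q := fun p => ∃ C B S, qNot p.1.2 ε C ∧ FormClosed C ∧ BC B p.1.1 ∧ p.2 ε B ∧
      TarskiOn p.1.1 C B S ∧ pr (qNot p.1.2) p.2 ε S) fun _ => tru_iff_exists
  have h2 : Pg M n fun p : (M × M) × M =>
    IsForm p.1.2 ∧ Asg p.2 p.1.1 ∧ ¬ Tru p.1.1 (qNot p.1.2) p.2 := inferInstance
  have : (fun p : (M × M) × M => Tru p.1.1 p.1.2 p.2) = fun p : (M × M) × M =>
      IsForm p.1.2 ∧ Asg p.2 p.1.1 ∧ ¬ Tru p.1.1 (qNot p.1.2) p.2 := by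
    funext p
    obtain ⟨⟨N, c⟩, a⟩ := p
    refine propext (and_congr_right fun hc => and_congr_right fun ha => ?_)
    rw [tru_iff (isForm_not.2 hc) ha, sat_not ha hc, not_not]
  rwa [this]

/-- The value of a formula depends only on the values of the variables that belong to a transitive
set containing the formula. -/
def Agree (t a b : M) : Prop := ∀ i, i ε t → Nt i → ev a i = ev b i

instance dg_agree {f g h : Γ → M} [hf : DFun M n f] [hg : DFun M n g] [hh : DFun M n h] :
    Dg M n fun γ => Agree (f γ) (g γ) (h γ) :=
  Dg.comp₃ (R := fun p : (M × M) × M => Agree p.1.1 p.1.2 p.2) (by unfold Agree; infer_instance)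
    hf hg hh

lemma Agree.upd {t a b : M} (h : Agree t a b) (i x : M) : Agree t (upd a i x) (upd b i x) := by
  intro k hk hk'
  rw [ev_upd hk', ev_upd hk', h k hk hk']

lemma Tr.pr_mem {t x y : M} (ht : Tr t) (h : pr x y ε t) : x ε t ∧ y ε t := by
  have h1 : upr x y ε t := ht _ h _ (by simp [pr])
  exact ⟨ht _ h1 x (by simp), ht _ h1 y (by simp)⟩

lemma tru_agree {N t c a b : M} (ht : Tr t) (hc : c ε t) (h : Agree t a b) (ha : Asg a N)
    (hb : Asg b N) (hF : IsForm c) : Tru N c a ↔ Tru N c b := by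
  refine IsForm.induct (fun c => c ε t → ∀ a, a ε AS N → ∀ b, b ε AS N → Agree t a b →
    (Tru N c a ↔ Tru N c b)) ?_ ?_ ?_ ?_ ?_ ?_ hF hc a (mem_AS.2 ha) b (mem_AS.2 hb) h
  · intro i j hi hj hc a ha b hb h
    rw [mem_AS] at ha hb
    have h1 := ht.pr_mem (ht.pr_mem hc).2
    rw [tru_iff (isForm_mem hi hj) ha, tru_iff (isForm_mem hi hj) hb, sat_mem ha hi hj,
      sat_mem hb hi hj, h i h1.1 hi, h j h1.2 hj]
  · intro i j hi hj hc a ha b hb h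
    rw [mem_AS] at ha hb
    have h1 := ht.pr_mem (ht.pr_mem hc).2
    rw [tru_iff (isForm_eq hi hj) ha, tru_iff (isForm_eq hi hj) hb, sat_eq ha hi hj,
      sat_eq hb hi hj, h i h1.1 hi, h j h1.2 hj]
  · intro d hd ih hc a ha b hb h
    have h1 := ih (ht.pr_mem hc).2 a ha b hb h
    rw [mem_AS] at ha hb
    rw [tru_iff hd ha, tru_iff hd hb] at h1
    rw [tru_iff (isForm_not.2 hd) ha, tru_iff (isForm_not.2 hd) hb, sat_not ha hd, sat_not hb hd, h1]
  · intro d e hd he ih1 ih2 hc a ha b hb h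
    have h0 := ht.pr_mem (ht.pr_mem hc).2
    have h1 := ih1 h0.1 a ha b hb h
    have h2 := ih2 h0.2 a ha b hb h
    rw [mem_AS] at ha hb
    have hde := isForm_and.2 ⟨hd, he⟩
    rw [tru_iff hd ha, tru_iff hd hb] at h1
    rw [tru_iff he ha, tru_iff he hb] at h2
    rw [tru_iff hde ha, tru_iff hde hb, sat_and ha hd he, sat_and hb hd he, h1, h2]
  · intro i d hi hd ih hc a ha b hb h
    have h0 := (ht.pr_mem (ht.pr_mem hc).2).2
    rw [mem_AS] at ha hb
    have hd' := isForm_ex.2 ⟨hi, hd⟩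
    rw [tru_iff hd' ha, tru_iff hd' hb, sat_ex ha hi hd, sat_ex hb hi hd]
    refine exists_congr fun x => and_congr_right fun hx => ?_
    rw [← tru_iff hd (asg_upd ha hx), ← tru_iff hd (asg_upd hb hx)]
    exact ih h0 _ (mem_AS.2 (asg_upd ha hx)) _ (mem_AS.2 (asg_upd hb hx)) (h.upd i x)
  · intro i d hi hd ih hc a ha b hb h
    have h0 := (ht.pr_mem (ht.pr_mem hc).2).2
    rw [mem_AS] at ha hb
    have hd' := isForm_all.2 ⟨hi, hd⟩
    rw [tru_iff hd' ha, tru_iff hd' hb, sat_all ha hi hd, sat_all hb hi hd]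
    refine forall_congr' fun x => imp_congr_right fun hx => ?_
    rw [← tru_iff hd (asg_upd ha hx), ← tru_iff hd (asg_upd hb hx)]
    exact ih h0 _ (mem_AS.2 (asg_upd ha hx)) _ (mem_AS.2 (asg_upd hb hx)) (h.upd i x)

end Codes

end FOSet

namespace FOSet

noncomputable section Levy

set_option linter.unusedSectionVars false
set_option synthInstance.maxHeartbeats 400000
set_option synthInstance.maxSize 2000

open TModel (lvl)

variable {M : Type} [setLang.Structure M] [TModel M] {Γ : Type} [Ctx M Γ] {n : ℕ}

/-! ## Codes in the Levy hierarchy -/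

def qBEx (i j d : M) : M := qEx i (qAnd (qMem i j) d)
def qBAll (i j d : M) : M := qAll i (qNot (qAnd (qMem i j) (qNot d)))

lemma cBEx_iff {c i j d : M} : CBEx c i j d ↔ ¬ i = j ∧ Nt i ∧ Nt j ∧ c = qBEx i j d := by
  simp only [CBEx, cMem_iff, cAnd_iff, cEx_iff, qBEx]
  refine and_congr_right fun _ => ⟨?_, ?_⟩
  · rintro ⟨e, g, ⟨hi, hj, rfl⟩, rfl, -, rfl⟩; exact ⟨hi, hj, rfl⟩
  · rintro ⟨hi, hj, rfl⟩; exact ⟨_, _, ⟨hi, hj, rfl⟩, rfl, hi, rfl⟩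

lemma cBAll_iff {c i j d : M} : CBAll c i j d ↔ ¬ i = j ∧ Nt i ∧ Nt j ∧ c = qBAll i j d := by
  simp only [CBAll, cMem_iff, cAnd_iff, cAll_iff, cNot_iff, qBAll]
  refine and_congr_right fun _ => ⟨?_, ?_⟩
  · rintro ⟨e, d', g, h, ⟨hi, hj, rfl⟩, rfl, rfl, rfl, -, rfl⟩; exact ⟨hi, hj, rfl⟩
  · rintro ⟨hi, hj, rfl⟩; exact ⟨_, _, _, _, ⟨hi, hj, rfl⟩, rfl, rfl, rfl, hi, rfl⟩

instance {f g h : Γ → M} [DFun M n f] [DFun M n g] [DFun M n h] :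
    DFun M n fun γ => qBEx (f γ) (g γ) (h γ) := by unfold qBEx; infer_instance
instance {f g h : Γ → M} [DFun M n f] [DFun M n g] [DFun M n h] :
    DFun M n fun γ => qBAll (f γ) (g γ) (h γ) := by unfold qBAll; infer_instance

/-- The possible shapes of an element of a set `C` that is closed under `Δ₀`-components. -/
def Shape₀ (C c : M) : Prop :=
  (∃ i j, Nt i ∧ Nt j ∧ c = qMem i j) ∨ (∃ i j, Nt i ∧ Nt j ∧ c = qEq i j) ∨
  (∃ d, d ε C ∧ c = qNot d) ∨ (∃ d, d ε C ∧ ∃ e, e ε C ∧ c = qAnd d e) ∨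
  (∃ i j d, d ε C ∧ ¬ i = j ∧ Nt i ∧ Nt j ∧ c = qBEx i j d) ∨
  (∃ i j d, d ε C ∧ ¬ i = j ∧ Nt i ∧ Nt j ∧ c = qBAll i j d)

lemma d0Closed_iff {C : M} : D0Closed C ↔ ∀ c, c ε C → Shape₀ C c := by
  refine forall_congr' fun c => imp_congr_right fun _ => ?_
  simp only [CAtomic, cMem_iff, cEq_iff, cNot_iff, cAnd_iff, cBEx_iff, cBAll_iff, Shape₀, exists_or,
    and_or_left, or_assoc]

instance sg_d0Code {f : Γ → M} [hf : DFun M n f] : Sg M n fun γ => D0Code (f γ) :=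
  Sg.comp₁ (R := D0Code) (Sg.congr (Q := fun c => ∃ C, c ε C ∧ ∀ c, c ε C → Shape₀ C c)
    (hQ := by unfold Shape₀; infer_instance) fun _ => by simp only [D0Code, d0Closed_iff]) hf
instance : Sg M n (D0Code : M → Prop) := sg_d0Code (f := fun x => x)

/-- Induction on codes of `Δ₀`-formulas. -/
lemma D0Code.induct (P : M → Prop) [hP : Dg M (lvl M + 2) P]
    (hmem : ∀ i j, Nt i → Nt j → P (qMem i j)) (heq : ∀ i j, Nt i → Nt j → P (qEq i j))
    (hnot : ∀ d, D0Code d → P d → P (qNot d))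
    (hand : ∀ d e, D0Code d → D0Code e → P d → P e → P (qAnd d e))
    (hex : ∀ i j d, ¬ i = j → Nt i → Nt j → D0Code d → P d → P (qBEx i j d))
    (hall : ∀ i j d, ¬ i = j → Nt i → Nt j → D0Code d → P d → P (qBAll i j d))
    {c : M} (hc : D0Code c) : P c := by
  refine rank_induction (fun c => D0Code c → P c) (fun c α hα hcα ih h => ?_) c hc
  obtain ⟨C, hcC, hC⟩ := h
  have hF : ∀ {d}, d ε C → D0Code d := fun hd => ⟨C, hd, hC⟩
  rcases d0Closed_iff.1 hC c hcC with ⟨i, j, hi, hj, rfl⟩ | ⟨i, j, hi, hj, rfl⟩ | ⟨d, hd, rfl⟩ |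
    ⟨d, hd, e, he, rfl⟩ | ⟨i, j, d, hd, hij, hi, hj, rfl⟩ | ⟨i, j, d, hd, hij, hi, hj, rfl⟩
  · exact hmem i j hi hj
  · exact heq i j hi hj
  · exact hnot d (hF hd) (ih d (pr_sub_V hcα).2 (hF hd))
  · exact hand d e (hF hd) (hF he) (ih d (sub_V_of_pr₂ hcα).1 (hF hd))
      (ih e (sub_V_of_pr₂ hcα).2 (hF he))
  · have h1 := (mem_V_of_pr (mem_V_of_pr (sub_V_of_pr₂ hcα).2).2).2
    exact hex i j d hij hi hj (hF hd) (ih d h1 (hF hd))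
  · have h1 := (mem_V_of_pr (mem_V_of_pr (mem_V_of_pr (mem_V_of_pr (sub_V_of_pr₂ hcα).2).2).2).2).2
    exact hall i j d hij hi hj (hF hd) (ih d h1 (hF hd))

lemma isForm_bex {i j d : M} (hi : Nt i) (hj : Nt j) (hd : IsForm d) : IsForm (qBEx i j d) :=
  isForm_ex.2 ⟨hi, isForm_and.2 ⟨isForm_mem hi hj, hd⟩⟩
lemma isForm_ball {i j d : M} (hi : Nt i) (hj : Nt j) (hd : IsForm d) : IsForm (qBAll i j d) :=
  isForm_all.2 ⟨hi, isForm_not.2 (isForm_and.2 ⟨isForm_mem hi hj, isForm_not.2 hd⟩)⟩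

lemma D0Code.isForm {c : M} (h : D0Code c) : IsForm c := by
  refine D0Code.induct (fun c => IsForm c) ?_ ?_ ?_ ?_ ?_ ?_ h
  · exact fun i j => isForm_mem
  · exact fun i j => isForm_eq
  · exact fun d _ => isForm_not.2
  · exact fun d e _ _ h h' => isForm_and.2 ⟨h, h'⟩
  · exact fun i j d _ hi hj _ => isForm_bex hi hj
  · exact fun i j d _ hi hj _ => isForm_ball hi hj

instance : Dg M n (D0Code : M → Prop) := dg_of_forms _ fun _ h => h.isForm
instance dg_d0Code {f : Γ → M} [hf : DFun M n f] : Dg M n fun γ => D0Code (f γ) :=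
  Dg.comp₁ (R := D0Code) inferInstance hf

/-- `∃ v_i d` or `∀ v_i d`. -/
def qQ : Side → M → M → M
  | .sigma, i, d => qEx i d
  | .pi, i, d => qAll i d

instance dFun_qQ {s : Side} {f g : Γ → M} [DFun M n f] [DFun M n g] :
    DFun M n fun γ => qQ s (f γ) (g γ) := by
  cases s <;> (unfold qQ; infer_instance)

lemma cQuant_iff {s : Side} {c i d : M} : CQuant s c i d ↔ Nt i ∧ c = qQ s i d := by
  cases s
  · exact cEx_iff
  · exact cAll_iff

lemma isForm_qQ {s : Side} {i d : M} : IsForm (qQ s i d) ↔ Nt i ∧ IsForm d := by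
  cases s
  · exact isForm_ex
  · exact isForm_all

lemma levyCode_succ {k : ℕ} {s : Side} {c : M} : LevyCode (k + 1) s c ↔ ∃ C, c ε C ∧
    ∀ c, c ε C → LevyCode k s.swap c ∨ ∃ i d, d ε C ∧ Nt i ∧ c = qQ s i d := by
  simp only [LevyCode, cQuant_iff]

lemma LevyCode.base {k : ℕ} {s : Side} {c : M} (h : LevyCode k s.swap c) : LevyCode (k + 1) s c :=
  levyCode_succ.2 ⟨sing c, by simp, fun d hd => Or.inl (by rwa [mem_sing.1 hd])⟩

lemma LevyCode.quant {k : ℕ} {s : Side} {i d : M} (hi : Nt i) (h : LevyCode (k + 1) s d) :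
    LevyCode (k + 1) s (qQ s i d) := by
  obtain ⟨C, hd, hC⟩ := levyCode_succ.1 h
  refine levyCode_succ.2 ⟨cup C (sing (qQ s i d)), by simp, fun c hc => ?_⟩
  rcases mem_cup.1 hc with hc | hc
  · rcases hC c hc with h | ⟨j, e, he, hj, rfl⟩
    · exact Or.inl h
    · exact Or.inr ⟨j, e, by simp [he], hj, rfl⟩
  · exact Or.inr ⟨i, d, by simp [hd], hi, mem_sing.1 hc⟩

lemma qQ_sub_V {s : Side} {i d α : M} (h : Sub (qQ s i d) (V α)) : d ε V α := by
  cases s <;> exact (sub_V_of_pr₂ h).2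

lemma LevyCode.block_induction_of_sg {k : ℕ} {s : Side} (hk : Sg M (lvl M + 1) fun c : M => LevyCode (k + 1) s c)
    (P : M → Prop) [hP : Dg M (lvl M + 2) P]
    (base : ∀ c, LevyCode k s.swap c → P c)
    (step : ∀ i d, Nt i → LevyCode (k + 1) s d → P d → P (qQ s i d)) {c : M}
    (hc : LevyCode (k + 1) s c) : P c := by
  refine rank_induction (fun c => LevyCode (k + 1) s c → P c) (fun c α hα hcα ih h => ?_) c hc
  obtain ⟨C, hcC, hC⟩ := levyCode_succ.1 h
  rcases hC c hcC with h | ⟨i, d, hd, hi, rfl⟩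
  · exact base c h
  · have : LevyCode (k + 1) s d := levyCode_succ.2 ⟨C, hd, hC⟩
    exact step i d hi this (ih d (qQ_sub_V hcα) this)

lemma levyCode_aux (k : ℕ) : ∀ s, (∀ n, Dg M n fun c : M => LevyCode k s c) ∧
    ∀ c : M, LevyCode k s c → IsForm c := by
  induction k with
  | zero => exact fun s => ⟨fun n => inferInstanceAs (Dg M n (D0Code : M → Prop)), fun c h => D0Code.isForm h⟩
  | succ k ih =>
    intro s
    have h1 : ∀ n, Sg M n fun c : M => LevyCode (k + 1) s c := by
      intro n
      have : Dg M n fun q : (M × M) × M => LevyCode k s.swap q.2 :=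
        Dg.comp₁ (R := LevyCode k s.swap) ((ih s.swap).1 n) inferInstance
      exact Sg.congr (Q := fun c => ∃ C, c ε C ∧
        ∀ c, c ε C → LevyCode k s.swap c ∨ ∃ i d, d ε C ∧ Nt i ∧ c = qQ s i d) fun c => levyCode_succ
    have h2 : ∀ c : M, LevyCode (k + 1) s c → IsForm c := fun c hc =>
      LevyCode.block_induction_of_sg (h1 _) (fun c => IsForm c) (fun c h => (ih s.swap).2 c h)
        (fun i d hi _ h => isForm_qQ.2 ⟨hi, h⟩) hc
    have := h1 (lvl M + 1)
    have h3 : Dg M (lvl M + 2) fun c : M => LevyCode (k + 1) s c := inferInstance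
    exact ⟨fun n => dg_of_forms _ h2, h2⟩

lemma LevyCode.isForm {k : ℕ} {s : Side} {c : M} (h : LevyCode k s c) : IsForm c :=
  (levyCode_aux k s).2 c h

instance dg_levyCode {k : ℕ} {s : Side} {f : Γ → M} [hf : DFun M n f] :
    Dg M n fun γ => LevyCode k s (f γ) :=
  Dg.comp₁ (R := LevyCode k s) ((levyCode_aux k s).1 n) hf
instance {k : ℕ} {s : Side} : Dg M n (LevyCode k s : M → Prop) := dg_levyCode (f := fun x => x)

/-- Induction on the quantifier block of a code. -/
lemma LevyCode.block_induction {k : ℕ} {s : Side} (P : M → Prop) [hP : Dg M (lvl M + 2) P]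
    (base : ∀ c, LevyCode k s.swap c → P c)
    (step : ∀ i d, Nt i → LevyCode (k + 1) s d → P d → P (qQ s i d)) {c : M}
    (hc : LevyCode (k + 1) s c) : P c :=
  LevyCode.block_induction_of_sg inferInstance P base step hc

/-! ## Quantifier blocks -/

lemma block_iff {s : Side} {c a d b : M} : Block s c a d b ↔ ∃ R, pr c a ε R ∧
    ∀ p, p ε R → p = pr (fst p) (snd p) → ((fst p = d ∧ snd p = b) ∨
      ∃ i e x a', (Nt i ∧ fst p = qQ s i e) ∧ Upd (snd p) i x a' ∧ pr e a' ε R) := by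
  simp only [Block, ap_iff, cQuant_iff]
  refine exists_congr fun R => and_congr_right fun _ => ⟨fun h p hp hpp => ?_, fun h c' a' hc => ?_⟩
  · rw [hpp] at hp; exact h _ _ hp
  · have := h _ hc (by simp)
    rwa [fst_pr, snd_pr] at this

instance sg_block {s : Side} {f g h k : Γ → M} [hf : DFun M n f] [hg : DFun M n g]
    [hh : DFun M n h] [hk : DFun M n k] : Sg M n fun γ => Block s (f γ) (g γ) (h γ) (k γ) :=
  Sg.comp₄ (R := fun p : ((M × M) × M) × M => Block s p.1.1.1 p.1.1.2 p.1.2 p.2)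
    (Sg.congr fun _ => block_iff) hf hg hh hk

lemma Block.refl {s : Side} (c a : M) : Block s c a c a :=
  block_iff.2 ⟨sing (pr c a), by simp, fun p hp _ => Or.inl (by rw [mem_sing.1 hp]; simp)⟩

lemma Block.step {s : Side} {i e x a a' d b : M} (hi : Nt i) (hu : Upd a i x a')
    (h : Block s e a' d b) : Block s (qQ s i e) a d b := by
  obtain ⟨R, hR, hR'⟩ := block_iff.1 h
  refine block_iff.2 ⟨cup R (sing (pr (qQ s i e) a)), by simp, fun p hp hpp => ?_⟩
  rcases mem_cup.1 hp with hp | hp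
  · rcases hR' p hp hpp with h | ⟨j, e', y, a'', h1, h2, h3⟩
    · exact Or.inl h
    · exact Or.inr ⟨j, e', y, a'', h1, h2, by simp [h3]⟩
  · rw [mem_sing] at hp; subst hp
    rw [fst_pr, snd_pr]
    exact Or.inr ⟨i, e, x, a', ⟨hi, rfl⟩, hu, by simp [hR]⟩

/-- Induction along a quantifier block, from its end. -/
lemma Block.ind {s : Side} {d b : M} (P : M → M → Prop)
    [hP : Dg M (lvl M + 2) fun p : M × M => P p.1 p.2] (h0 : P d b)
    (h1 : ∀ i e x a a', Nt i → Upd a i x a' → P e a' → P (qQ s i e) a) {c a : M}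
    (h : Block s c a d b) : P c a := by
  obtain ⟨R, hR, hR'⟩ := block_iff.1 h
  refine rank_induction (fun c => ∀ a, a ε un (un R) → pr c a ε R → P c a) (fun c α hα hc ih a _ h => ?_)
    c a (right_mem_of_pr hR) hR
  have := hR' _ h (by simp)
  rw [fst_pr, snd_pr] at this
  rcases this with ⟨rfl, rfl⟩ | ⟨i, e, x, a', ⟨hi, rfl⟩, hu, he⟩
  · exact h0
  · exact h1 i e x a a' hi hu (ih e (qQ_sub_V hc) a' (right_mem_of_pr he) he)

lemma Tr.of_qQ {t i d : M} {s : Side} (ht : Tr t) (h : qQ s i d ε t) : d ε t := by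
  cases s <;> exact (ht.pr_mem (ht.pr_mem h).2).2

lemma Block.fn {s : Side} {c a d b : M} (h : Block s c a d b) (ha : Fn a om) : Fn b om :=
  h.ind (fun _ a => Fn a om → Fn b om) (fun h => h) (fun _ _ _ _ _ _ hu h _ => h hu.fn) ha

/-- A block can be transferred to an assignment with the same relevant values. -/
lemma Block.transfer {s : Side} {t c a d b : M} (ht : Tr t) (h : Block s c a d b) (hc : c ε t)
    (ha : Fn a om) {a' : M} (ha' : Fn a' om) (haa : Agree t a a') :
    ∃ b', Block s c a' d b' ∧ Agree t b b' ∧ d ε t := by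
  refine h.ind (fun c a => c ε t → Fn a om → ∀ a', Fn a' om → Agree t a a' →
    ∃ b', Block s c a' d b' ∧ Agree t b b' ∧ d ε t) ?_ ?_ hc ha a' ha' haa
  · exact fun hd _ a' _ haa => ⟨a', Block.refl _ _, haa, hd⟩
  · intro i e x a a₁ hi hu ih hc ha a' ha' haa
    rw [upd_iff ha hi] at hu
    subst hu
    obtain ⟨b', h1, h2⟩ := ih (ht.of_qQ hc) (fn_upd _ _ _) _ (fn_upd a' i x) (haa.upd i x)
    exact ⟨b', h1.step hi ((upd_iff ha' hi).2 rfl), h2⟩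

/-- A statement or its negation, according to the side of the hierarchy. -/
def pos : Side → Prop → Prop
  | .sigma, p => p
  | .pi, p => ¬ p

lemma pos_congr {s : Side} {p q : Prop} : (pos s p ↔ pos s q) ↔ (p ↔ q) := by
  cases s
  · exact Iff.rfl
  · exact not_iff_not

instance dg_pos {s : Side} {P : Γ → Prop} [Dg M n P] : Dg M n fun γ => pos s (P γ) := by
  cases s <;> (unfold pos; infer_instance)

lemma tru_qQ {s : Side} {N i e a : M} (hi : Nt i) (he : IsForm e) (ha : Asg a N) :
    pos s (Tru N (qQ s i e) a) ↔ ∃ x, x ε N ∧ pos s (Tru N e (upd a i x)) := by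
  have h : IsForm (qQ s i e) := isForm_qQ.2 ⟨hi, he⟩
  rw [tru_iff h ha]
  cases s
  · simp only [pos, qQ, sat_ex ha hi he]
    exact exists_congr fun x => and_congr_right fun hx => (tru_iff he (asg_upd ha hx)).symm
  · simp only [pos, qQ, sat_all ha hi he, not_forall, exists_prop]
    exact exists_congr fun x => and_congr_right fun hx => not_congr (tru_iff he (asg_upd ha hx)).symm

/-- In a set, the value of a formula is determined by the end of a block. -/
lemma Block.tru {s : Side} {N c a d b : M} (h : Block s c a d b) (hc : IsForm c) (ha : Asg a N)
    (hb : Asg b N) (hd : pos s (Tru N d b)) : pos s (Tru N c a) := by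
  refine h.ind (fun c a => IsForm c → Fn a om → ∀ a', a' ε AS N →
    (∀ i, i ε om → ev a i = ev a' i ∨ ¬ ev a i ε N) → pos s (Tru N c a')) ?_ ?_ hc ha.fn a
    (mem_AS.2 ha) fun _ _ => Or.inl rfl
  · intro _ _ a' ha' hab
    rw [mem_AS] at ha'
    rwa [← hb.fn.ext ha'.fn fun i hi => (hab i hi).resolve_right (not_not.2 (hb.ev_mem (mem_om.1 hi)))]
  · intro i e x a a₁ hi hu ih hc ha a' ha' hab
    rw [upd_iff ha hi] at hu
    subst hu
    have he := (isForm_qQ.1 hc).2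
    rw [mem_AS] at ha'
    rw [tru_qQ hi he ha']
    by_cases hx : x ε N
    · refine ⟨x, hx, ih he (fn_upd _ _ _) _ (mem_AS.2 (asg_upd ha' hx)) fun k hk => ?_⟩
      have hk' := mem_om.1 hk
      rw [ev_upd hk', ev_upd hk']
      split_ifs
      · exact Or.inl rfl
      · exact hab k hk
    · refine ⟨ev a' i, ha'.ev_mem hi, ?_⟩
      have h1 : upd a' i (ev a' i) = a' := by
        refine (fn_upd _ _ _).ext ha'.fn fun k hk => ?_
        rw [ev_upd (mem_om.1 hk)]
        split_ifs with h
        · rw [h]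
        · rfl
      rw [h1]
      refine ih he (fn_upd _ _ _) _ (mem_AS.2 ha') fun k hk => ?_
      rw [ev_upd (mem_om.1 hk)]
      split_ifs
      · exact Or.inr hx
      · exact hab k hk

lemma exists_block {s : Side} {k : ℕ} {N c a : M} (hc : LevyCode (k + 1) s c) (ha : Asg a N)
    (h : pos s (Tru N c a)) : ∃ d b, LevyCode k s.swap d ∧ Asg b N ∧ Block s c a d b ∧
      pos s (Tru N d b) := by
  refine LevyCode.block_induction (k := k) (s := s) (fun c => ∀ a, a ε AS N → pos s (Tru N c a) →
    ∃ d b, LevyCode k s.swap d ∧ Asg b N ∧ Block s c a d b ∧ pos s (Tru N d b)) ?_ ?_ hc a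
    (mem_AS.2 ha) h
  · intro c hc a ha h
    exact ⟨c, a, hc, mem_AS.1 ha, Block.refl c a, h⟩
  · intro i e hi he ih a ha h
    rw [mem_AS] at ha
    obtain ⟨x, hx, h⟩ := (tru_qQ hi he.isForm ha).1 h
    obtain ⟨d, b, h1, h2, h3, h4⟩ := ih _ (mem_AS.2 (asg_upd ha hx)) h
    exact ⟨d, b, h1, h2, h3.step hi ((upd_iff ha.fn hi).2 rfl), h4⟩

/-! ## Partial satisfaction predicates -/

lemma Asg.mono {a N N' : M} (h : Asg a N) (hN : Sub N N') : Asg a N' :=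
  asg_iff.2 ⟨h.fn, fun _ hi => hN _ (h.ev_mem (mem_om.1 hi))⟩

lemma asg_of_mem {a t : M} (ha : Fn a om) (ht : Tr t) (h : a ε t) : Asg a t :=
  asg_iff.2 ⟨ha, fun i hi => (ht.pr_mem (ht _ h _ (ha.2 i hi))).2⟩

lemma tru_abs {N N' c a : M} (hN : Tr N) (hN' : Tr N') (ha : Asg a N) (ha' : Asg a N')
    (hc : D0Code c) : Tru N c a ↔ Tru N' c a := by
  have hset : ∀ {i j d a : M}, i ≠ j → Nt i → Nt j → Asg a N → Asg a N' →
      (∀ a, a ε AS N → a ε AS N' → (Tru N d a ↔ Tru N' d a)) →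
      ∀ x, (x ε N ∧ x ε ev a j ∧ Tru N d (upd a i x)) ↔ (x ε N' ∧ x ε ev a j ∧ Tru N' d (upd a i x)) := by
    intro i j d a hij hi hj ha ha' ih x
    by_cases hx : x ε ev a j
    · have h1 := hN _ (ha.ev_mem hj) x hx
      have h2 := hN' _ (ha'.ev_mem hj) x hx
      simp only [h1, h2, hx, true_and]
      exact ih _ (mem_AS.2 (asg_upd ha h1)) (mem_AS.2 (asg_upd ha' h2))
    · simp [hx]
  have hbex : ∀ {N i j d a : M}, i ≠ j → Nt i → Nt j → IsForm d → Asg a N →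
      (Tru N (qBEx i j d) a ↔ ∃ x, x ε N ∧ x ε ev a j ∧ Tru N d (upd a i x)) := by
    intro N i j d a hij hi hj hd ha
    rw [tru_iff (isForm_bex hi hj hd) ha, qBEx, sat_ex ha hi (isForm_and.2 ⟨isForm_mem hi hj, hd⟩)]
    refine exists_congr fun x => and_congr_right fun hx => ?_
    have h1 := asg_upd (i := i) ha hx
    rw [sat_and h1 (isForm_mem hi hj) hd, sat_mem h1 hi hj, ev_upd_self hi, ev_upd_ne hj hij.symm,
      tru_iff hd h1]
  have hnot : ∀ {N d a : M}, IsForm d → Asg a N → (Tru N (qNot d) a ↔ ¬ Tru N d a) := by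
    intro N d a hd ha
    rw [tru_iff (isForm_not.2 hd) ha, tru_iff hd ha, sat_not ha hd]
  have hball : ∀ {N i j d a : M}, i ≠ j → Nt i → Nt j → IsForm d → Asg a N →
      (Tru N (qBAll i j d) a ↔ ¬ Tru N (qBEx i j (qNot d)) a) := by
    intro N i j d a hij hi hj hd ha
    have h2 := isForm_not.2 hd
    have h3 := isForm_and.2 ⟨isForm_mem hi hj, h2⟩
    rw [tru_iff (isForm_ball hi hj hd) ha, tru_iff (isForm_bex hi hj h2) ha, qBAll, qBEx,
      sat_all ha hi (isForm_not.2 h3), sat_ex ha hi h3]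
    push Not
    exact forall_congr' fun x => imp_congr_right fun hx => sat_not (asg_upd ha hx) h3
  refine D0Code.induct (fun c => ∀ a, a ε AS N → a ε AS N' → (Tru N c a ↔ Tru N' c a))
    ?_ ?_ ?_ ?_ ?_ ?_ hc a (mem_AS.2 ha) (mem_AS.2 ha')
  · intro i j hi hj a ha ha'
    rw [mem_AS] at ha ha'
    rw [tru_iff (isForm_mem hi hj) ha, tru_iff (isForm_mem hi hj) ha', sat_mem ha hi hj,
      sat_mem ha' hi hj]
  · intro i j hi hj a ha ha'
    rw [mem_AS] at ha ha'
    rw [tru_iff (isForm_eq hi hj) ha, tru_iff (isForm_eq hi hj) ha', sat_eq ha hi hj,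
      sat_eq ha' hi hj]
  · intro d hd ih a ha ha'
    rw [hnot hd.isForm (mem_AS.1 ha), hnot hd.isForm (mem_AS.1 ha'), ih a ha ha']
  · intro d e hd he ih ih' a ha ha'
    have h1 := ih a ha ha'
    have h2 := ih' a ha ha'
    rw [mem_AS] at ha ha'
    have hde := isForm_and.2 ⟨hd.isForm, he.isForm⟩
    rw [tru_iff hd.isForm ha, tru_iff hd.isForm ha'] at h1
    rw [tru_iff he.isForm ha, tru_iff he.isForm ha'] at h2
    rw [tru_iff hde ha, tru_iff hde ha', sat_and ha hd.isForm he.isForm,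
      sat_and ha' hd.isForm he.isForm, h1, h2]
  · intro i j d hij hi hj hd ih a ha ha'
    rw [mem_AS] at ha ha'
    rw [hbex hij hi hj hd.isForm ha, hbex hij hi hj hd.isForm ha']
    exact exists_congr (hset hij hi hj ha ha' ih)
  · intro i j d hij hi hj hd ih a ha ha'
    rw [mem_AS] at ha ha'
    have hd' := isForm_not.2 hd.isForm
    rw [hball hij hi hj hd.isForm ha, hball hij hi hj hd.isForm ha', hbex hij hi hj hd' ha,
      hbex hij hi hj hd' ha']
    refine not_congr (exists_congr (hset hij hi hj ha ha' fun a ha ha' => ?_))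
    rw [hnot hd.isForm (mem_AS.1 ha), hnot hd.isForm (mem_AS.1 ha'), ih a ha ha']

lemma satV_zero {s : Side} {c a : M} : SatV 0 s c a ↔ D0Code c ∧ ∃ N, Tr N ∧ Tru N c a := by
  refine and_congr_right fun hc => exists_congr fun N => and_congr_right fun _ => ?_
  simp [Tru, hc.isForm]

lemma satV_zero_iff {s : Side} {N c a : M} (hN : Tr N) (ha : Asg a N) (hc : D0Code c) :
    SatV 0 s c a ↔ Tru N c a := by
  rw [satV_zero]
  constructor
  · rintro ⟨-, N', hN', h⟩
    exact (tru_abs hN' hN h.2.1 ha hc).1 h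
  · exact fun h => ⟨hc, N, hN, h⟩

lemma satV_succ {k : ℕ} {s : Side} {c a : M} (hc : LevyCode (k + 1) s c) :
    pos s (SatV (k + 1) s c a) ↔
      ∃ d b, LevyCode k s.swap d ∧ Block s c a d b ∧ pos s (SatV k s.swap d b) := by
  cases s
  · exact Iff.rfl
  · simp only [pos, SatV, hc, true_and, not_forall, exists_prop, and_assoc]; exact Iff.rfl

lemma dg_satV_zero (s : Side) : Dg M n fun p : M × M => SatV 0 s p.1 p.2 := by
  refine ⟨Sg.congr fun _ => satV_zero, ?_⟩
  have : Pg M n fun p : M × M => D0Code p.1 ∧ Fn p.2 om ∧ ∀ N, Tr N → Asg p.2 N → Tru N p.1 p.2 :=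
    inferInstance
  convert this using 2 with p
  obtain ⟨c, a⟩ := p
  constructor
  · intro h
    have h1 := satV_zero.1 h
    obtain ⟨hc, N, hN, h2⟩ := h1
    exact ⟨hc, h2.2.1.fn, fun N' hN' ha => (satV_zero_iff hN' ha hc).1 h⟩
  · rintro ⟨hc, ha, h⟩
    obtain ⟨t, ht, hat⟩ := exists_tr a
    have := asg_of_mem ha ht hat
    exact (satV_zero_iff ht this hc).2 (h t ht this)

lemma sg_pg_satV_succ {k : ℕ} (h : ∀ s, Dg M k fun p : M × M => SatV k s p.1 p.2) :
    Sg M k (fun p : M × M => SatV (k + 1) .sigma p.1 p.2) ∧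
    Pg M k (fun p : M × M => SatV (k + 1) .pi p.1 p.2) := by
  have key : ∀ s : Side, Dg M k fun q : ((M × M) × M) × M => SatV k s q.1.2 q.2 := fun s =>
    Dg.comp₂ (R := fun p : M × M => SatV k s p.1 p.2) (h s) inferInstance inferInstance
  have h1 := key .sigma
  have h2 := key .pi
  constructor
  · change Sg M k fun p : M × M => ∃ d b, LevyCode k .pi d ∧ Block .sigma p.1 p.2 d b ∧ SatV k .pi d b
    infer_instance
  · change Pg M k fun p : M × M => LevyCode (k + 1) .pi p.1 ∧ ∀ d b,
      (LevyCode k .sigma d ∧ Block .pi p.1 p.2 d b) → SatV k .sigma d b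
    infer_instance

lemma dg_satV_pair (k : ℕ) (s : Side) : Dg M k fun p : M × M => SatV k s p.1 p.2 := by
  induction k generalizing s with
  | zero => exact dg_satV_zero s
  | succ k ih =>
    obtain ⟨h1, h2⟩ := sg_pg_satV_succ ih
    cases s <;> infer_instance

instance dg_satV {k : ℕ} {s : Side} {f g : Γ → M} [hf : DFun M k f] [hg : DFun M k g] :
    Dg M k fun γ => SatV k s (f γ) (g γ) :=
  Dg.comp₂ (R := fun p : M × M => SatV k s p.1 p.2) (dg_satV_pair k s) hf hg

lemma Agree.symm {t a b : M} (h : Agree t a b) : Agree t b a := fun i hi hi' => (h i hi hi').symm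

/-- The values of the variables that do not occur in a code are irrelevant. -/
lemma satV_agree {k : ℕ} {s : Side} {t c a b : M} (ht : Tr t) (hct : c ε t) (hc : LevyCode k s c)
    (ha : Fn a om) (hb : Fn b om) (h : Agree t a b) : SatV k s c a ↔ SatV k s c b := by
  induction k generalizing s c a b with
  | zero =>
    obtain ⟨N, hN, hab⟩ := exists_tr (pr a b)
    have ha' := asg_of_mem ha hN (hN.pr_mem hab).1
    have hb' := asg_of_mem hb hN (hN.pr_mem hab).2
    rw [satV_zero_iff hN ha' hc, satV_zero_iff hN hb' hc]
    exact tru_agree ht hct h ha' hb' hc.isForm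
  | succ k ih =>
    have key : ∀ {a b}, Fn a om → Fn b om → Agree t a b → pos s (SatV (k + 1) s c a) →
        pos s (SatV (k + 1) s c b) := by
      intro a b ha hb h hs
      obtain ⟨d, a', hd, hB, hs⟩ := (satV_succ hc).1 hs
      obtain ⟨b', hB', h', hdt⟩ := hB.transfer ht hct ha hb h
      exact (satV_succ hc).2 ⟨d, b', hd, hB', (pos_congr.2 (ih hdt hd (hB.fn ha) (hB'.fn hb) h')).1 hs⟩
    exact pos_congr.1 ⟨key ha hb h, key hb ha h.symm⟩

/-! ## Elementarity -/

/-- `w = ⟨d, b⟩` is a witness for the block in front of the formula `c`, under the assignment `a`,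
where `p = ⟨c, a⟩`. -/
def Wit (k : ℕ) (s : Side) (p w : M) : Prop :=
  w = pr (fst w) (snd w) ∧ LevyCode k s.swap (fst w) ∧ Block s (fst p) (snd p) (fst w) (snd w) ∧
    pos s (SatV k s.swap (fst w) (snd w))

instance sg_wit {k : ℕ} {s : Side} {f g : Γ → M} [DFun M k f] [DFun M k g] :
    Sg M k fun γ => Wit k s (f γ) (g γ) := by
  unfold Wit; infer_instance

/-- The relation that combines the witness relations below a given level. -/
def Wits (l : ℕ) (p w : M) : Prop :=
  ∃ k < l, fst p = num k ∧ ((fst (snd p) = num 0 ∧ Wit k .sigma (snd (snd p)) w) ∨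
    (fst (snd p) = num 1 ∧ Wit k .pi (snd (snd p)) w))

lemma Sg.mono {P : Γ → Prop} {n' : ℕ} (h : Sg M n P) (hn : n ≤ n') : Sg M n' P := by
  induction hn with
  | refl => exact h
  | step _ ih => exact inferInstance

lemma sg_wits_aux {l n : ℕ} (hl : l ≤ n + 1) : Sg M n fun p : M × M => Wits l p.1 p.2 := by
  induction l with
  | zero => exact Sg.congr (Q := fun p : M × M => False) (hQ := (Dg.ofZ .falsum).sg) fun _ => by simp [Wits]
  | succ l ih =>
    have h1 := ih (by omega)
    have h2 : Sg M l fun p : M × M => fst p.1 = num l ∧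
      ((fst (snd p.1) = num 0 ∧ Wit l .sigma (snd (snd p.1)) p.2) ∨
       (fst (snd p.1) = num 1 ∧ Wit l .pi (snd (snd p.1)) p.2)) := inferInstance
    have h3 := h2.mono (n' := n) (by omega)
    refine Sg.congr (hQ := Sg.or (h1 := h1) (h2 := h3)) fun p => ?_
    simp only [Wits, Nat.lt_succ_iff_lt_or_eq, or_and_right, exists_or, exists_eq_left]

lemma wits_iff {l k : ℕ} (hk : k < l) {s : Side} {p w : M} :
    Wits l (pr (num k) (pr (num (match s with | .sigma => 0 | .pi => 1)) p)) w ↔ Wit k s p w := by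
  simp only [Wits, fst_pr, snd_pr, num_inj]
  cases s <;> simp [hk]

lemma upd_mem_V {δ a i x : M} (hδ : Lim δ) (hω : om ε δ) (ha : Fn a om) (hi : Nt i) (haV : a ε V δ)
    (hx : x ε V δ) : upd a i x ε V δ := by
  have hi' : i ε V δ := V_mono (hδ.1.1 _ hω) _ hi.mem_V_om
  obtain ⟨γ, hγ, h1, h2⟩ := hδ.exists_common haV (hδ.pr_mem.2 ⟨hi', hx⟩)
  refine V_mono (hδ.1.1 _ (hδ.2.2 _ hγ)) _ (mem_V.2 ⟨γ, by simp, fun p hp => ?_⟩)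
  obtain ⟨k, hk, rfl⟩ := (fn_upd a i x).1 p hp
  rw [ev_upd (mem_om.1 hk)]
  split_ifs with h
  · rwa [h]
  · exact tr_V γ _ h1 _ (ha.pr_mem.2 ⟨hk, rfl⟩)

lemma exists_truncation {δ a q : M} (hδ : Lim δ) (hω : om ε δ) (ha : Asg a (V δ)) (hq : Nt q) :
    ∃ b, Fn b om ∧ (∀ i, i ε q → ev a i = ev b i) ∧ b ε V δ := by
  refine nt_induction (fun q => ∃ b, Fn b om ∧ (∀ i, i ε q → ev a i = ev b i) ∧ b ε V δ) ?_ ?_ hq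
  · obtain ⟨b, hb, hb'⟩ := exists_lam (om : M) fun _ => emp
    refine ⟨b, hb, by simp, V_mono (hδ.1.1 _ (hδ.2.2 _ hω)) _ (mem_V.2 ⟨om, by simp, fun p hp => ?_⟩)⟩
    obtain ⟨k, hk, rfl⟩ := hb.1 p hp
    rw [hb' k hk]
    exact lim_om.pr_mem.2 ⟨(mem_om.1 hk).mem_V_om, nt_emp.mem_V_om⟩
  · rintro q hq ⟨b, hb, h, hbV⟩
    refine ⟨upd b q (ev a q), fn_upd _ _ _, fun i hi => ?_, upd_mem_V hδ hω hb hq hbV (ha.ev_mem hq)⟩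
    rcases mem_suc.1 hi with hi | rfl
    · rw [ev_upd_ne (hq.mem hi) (by rintro rfl; exact mem_irrefl _ hi), h i hi]
    · rw [ev_upd_self hq]

/-- An assignment with values in `V_δ` can be replaced by an element of `V_δ`. -/
lemma exists_agree {δ a c : M} (hδ : Lim δ) (hω : om ε δ) (ha : Asg a (V δ)) (hc : IsForm c) :
    ∃ t b, Tr t ∧ c ε t ∧ Fn b om ∧ Agree t a b ∧ b ε V δ := by
  obtain ⟨q, hq, hcq⟩ := lim_om.exists_mem hc.mem_V_om
  rw [mem_om] at hq
  obtain ⟨b, hb, h, hbV⟩ := exists_truncation hδ hω ha hq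
  exact ⟨V q, b, tr_V q, hcq, hb, fun i hi hi' => h i (hq.ordl.sub_V.1 ⟨hi, hi'.ordl⟩), hbV⟩

/-- `V_β` contains witnesses for all elements of `V_α`. -/
def Cl (α β : M) : Prop :=
  ∀ p, p ε V α → (∃ w, Wits (lvl M + 2) p w) → ∃ w, w ε V β ∧ Wits (lvl M + 2) p w

instance dg_cl {f g : Γ → M} [hf : DFun M (lvl M + 2) f] [hg : DFun M (lvl M + 2) g] :
    Dg M (lvl M + 2) fun γ => Cl (f γ) (g γ) := by
  have h1 : Sg M (lvl M + 1) fun p : M × M => Wits (lvl M + 2) p.1 p.2 := sg_wits_aux le_rfl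
  have h2 : Dg M (lvl M + 2) fun p : M × M => Wits (lvl M + 2) p.1 p.2 := inferInstance
  have h3 : Sg M (lvl M + 1) fun p : M => ∃ w, Wits (lvl M + 2) p w := inferInstance
  have h4 : Dg M (lvl M + 2) fun p : M => ∃ w, Wits (lvl M + 2) p w := inferInstance
  have h5 : Dg M (lvl M + 2) fun p : (M × M) × M => ∃ w, Wits (lvl M + 2) p.2 w :=
    Dg.comp₁ (R := fun p : M => ∃ w, Wits (lvl M + 2) p w) h4 inferInstance
  have h6 : Dg M (lvl M + 2) fun p : ((M × M) × M) × M => Wits (lvl M + 2) p.1.2 p.2 :=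
    Dg.comp₂ (R := fun p : M × M => Wits (lvl M + 2) p.1 p.2) h2 inferInstance inferInstance
  have h7 : Dg M (lvl M + 2) fun p : M × M => Cl p.1 p.2 := by unfold Cl; infer_instance
  exact Dg.comp₂ (R := fun p : M × M => Cl p.1 p.2) h7 hf hg

/-- If `V_δ` is closed under witnesses then it is an elementary submodel of the universe. -/
theorem tru_iff_satV {δ : M} (hδ : Lim δ) (hω : om ε δ) (hcl : Cl δ δ) {k : ℕ} (hk : k ≤ lvl M + 2)
    {s : Side} {c a : M} (hc : LevyCode k s c) (ha : Asg a (V δ)) : Tru (V δ) c a ↔ SatV k s c a := by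
  induction k generalizing s c a with
  | zero => exact (satV_zero_iff (tr_V δ) ha hc).symm
  | succ k ih =>
    replace ih := @ih (by omega)
    rw [← pos_congr (s := s)]
    constructor
    · intro h
      obtain ⟨d, b, hd, hb, hB, h⟩ := exists_block hc ha h
      exact (satV_succ hc).2 ⟨d, b, hd, hB, (pos_congr.2 (ih hd hb)).1 h⟩
    · intro h
      obtain ⟨t, a', ht, hct, ha', haa, haV⟩ := exists_agree hδ hω ha hc.isForm
      have ha'' := asg_of_mem ha' (tr_V δ) haV
      rw [pos_congr.2 (satV_agree ht hct hc ha.fn ha' haa)] at h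
      obtain ⟨d, b, hd, hB, h⟩ := (satV_succ hc).1 h
      have hm : ∀ {x : M}, x ε V om → x ε V δ := fun {x} hx => V_mono (hδ.1.1 _ hω) _ hx
      have hW : Wit k s (pr c a') (pr d b) := by simp only [Wit, fst_pr, snd_pr]; exact ⟨trivial, hd, hB, h⟩
      obtain ⟨w, hw, hW⟩ := hcl _ (hδ.pr_mem.2 ⟨hm (nt_num k).mem_V_om, hδ.pr_mem.2
        ⟨hm (nt_num _).mem_V_om, hδ.pr_mem.2 ⟨hm hc.isForm.mem_V_om, haV⟩⟩⟩)
        ⟨_, (wits_iff (s := s) (by omega)).2 hW⟩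
      obtain ⟨hw', hd, hB, h⟩ := (wits_iff (by omega)).1 hW
      rw [fst_pr, snd_pr] at hB
      rw [hw'] at hw
      have hb := asg_of_mem (hB.fn ha') (tr_V δ) (hδ.pr_mem.1 hw).2
      have := hB.tru hc.isForm ha'' hb ((pos_congr.2 (ih hd hb)).2 h)
      exact (pos_congr.2 (tru_agree ht hct haa ha ha'' hc.isForm)).2 this

end Levy

end FOSet

namespace FOSet

noncomputable section Construction

set_option linter.unusedSectionVars false
set_option synthInstance.maxHeartbeats 400000
set_option synthInstance.maxSize 2000

open TModel (lvl)

variable {M : Type} [setLang.Structure M] [TModel M] {Γ : Type} [Ctx M Γ] {n : ℕ}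

/-! ## Sequences of ordinals -/

/-- `β` is the least ordinal that is related to `α`. -/
def Least (R : M → M → Prop) (α β : M) : Prop :=
  Ordl β ∧ R α β ∧ ∀ γ, γ ε β → ¬ R α γ

lemma dg_least {R : M → M → Prop} (hR : Dg M n fun p : M × M => R p.1 p.2) {f g : Γ → M}
    (hf : DFun M n f) (hg : DFun M n g) : Dg M n fun γ => Least R (f γ) (g γ) := by
  have h2 : Dg M n fun p : (M × M) × M => R p.1.1 p.2 :=
    Dg.comp₂ (R := fun p : M × M => R p.1 p.2) hR (f := fun p : (M × M) × M => p.1.1)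
      (g := fun p : (M × M) × M => p.2) inferInstance inferInstance
  have h : Dg M n fun p : M × M => Least R p.1 p.2 := by unfold Least; infer_instance
  exact Dg.comp₂ (R := fun p : M × M => Least R p.1 p.2) h hf hg

lemma Least.unique {R : M → M → Prop} {α β β' : M} (h : Least R α β) (h' : Least R α β') : β = β' := by
  rcases h.1.trichotomy h'.1 with hb | hb | hb
  · exact absurd h.2.1 (h'.2.2 _ hb)
  · exact hb
  · exact absurd h'.2.1 (h.2.2 _ hb)

lemma exists_least_rel {R : M → M → Prop} (hR : Dg M (lvl M + 2) fun p : M × M => R p.1 p.2) {α β : M}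
    (hβ : Ordl β) (h : R α β) : ∃ β, Least R α β := by
  have h1 : Dg M (lvl M + 2) fun x : M => R α x :=
    Dg.comp₂ (R := fun p : M × M => R p.1 p.2) hR inferInstance inferInstance
  obtain ⟨γ, ⟨h1, h2⟩, h3⟩ := exists_least (fun γ => Ordl γ ∧ R α γ) ⟨hβ, h⟩
  exact ⟨γ, h1, h2, fun δ hδ hr => h3 δ hδ ⟨h1.mem hδ, hr⟩⟩

/-- `g` follows the relation `R` for `q` steps. -/
def Follows (R : M → M → Prop) (α q g : M) : Prop :=
  Fn g om ∧ ev g emp = α ∧ ∀ i, i ε q → Least R (ev g i) (ev g (suc i))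

lemma dg_follows {R : M → M → Prop} (hR : Dg M n fun p : M × M => R p.1 p.2) (α : M) {f g : Γ → M}
    (hf : DFun M n f) (hg : DFun M n g) : Dg M n fun γ => Follows R α (f γ) (g γ) := by
  have h1 : Dg M n fun p : (M × M) × M => Least R (ev p.1.2 p.2) (ev p.1.2 (suc p.2)) :=
    dg_least hR inferInstance inferInstance
  have h : Dg M n fun p : M × M => Follows R α p.1 p.2 := by unfold Follows; infer_instance
  exact Dg.comp₂ (R := fun p : M × M => Follows R α p.1 p.2) h hf hg

lemma Follows.unique {R : M → M → Prop} {α q q' g g' i : M} (h : Follows R α q g)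
    (h' : Follows R α q' g') (hq : Nt q) (hq' : Nt q') (hi : i ε suc q) (hi' : i ε suc q') :
    ev g i = ev g' i := by
  refine nt_induction (fun i => i ε suc q → i ε suc q' → ev g i = ev g' i) ?_ ?_ (hq.succ.mem hi) hi hi'
  · exact fun _ _ => h.2.1.trans h'.2.1.symm
  · intro i hi ih h1 h2
    have key : ∀ {q}, Nt q → suc i ε suc q → i ε q := by
      intro q hq h
      rcases mem_suc.1 h with h | rfl
      · exact hq.ordl.trans h (by simp)
      · simp
    have hiq := key hq h1
    have hiq' := key hq' h2
    have := h.2.2 i hiq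
    rw [ih (by simp [hiq]) (by simp [hiq'])] at this
    exact this.unique (h'.2.2 i hiq')

/-- Dependent choice for relations between ordinals. -/
lemma exists_chain {R : M → M → Prop} (hR : Dg M (lvl M + 2) fun p : M × M => R p.1 p.2)
    (h : ∀ α, Ordl α → ∃ β, Ordl β ∧ R α β) {α : M} (hα : Ordl α) :
    ∃ f, ev f emp = α ∧ ∀ i, Nt i → Ordl (ev f i) ∧ R (ev f i) (ev f (suc i)) := by
  have ordl : ∀ {q g}, Nt q → Follows R α q g → Ordl (ev g q) := by
    intro q g hq hg
    rcases hq.cases with rfl | ⟨j, hj, rfl⟩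
    · rwa [hg.2.1]
    · exact (hg.2.2 j (by simp)).1
  have ex : ∀ {q}, Nt q → ∃ g, Follows R α q g := by
    intro q hq
    have : Dg M (lvl M + 2) fun p : M × M => Follows R α p.1 p.2 :=
      dg_follows hR α inferInstance inferInstance
    refine nt_induction (fun q => ∃ g, Follows R α q g) ?_ ?_ hq
    · exact ⟨upd emp emp α, fn_upd _ _ _, ev_upd_self nt_emp, by simp⟩
    · rintro q hq ⟨g, hg⟩
      obtain ⟨β, hβ, hr⟩ := h _ (ordl hq hg)
      obtain ⟨β, hβ⟩ := exists_least_rel hR hβ hr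
      refine ⟨upd g (suc q) β, fn_upd _ _ _, ?_, fun i hi => ?_⟩
      · rw [ev_upd_ne nt_emp, hg.2.1]
        intro h
        exact not_mem_emp q (by rw [h]; simp)
      · have hi' := hq.succ.mem hi
        rw [ev_upd_ne hi' (by rintro rfl; exact mem_irrefl _ hi)]
        rcases mem_suc.1 hi with hi | rfl
        · rw [ev_upd_ne hi'.succ]
          · exact hg.2.2 i hi
          · intro h
            have : q ε suc i := by rw [h]; simp
            rcases mem_suc.1 this with h | rfl
            · exact mem_irrefl q (hq.ordl.trans hi h)
            · exact mem_irrefl _ hi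
        · rwa [ev_upd_self hi'.succ]
  have tot : ∀ q, ∃ y, (Nt q ∧ ∃ g, Follows R α q g ∧ y = ev g q) ∨ (¬ Nt q ∧ y = emp) := by
    intro q
    by_cases hq : Nt q
    · obtain ⟨g, hg⟩ := ex hq
      exact ⟨_, Or.inl ⟨hq, g, hg, rfl⟩⟩
    · exact ⟨_, Or.inr ⟨hq, rfl⟩⟩
  choose F hF using tot
  have hFn : ∀ {q g}, Nt q → Follows R α q g → F q = ev g q := by
    intro q g hq hg
    rcases hF q with ⟨-, g', hg', h⟩ | ⟨h, -⟩
    · rw [h]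
      exact hg'.unique hg hq hq (by simp) (by simp)
    · exact absurd hq h
  have : DFun M (lvl M + 2) F := by
    have : Dg M (lvl M + 2) fun p : (M × M) × M => Follows R α p.1.1 p.2 :=
      dg_follows hR α inferInstance inferInstance
    refine DFun.of_iff (Q := fun q y => (Nt q ∧ ∃ g, Follows R α q g ∧ y = ev g q) ∨ (¬ Nt q ∧ y = emp))
      fun q y => ⟨?_, ?_⟩
    · rintro rfl
      exact hF q
    · rintro (⟨hq, g, hg, rfl⟩ | ⟨hq, rfl⟩)
      · exact (hFn hq hg).symm
      · rcases hF q with ⟨h, -⟩ | ⟨-, h⟩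
        · exact absurd h hq
        · exact h.symm
  obtain ⟨f, -, hf⟩ := exists_lam om F
  refine ⟨f, ?_, fun i hi => ?_⟩
  · obtain ⟨g, hg⟩ := ex nt_emp
    rw [hf _ (mem_om.2 nt_emp), hFn nt_emp hg, hg.2.1]
  · obtain ⟨g, hg⟩ := ex hi.succ
    have h1 : Follows R α i g := ⟨hg.1, hg.2.1, fun j hj => hg.2.2 j (by simp [hj])⟩
    rw [hf _ (mem_om.2 hi), hf _ (mem_om.2 hi.succ), hFn hi.succ hg, hFn hi h1]
    exact ⟨ordl hi h1, (hg.2.2 i (by simp)).2.1⟩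

lemma Ordl.exists_gt {α β : M} (hα : Ordl α) (hβ : Ordl β) : ∃ γ, Ordl γ ∧ α ε γ ∧ β ε γ := by
  rcases hα.sub_or_mem hβ with h | h
  · exact ⟨suc β, hβ.succ, (hα.sub_iff hβ).1 h, by simp⟩
  · exact ⟨suc α, hα.succ, by simp, by simp [h]⟩

/-- An increasing sequence of ordinals has a limit. -/
lemma exists_limit {f : M} (hf : ∀ i, Nt i → Ordl (ev f i) ∧ ev f i ε ev f (suc i)) :
    ∃ δ, Lim δ ∧ (∀ i, Nt i → ev f i ε δ) ∧ ∀ z, z ε V δ ↔ ∃ i, Nt i ∧ z ε V (ev f i) := by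
  obtain ⟨r, hr⟩ := exists_lam (om : M) fun i => ev f i
  obtain ⟨δ, hδ⟩ := sep (fun z => ∃ i, Nt i ∧ z ε ev f i) (un (un (un r)))
  have hmem : ∀ z, z ε δ ↔ ∃ i, Nt i ∧ z ε ev f i := by
    intro z
    rw [hδ]
    refine and_iff_right_of_imp ?_
    rintro ⟨i, hi, hz⟩
    have h1 := hr.1.pr_mem.2 ⟨mem_om.2 hi, rfl⟩
    rw [hr.2 i (mem_om.2 hi)] at h1
    exact mem_un.2 ⟨_, right_mem_of_pr h1, hz⟩
  have hin : ∀ i, Nt i → ev f i ε δ := fun i hi => (hmem _).2 ⟨_, hi.succ, (hf i hi).2⟩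
  refine ⟨δ, ⟨⟨fun x hx y hy => ?_, fun x hx => ?_⟩, ?_, fun x hx => ?_⟩, hin, fun z => ?_⟩
  · obtain ⟨i, hi, hx⟩ := (hmem x).1 hx
    exact (hmem y).2 ⟨i, hi, (hf i hi).1.trans hx hy⟩
  · obtain ⟨i, hi, hx⟩ := (hmem x).1 hx
    exact ((hf i hi).1.mem hx).1
  · have h1 := (hf emp nt_emp).2
    rcases ordl_emp.trichotomy (hf _ nt_emp.succ).1 with h | h | h
    · exact (hmem _).2 ⟨_, nt_emp.succ, h⟩
    · rw [← h] at h1; exact absurd h1 (not_mem_emp _)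
    · exact absurd h (not_mem_emp _)
  · obtain ⟨i, hi, hx⟩ := (hmem x).1 hx
    have h1 := ((hf i hi).1.mem hx)
    rcases h1.succ.trichotomy (hf i hi).1 with h | h | h
    · exact (hmem _).2 ⟨i, hi, h⟩
    · rw [h]; exact hin i hi
    · rcases mem_suc.1 h with h | h
      · exact absurd (h1.trans h hx) (mem_irrefl x)
      · rw [h] at hx; exact absurd hx (mem_irrefl x)
  · constructor
    · intro hz
      obtain ⟨y, hy, hz⟩ := mem_V.1 hz
      obtain ⟨i, hi, hy⟩ := (hmem y).1 hy
      exact ⟨i, hi, mem_V.2 ⟨y, hy, hz⟩⟩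
    · rintro ⟨i, hi, hz⟩
      exact V_mono (fun x hx => (hmem x).2 ⟨i, hi, hx⟩) z hz

/-! ## Closed ordinals -/

lemma exists_cl (α : M) : ∃ β, Ordl β ∧ ∀ β', Sub β β' → Cl α β' := by
  have h1 : Sg M (lvl M + 1) fun p : M × M => Wits (lvl M + 2) p.1 p.2 := sg_wits_aux le_rfl
  have h2 : Dg M (lvl M + 2) fun p : M × M => Wits (lvl M + 2) p.1 p.2 := inferInstance
  have h3 : Sg M (lvl M + 1) fun p : M => ∃ w, Wits (lvl M + 2) p w := inferInstance
  obtain ⟨W, hW⟩ := sep (fun p => ∃ w, Wits (lvl M + 2) p w) (V α)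
  obtain ⟨C, hC⟩ := coll (fun p w => Wits (lvl M + 2) p w) W fun p hp => ((hW p).1 hp).2
  obtain ⟨β, hβ, hCβ⟩ := exists_sub_V C
  refine ⟨β, hβ, fun β' hβ' p hp hw => ?_⟩
  obtain ⟨w, hw, h⟩ := hC p ((hW p).2 ⟨hp, hw⟩)
  exact ⟨w, V_mono hβ' _ (hCβ _ hw), h⟩

/-- `δ` is a limit ordinal above `ω`, and `V_δ` is closed under witnesses. -/
def Clo (δ : M) : Prop := Lim δ ∧ om ε δ ∧ Cl δ δ

lemma exists_clo {α : M} (hα : Ordl α) : ∃ δ, α ε δ ∧ Clo δ := by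
  obtain ⟨α₀, h0, hα0, hω⟩ := hα.exists_gt ordl_om
  obtain ⟨f, hf0, hf⟩ := exists_chain (R := fun α β => α ε β ∧ Cl α β) inferInstance (fun α hα => by
    obtain ⟨β, hβ, h⟩ := exists_cl α
    obtain ⟨γ, hγ, h1, h2⟩ := hα.exists_gt hβ
    exact ⟨γ, hγ, h1, h γ (hγ.1 β h2)⟩) h0
  obtain ⟨δ, hδ, hin, hV⟩ := exists_limit fun i hi => ⟨(hf i hi).1, (hf i hi).2.1⟩
  have h1 := hin _ nt_emp
  rw [hf0] at h1
  refine ⟨δ, hδ.1.trans h1 hα0, hδ, hδ.1.trans h1 hω, fun p hp hw => ?_⟩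
  obtain ⟨i, hi, hp⟩ := (hV p).1 hp
  obtain ⟨w, hw, h⟩ := (hf i hi).2.2 p hp hw
  exact ⟨w, (hV w).2 ⟨_, hi.succ, hw⟩, h⟩

instance dg_lim {f : Γ → M} [hf : DFun M n f] : Dg M n fun γ => Lim (f γ) :=
  Dg.comp₁ (R := Lim) (by unfold Lim; infer_instance) hf

lemma exists_clo_chain : ∃ f β : M, (∀ i, Nt i → Clo (ev f i) ∧ ev f i ε ev f (suc i) ∧ ev f i ε β) ∧
    Clo β ∧ ∀ z, z ε V β ↔ ∃ i, Nt i ∧ z ε V (ev f i) := by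
  obtain ⟨α, -, hα⟩ := exists_clo (ordl_emp (M := M))
  obtain ⟨f, hf0, hf⟩ := exists_chain (R := fun α β => α ε β ∧ Clo β) (by unfold Clo; infer_instance)
    (fun α hα => (exists_clo hα).imp fun δ hδ => ⟨hδ.2.1.1, hδ⟩) hα.1.1
  have hclo : ∀ i, Nt i → Clo (ev f i) := by
    intro i hi
    rcases hi.cases with rfl | ⟨j, hj, rfl⟩
    · rwa [hf0]
    · exact (hf j hj).2.2
  obtain ⟨β, hβ, hin, hV⟩ := exists_limit fun i hi => ⟨(hf i hi).1, (hf i hi).2.1⟩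
  refine ⟨f, β, fun i hi => ⟨hclo i hi, (hf i hi).2.1, hin i hi⟩,
    ⟨hβ, hβ.1.trans (hin _ nt_emp) (hclo _ nt_emp).2.1, fun p hp hw => ?_⟩, hV⟩
  obtain ⟨i, hi, hp⟩ := (hV p).1 hp
  obtain ⟨w, hw, h⟩ := (hclo i hi).2.2 p hp hw
  exact ⟨w, (hV w).2 ⟨_, hi, hw⟩, h⟩

/-! ## The model -/

lemma Clo.piElem {δ : M} (h : Clo δ) : PiElem (lvl M + 1) (V δ) := by
  refine ⟨⟨_, sub_V δ _ h.2.1⟩, fun c a ⟨hc, ha⟩ => ?_⟩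
  rw [← tru_iff hc.isForm ha]
  exact tru_iff_satV h.1 h.2.1 h.2.2 (by omega) hc ha

lemma sat1_iff {N c a i x : M} (hc : IsForm c) (ha : Asg a N) (hi : Nt i) (hx : x ε N) :
    Sat1 N c a i x ↔ Tru N c (upd a i x) := by
  simp only [Sat1, upd_iff ha.fn hi, exists_eq_left, tru_iff hc (asg_upd ha hx)]

lemma sat2_iff {N c a i x j y : M} (hc : IsForm c) (ha : Asg a N) (hi : Nt i) (hx : x ε N) (hj : Nt j)
    (hy : y ε N) : Sat2 N c a i x j y ↔ Tru N c (upd (upd a i x) j y) := by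
  simp only [Sat2, upd_iff ha.fn hi, exists_eq_left, sat1_iff hc (asg_upd ha hx) hj hy]

lemma modelsSep_V (β : M) : ModelsSep (V β) := by
  rintro c a i ⟨hc, ha, hi⟩ w hw
  obtain ⟨y, hy⟩ := sep (fun x => Tru (V β) c (upd a i x)) w
  refine ⟨y, V_of_sub hw fun x hx => ((hy x).1 hx).1, fun x hx => ?_⟩
  rw [hy, sat1_iff hc ha hi hx]

lemma modelsStrongColl_V {β : M} (hβ : Clo β) (h : ∀ x, x ε V β → ∃ γ, γ ε β ∧ Clo γ ∧ x ε V γ) :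
    ModelsStrongColl (lvl M + 1) (V β) := by
  rintro c a i j ⟨hc, ha, hi, hj, -⟩ w hw
  have hq : LevyCode (lvl M + 2) .sigma (qQ .sigma j c) := LevyCode.quant hj hc.base
  obtain ⟨t, b, ht, hqt, hb, hab, hbV⟩ := exists_agree hβ.1 hβ.2.1 ha hq.isForm
  obtain ⟨γ, hγ, hγc, hm⟩ := h _ (hβ.1.pr_mem.2 ⟨hbV, hw⟩)
  obtain ⟨hbγ, hwγ⟩ := mem_V_of_pr hm
  have hγβ : Sub (V γ) (V β) := V_mono (hβ.1.1.1 _ hγ)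
  have hbA := asg_of_mem hb (tr_V γ) hbγ
  refine ⟨V γ, V_mem hγ, fun x hx hxw => ?_⟩
  rintro ⟨y, hy, hs⟩
  have hxγ := tr_V γ _ hwγ _ hxw
  rw [sat2_iff hc.isForm ha hi hx hj hy] at hs
  have h1 : Tru (V β) (qQ .sigma j c) (upd a i x) :=
    (tru_qQ (s := .sigma) hj hc.isForm (asg_upd ha hx)).2 ⟨y, hy, hs⟩
  rw [tru_iff_satV hβ.1 hβ.2.1 hβ.2.2 le_rfl hq (asg_upd ha hx),
    satV_agree ht hqt hq (fn_upd _ _ _) (fn_upd _ _ _) (hab.upd i x),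
    ← tru_iff_satV hγc.1 hγc.2.1 hγc.2.2 le_rfl hq (asg_upd hbA hxγ)] at h1
  obtain ⟨z, hz, h2⟩ := (tru_qQ (s := .sigma) hj hc.isForm (asg_upd hbA hxγ)).1 h1
  change Tru _ _ _ at h2
  have hzβ := hγβ _ hz
  refine ⟨z, hzβ, hz, ?_⟩
  have hbx := asg_upd (i := j) (asg_upd (i := i) hbA hxγ) hz
  rw [tru_iff_satV hγc.1 hγc.2.1 hγc.2.2 (by omega) hc hbx,
    ← tru_iff_satV hβ.1 hβ.2.1 hβ.2.2 (by omega) hc (hbx.mono hγβ)] at h2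
  have hax := asg_upd (i := j) (asg_upd (i := i) ha hx) hzβ
  rw [sat2_iff hc.isForm ha hi hx hj hzβ]
  exact (tru_agree ht (ht.of_qQ hqt) ((hab.upd i x).upd j z) hax (hbx.mono hγβ) hc.isForm).2 h2

lemma ModelsStrongColl.coll {m : ℕ} {N : M} (h : ModelsStrongColl m N) : ModelsColl m N := by
  intro c a i j hc w hw hx
  obtain ⟨C, hC, h⟩ := h c a i j hc w hw
  exact ⟨C, hC, fun x hx' hxw => h x hx' hxw (hx x hx' hxw)⟩

lemma chainUnion_V {f β : M}
    (hf : ∀ i, Nt i → Clo (ev f i) ∧ ev f i ε ev f (suc i) ∧ ev f i ε β)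
    (hV : ∀ z, z ε V β ↔ ∃ i, Nt i ∧ z ε V (ev f i)) : ChainUnion (lvl M + 1) (V β) := by
  obtain ⟨g, hg, hgf⟩ := exists_lam om fun i => V (ev f i)
  have hap : ∀ {i x}, Ap g i x ↔ Nt i ∧ x = V (ev f i) := by
    intro i x
    rw [ap_iff, hg.pr_mem, mem_om]
    exact and_congr_right fun hi => by rw [hgf i (mem_om.2 hi)]
  refine ⟨g, seqS_iff.2 hg, fun i x h => ?_, fun i j x y h => ?_, fun z => ?_⟩
  · obtain ⟨hi, rfl⟩ := hap.1 h
    exact ⟨(hf i hi).1.piElem, _, (hf i hi).1.1.1, (hf i hi).1.1.1.vv⟩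
  · obtain ⟨h, h1, h2⟩ := h
    obtain ⟨hi, rfl⟩ := hap.1 h1
    obtain ⟨-, rfl⟩ := hap.1 h2
    rw [isSuc_iff.1 h]
    exact V_mem (hf i hi).2.1
  · rw [hV]
    simp only [hap]
    constructor
    · rintro ⟨i, hi, hz⟩
      exact ⟨i, _, ⟨hi, rfl⟩, hz⟩
    · rintro ⟨i, x, ⟨hi, rfl⟩, hz⟩
      exact ⟨i, hi, hz⟩

section Axioms

variable {β N x : M}

/-- An element of `N`, as an element of the substructure. -/
def El.mk (h : x ε N) : El N := ⟨x, h⟩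
/-- The set that is given by an element of the substructure. -/
def El.val (x : El N) : M := x.1
@[simp] lemma El.val_mk (h : x ε N) : (El.mk h).val = x := rfl
lemma El.val_mem (x : El N) : x.val ε N := x.2
lemma El.mem_val_iff (x y : El N) : x ε y ↔ x.val ε y.val := El.mem_iff x y
lemma El.eq_iff (x y : El N) : x = y ↔ x.val = y.val := Subtype.ext_iff

lemma models_ext (hN : Tr N) : El N ⊨ axExt := by
  refine realize_axExt.2 fun x y h => (El.eq_iff x y).2 (ext fun z => ⟨fun hz => ?_, fun hz => ?_⟩)
  · exact (El.mem_val_iff (El.mk (hN _ x.val_mem _ hz)) y).1 ((h _).1 ((El.mem_val_iff _ _).2 hz))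
  · exact (El.mem_val_iff (El.mk (hN _ y.val_mem _ hz)) x).1 ((h _).2 ((El.mem_val_iff _ _).2 hz))

lemma models_empty (hβ : Lim β) : El (V β) ⊨ axEmpty :=
  realize_axEmpty.2 ⟨El.mk (sub_V β _ hβ.2.1), fun z hz => not_mem_emp z.val ((El.mem_val_iff _ _).1 hz)⟩

lemma models_pair (hβ : Lim β) : El (V β) ⊨ axPair := by
  refine realize_axPair.2 fun x y => ?_
  obtain ⟨γ, hγ, hx, hy⟩ := hβ.exists_common x.val_mem y.val_mem
  refine ⟨El.mk (x := upr x.val y.val) (mem_V.2 ⟨γ, hγ, fun z hz => ?_⟩), fun z => ?_⟩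
  · rcases mem_upr.1 hz with rfl | rfl <;> assumption
  · simp only [El.mem_val_iff, El.val_mk, mem_upr, El.eq_iff]

lemma models_union (hβ : Lim β) : El (V β) ⊨ axUnion := by
  refine realize_axUnion.2 fun x => ?_
  obtain ⟨γ, hγ, hx⟩ := hβ.exists_mem x.val_mem
  refine ⟨El.mk (x := un x.val) (mem_V.2 ⟨γ, hγ, fun z hz => ?_⟩), fun z => ?_⟩
  · obtain ⟨y, hy, hz⟩ := mem_un.1 hz
    exact tr_V γ _ (tr_V γ _ hx _ hy) _ hz
  · simp only [El.mem_val_iff, El.val_mk, mem_un]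
    exact ⟨fun ⟨y, hy, hz⟩ => ⟨El.mk (tr_V β _ x.val_mem _ hy), hy, hz⟩, fun ⟨y, hy, hz⟩ => ⟨_, hy, hz⟩⟩

lemma models_diff (β : M) : El (V β) ⊨ axDiff := by
  refine realize_axDiff.2 fun x y => ?_
  obtain ⟨d, hd⟩ := TModel.diff x.val y.val
  refine ⟨El.mk (V_of_sub x.val_mem fun z hz => ((hd z).1 hz).1), fun z => ?_⟩
  simp only [El.mem_val_iff, El.val_mk, hd]

lemma models_power (hβ : Lim β) : El (V β) ⊨ axPower := by
  refine realize_axPower.2 fun x => ?_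
  obtain ⟨γ, hγ, hx⟩ := hβ.exists_mem x.val_mem
  refine ⟨El.mk (x := pw x.val) (mem_V.2 ⟨γ, hγ, fun z hz => V_of_sub hx (mem_pw.1 hz)⟩), fun z => ?_⟩
  simp only [El.mem_val_iff, El.val_mk, mem_pw, Sub]
  exact ⟨fun h y hy => h _ hy, fun h y hy => h (El.mk (tr_V β _ z.val_mem _ hy)) hy⟩

lemma models_inf (hβ : Lim β) (hω : om ε β) : El (V β) ⊨ axInf := by
  refine realize_axInf.2 ⟨El.mk (sub_V β _ hω), ⟨El.mk (sub_V β _ hβ.2.1), ?_, fun z hz => ?_⟩,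
    fun y hy => ?_⟩
  · exact (El.mem_val_iff _ _).2 (mem_om.2 nt_emp)
  · exact not_mem_emp z.val ((El.mem_val_iff _ _).1 hz)
  · have h := mem_om.2 (mem_om.1 ((El.mem_val_iff _ _).1 hy)).succ
    refine ⟨El.mk (sub_V β _ (hβ.1.trans hω h)), (El.mem_val_iff _ _).2 h, fun z => ?_⟩
    simp only [El.mem_val_iff, El.val_mk, mem_suc, El.eq_iff]

lemma models_found (β : M) : El (V β) ⊨ axFound := by
  refine realize_axFound.2 fun z ⟨x, hx⟩ => ?_
  obtain ⟨y, hy, h⟩ := TModel.found z.val ⟨x.val, (El.mem_val_iff _ _).1 hx⟩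
  exact ⟨El.mk (tr_V β _ z.val_mem _ hy), (El.mem_val_iff _ _).2 hy, fun w hw hw' =>
    h w.val ((El.mem_val_iff _ _).1 hw) ((El.mem_val_iff _ _).1 hw')⟩

end Axioms

attribute [local instance] liftVar

lemma realize_modelsZ {k : ℕ} {β : M} (v : Empty → M) (xs : Fin k → M) (N : Fin k) (hN : xs N = V β)
    (hβ : Lim β) (hω : om ε β) : (modelsZ N).Realize v xs := by
  simp only [modelsZ, realize_andF, realize_models, realize_modelsSep, hN]
  have h : ∀ σ : setLang.Sentence, El (V β) ⊨ σ → El (xs N) ⊨ σ := fun σ h => by rwa [hN]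
  exact ⟨h _ (models_ext (tr_V β)), h _ (models_empty hβ), h _ (models_pair hβ), h _ (models_union hβ),
    h _ (models_diff β), h _ (models_power hβ), h _ (models_inf hβ hω), h _ (models_found β),
    modelsSep_V β⟩

end Construction

/-- Every model of the theory satisfies the sentence. -/
theorem realize_transitiveModelSentence {M : Type} [setLang.Structure M] [TModel M] :
    M ⊨ transitiveModelSentence (TModel.lvl M + 1) := by
  obtain ⟨f, β, hf, hβ, hV⟩ := exists_clo_chain (M := M)
  rw [transitiveModelSentence, realize_closure]
  intro xs
  have hs := modelsStrongColl_V hβ fun x hx => by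
    obtain ⟨i, hi, hx⟩ := (hV x).1 hx
    exact ⟨_, (hf i hi).2.2, (hf i hi).1, hx⟩
  rw [realize_exF]
  refine ⟨β, ?_⟩
  rw [realize_exF]
  refine ⟨V β, ?_⟩
  simp only [realize_andF, realize_isOrd, realize_isV, realize_isTrans, realize_modelsColl,
    realize_modelsStrongColl, realize_isPiElemChainUnion]
  have h1 : (Fin.snoc (Fin.snoc xs β : Fin 1 → M) (V β) : Fin 2 → M) (Fin.last 1) = V β := by
    simp [Fin.snoc]
  have h0 : (Fin.snoc (Fin.snoc xs β : Fin 1 → M) (V β) : Fin 2 → M) (Fin.castSucc (Fin.last 0)) = β := by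
    simp [Fin.snoc]
  refine ⟨?_, ?_, ?_, realize_modelsZ _ _ _ h1 hβ.1 hβ.2.1, ?_, ?_, ?_⟩
  · exact h0.symm ▸ hβ.1.1
  · rw [h1, h0]; exact hβ.1.1.vv
  · rw [h1]; exact tr_V β
  · rw [h1]; exact hs.coll
  · rw [h1]; exact hs
  · rw [h1]; exact chainUnion_V hf hV

end FOSet

theorem mainTheorem2 (m : ℕ) (hm : 1 ≤ m) :
    FOSet.theoryM ∪ FOSet.piCollection (m + 1) ∪ FOSet.sigmaInduction (m + 2) ⊨ᵇ
      FOSet.transitiveModelSentence m := by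
  obtain ⟨l, rfl⟩ := Nat.exists_eq_add_of_le' hm
  intro M v xs
  have h : M ⊨ FOSet.transitiveModelSentence (l + 1) :=
    @FOSet.realize_transitiveModelSentence M _ (FOSet.TModel.ofTheory M l M.is_model)
  rwa [Subsingleton.elim v default, Subsingleton.elim xs default]
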